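/- **Setting.** Let $\mathcal S$ be a non-compact (connected) Riemann surface, $o\in\mathcal S$, and let $\mathscr S$ be a holomorphic $1$-form on $\mathcal S$ without zeros such that $\int_c\mathscr S=0$ for every piecewise $C^1$ closed curve $c$ in $\mathcal S$. Put $\hat x=\int_o^x\mathscr S$ and assume that $\hat x=0$ only for $x=o$. Let $D(r)=\{x\in\mathcal S:|\hat x|<r\}$ and $C(r)=\{x\in\mathcal S:|\hat x|=r\}$. Assume that $\mathcal S$ is $\mathscr S$-exhausted: for all $0<r_1<r_2<\cdots$ with $r_n\to\infty$ one has $\bigcup_n D(r_n)=\mathcal S$, and either every $\overline{D(r_n)}$ is compact and contained in $D(r_{n+1})$, or there is $k\ge1$ such that this holds for all $n<k$ while $D(r_n)=\mathcal S$ for all $n\ge k$. Let $R=\sup\{r>0: C(r)\neq\emptyset\}\in(0,\infty]$ and fix $r_0\in(0,R)$. Let $h$ be a smooth Hermitian metric on $\mathcal S$, locally $ds^2=\lambda|dz|^2$, with Gauss curvature $K=-\frac1{2\lambda}\left(\frac{\partial^2}{\partial x^2}+\frac{\partial^2}{\partial y^2}\right)\log\lambda$ ($z=x+iy$), and let $\|\mathscr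 S\|_h=|\varphi|/\sqrt\lambda$ where $\mathscr S=\varphi\,dz$. Put $$\|\mathscr S\|_{r,\sup}=\sup_{D(r)}\|\mathscr S\|_h,\qquad \|\mathscr S\|_{r,\inf}=\inf_{D(r)}\|\mathscr S\|_h .$$ For a nonconstant meromorphic function $f$ on $\mathcal S$ (a holomorphic map to $\overline{\mathbb C}$) and $a\in\overline{\mathbb C}$ let $$T_f(r)=\int_{r_0}^r\frac{dt}{t}\int_{D(t)}f^*\omega_{FS},\qquad \overline N_f(r,a)=\int_{r_0}^r\frac{\overline n_f(t,a)}{t}\,dt,\qquad \bar\delta_f(a)=1-\limsup_{r\to R^-}\frac{\overline N_f(r,a)}{T_f(r)},$$ where $\omega_{FS}=\frac{i}{2\pi}\partial\bar\partial\log(1+|\zeta|^2)$ and $\overline n_f(t,a)$ is the number of points of $D(t)$ at which $f=a$, without multiplicities. **Theorem.** In this setting let $C\ge0$ be a constant with $-C\le K\le0$ on $\mathcal S$, and let $\gamma>0$ be a function on $(0,R)$ that is integrable on $(0,r]$ for every $r<R$ and satisfies $\int_0^R\gamma(r)\,dr=\infty$. Let $f$ be a nonconstant meromorphic function on $\mathcal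 S$ and let $a_1,\dots,a_q\in\overline{\mathbb C}$ be distinct. If $$\limsup_{r\to R^-}\frac{C r^2\,\|\mathscr S\|_{r,\inf}^{-1}+\log\bigl(\gamma(r)\,\|\mathscr S\|_{r,\sup}\bigr)}{T_f(r)}=0,$$ then $$\sum_{j=1}^q\bar\delta_f(a_j)\le 2 .$$ -/

import Mathlib

open Set Filter Topology MeasureTheory
open scoped ContDiff Manifold ENNReal

noncomputable section

namespace SNevanlinna

/-- A holomorphic `1`-form on a Riemann surface `S`, given by its coefficients: in the chart `e`
the form is `coeff e z dz`.  Only charts of the atlas matter. -/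
structure HolomorphicForm (S : Type*) [TopologicalSpace S] [ChartedSpace ℂ S] where
  coeff : OpenPartialHomeomorph S ℂ → ℂ → ℂ
  holomorphic : ∀ e ∈ atlas ℂ S, DifferentiableOn ℂ (coeff e) e.target
  compatible : ∀ e ∈ atlas ℂ S, ∀ e' ∈ atlas ℂ S, ∀ x ∈ e.source ∩ e'.source,
    coeff e (e x) = coeff e' (e' x) * deriv (e' ∘ e.symm) (e x)

/-- A smooth Hermitian metric on a Riemann surface `S`: in the chart `e` the length element is
`ds² = coeff e z |dz|²` with `coeff e` smooth and positive. -/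
structure HermitianMetric (S : Type*) [TopologicalSpace S] [ChartedSpace ℂ S] where
  coeff : OpenPartialHomeomorph S ℂ → ℂ → ℝ
  smooth : ∀ e ∈ atlas ℂ S, ContDiffOn ℝ ∞ (coeff e) e.target
  pos : ∀ e ∈ atlas ℂ S, ∀ z ∈ e.target, 0 < coeff e z
  compatible : ∀ e ∈ atlas ℂ S, ∀ e' ∈ atlas ℂ S, ∀ x ∈ e.source ∩ e'.source,
    coeff e (e x) = coeff e' (e' x) * ‖deriv (e' ∘ e.symm) (e x)‖ ^ 2

section Surface

variable {S : Type*} [TopologicalSpace S] [ChartedSpace ℂ S]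

/-- The Gauss curvature of `ds² = l |dz|²`, namely `K = -(1 / (2 l)) Δ (log l)` with `Δ` the
Euclidean Laplacian of the coordinate plane. -/
def gaussCurvature (h : HermitianMetric S) (x : S) : ℝ :=
  -(1 / (2 * h.coeff (chartAt ℂ x) (chartAt ℂ x x))) *
    Laplacian.laplacian (fun z : ℂ => Real.log (h.coeff (chartAt ℂ x) z)) (chartAt ℂ x x)

/-- The pointwise norm of a form with respect to a metric: `|φ dz| = |φ| / √l` for
`ds² = l |dz|²`. -/
def formNorm (h : HermitianMetric S) (η : HolomorphicForm S) (x : S) : ℝ :=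
  ‖η.coeff (chartAt ℂ x) (chartAt ℂ x x)‖ / √(h.coeff (chartAt ℂ x) (chartAt ℂ x x))

/-- `c`, restricted to `[0, 1]`, is a piecewise continuously differentiable curve in `S`. -/
def IsPiecewiseC1 (c : ℝ → S) : Prop :=
  ContinuousOn c (Icc 0 1) ∧
    ∃ (n : ℕ) (t : ℕ → ℝ), t 0 = 0 ∧ t n = 1 ∧ (∀ i < n, t i < t (i + 1)) ∧
      ∀ i < n, ∀ e ∈ atlas ℂ S,
        ContDiffOn ℝ 1 (e ∘ c) (Icc (t i) (t (i + 1)) ∩ c ⁻¹' e.source)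

/-- The integral of a form along the curve `c : [0, 1] → S`. -/
def curveIntegral (η : HolomorphicForm S) (c : ℝ → S) : ℂ :=
  ∫ t in (0 : ℝ)..1, η.coeff (chartAt ℂ (c t)) (chartAt ℂ (c t) (c t)) *
    deriv (fun s => chartAt ℂ (c t) (c s)) t

open Classical in
/-- `x̂ = ∫_o^x η`, the integral along a piecewise `C¹` curve from `o` to `x`; when `η` has no
periods the choice of the curve is immaterial. -/
def hat (η : HolomorphicForm S) (o x : S) : ℂ :=
  if H : ∃ c : ℝ → S, IsPiecewiseC1 c ∧ c 0 = o ∧ c 1 = x then curveIntegral η H.choose else 0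

/-- `η` makes `S` an `η`-Riemann surface with base point `o`: it has no zeros, it has no periods,
and `x̂ = 0` only at `x = o`. -/
structure IsSRiemannSurface (η : HolomorphicForm S) (o : S) : Prop where
  ne_zero : ∀ e ∈ atlas ℂ S, ∀ z ∈ e.target, η.coeff e z ≠ 0
  period_eq_zero : ∀ c : ℝ → S, IsPiecewiseC1 c → c 0 = c 1 → curveIntegral η c = 0
  hat_eq_zero_iff : ∀ x, hat η o x = 0 ↔ x = o

/-- The disc `{x : |x̂| < r}`. -/
def disc (η : HolomorphicForm S) (o : S) (r : ℝ) : Set S := {x | ‖hat η o x‖ < r}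

/-- The circle `{x : |x̂| = r}`. -/
def circle (η : HolomorphicForm S) (o : S) (r : ℝ) : Set S := {x | ‖hat η o x‖ = r}

/-- `η` is an exhaustion form: the discs of any radii `0 < r₀ < r₁ < ⋯ → ∞` exhaust `S`, either
by relatively compact discs for ever (parabolic), or by relatively compact discs until they are
all of `S` (hyperbolic). -/
def IsExhaustionForm (η : HolomorphicForm S) (o : S) : Prop :=
  ∀ r : ℕ → ℝ, 0 < r 0 → StrictMono r → Tendsto r atTop atTop →
    (⋃ n, disc η o (r n)) = univ ∧
    ((∀ n, IsCompact (closure (disc η o (r n))) ∧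
        closure (disc η o (r n)) ⊆ disc η o (r (n + 1))) ∨
      ∃ k, (∀ n < k, IsCompact (closure (disc η o (r n))) ∧
          closure (disc η o (r n)) ⊆ disc η o (r (n + 1))) ∧
        ∀ n ≥ k, disc η o (r n) = univ)

/-- The radius `sup {r > 0 : circle of radius r is not empty}`, possibly `∞`. -/
def radius (η : HolomorphicForm S) (o : S) : EReal :=
  sSup {R : EReal | ∃ r : ℝ, 0 < r ∧ (circle η o r).Nonempty ∧ R = r}

/-- The filter of real numbers tending to the radius from below. -/
def toRadius (η : HolomorphicForm S) (o : S) : Filter ℝ :=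
  comap (fun r : ℝ => (r : EReal)) (𝓝[<] radius η o)

/-- `sup {‖η_x‖ : |x̂| < r}`. -/
def supNorm (h : HermitianMetric S) (η : HolomorphicForm S) (o : S) (r : ℝ) : ℝ :=
  sSup (formNorm h η '' disc η o r)

/-- `inf {‖η_x‖ : |x̂| < r}`. -/
def infNorm (h : HermitianMetric S) (η : HolomorphicForm S) (o : S) (r : ℝ) : ℝ :=
  sInf (formNorm h η '' disc η o r)

/-- The affine coordinate `ζ` of the Riemann sphere (junk value `0` at `∞`). -/
def affineCoord (p : OnePoint ℂ) : ℂ := p.elim 0 id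

/-- The coordinate `1 / ζ` of the Riemann sphere, which is `0` at `∞` (junk value `0` at `0`). -/
def infinityCoord (p : OnePoint ℂ) : ℂ := p.elim 0 fun z => z⁻¹

open Classical in
/-- A coordinate of the Riemann sphere that is valid near `p`. -/
def sphereCoord (p : OnePoint ℂ) : OnePoint ℂ → ℂ :=
  if p = OnePoint.infty then infinityCoord else affineCoord

/-- A meromorphic function on `S`, as a holomorphic map from `S` to the Riemann sphere. -/
def IsMeromorphic (f : S → OnePoint ℂ) : Prop :=
  Continuous f ∧ ∀ e ∈ atlas ℂ S, ∀ z ∈ e.target,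
    AnalyticAt ℂ (fun w => sphereCoord (f (e.symm z)) (f (e.symm w))) z

/-- The pull-back of the Fubini-Study form
`ω_FS = dd^c log (1 + |ζ|²) = (i / 2π) dζ ∧ dζ̄ / (1 + |ζ|²)²` (same formula in `1 / ζ`) by `f`:
in the chart `e` it is this density times Lebesgue measure. -/
def pullbackFS (f : S → OnePoint ℂ) (e : OpenPartialHomeomorph S ℂ) (z : ℂ) : ℝ≥0∞ :=
  let u : ℂ → ℂ := fun w => sphereCoord (f (e.symm z)) (f (e.symm w))
  ENNReal.ofReal (1 / Real.pi * (‖deriv u z‖ / (1 + ‖u z‖ ^ 2)) ^ 2)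

/-- The integral over `A` of the nonnegative `(1,1)`-form whose density in the chart `e` is
`ρ e`: the supremum, over finite families of disjoint pieces of `A` that lie in chart domains, of
the sum of the integrals over the pieces. -/
def integralForm (ρ : OpenPartialHomeomorph S ℂ → ℂ → ℝ≥0∞) (A : Set S) : ℝ≥0∞ :=
  ⨆ (n : ℕ) (e : Fin n → OpenPartialHomeomorph S ℂ) (W : Fin n → Set ℂ)
    (_ : ∀ i, e i ∈ atlas ℂ S ∧ MeasurableSet (W i) ∧ W i ⊆ (e i).target ∧
      (e i).symm '' W i ⊆ A)
    (_ : Pairwise fun i j => Disjoint ((e i).symm '' W i) ((e j).symm '' W j)),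
    ∑ i, ∫⁻ z in W i, ρ (e i) z

/-- The characteristic function `T_f(r) = ∫_{r₀}^r (dt / t) ∫_{D(t)} f^* ω_FS`. -/
def charT (η : HolomorphicForm S) (o : S) (r₀ : ℝ) (f : S → OnePoint ℂ) (r : ℝ) : ℝ :=
  ∫ t in r₀..r, (integralForm (pullbackFS f) (disc η o t)).toReal / t

/-- The number of `a`-points of `f` in the disc of radius `t`, without multiplicities. -/
def simpleCount (η : HolomorphicForm S) (o : S) (f : S → OnePoint ℂ) (a : OnePoint ℂ)
    (t : ℝ) : ℕ :=
  {x | x ∈ disc η o t ∧ f x = a}.ncard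

/-- The simple counting function `∫_{r₀}^r n̄_f(t, a) dt / t`. -/
def simpleN (η : HolomorphicForm S) (o : S) (r₀ : ℝ) (f : S → OnePoint ℂ) (a : OnePoint ℂ)
    (r : ℝ) : ℝ :=
  ∫ t in r₀..r, (simpleCount η o f a t : ℝ) / t

/-- The simple defect `1 - limsup_{r → R} N̄_f(r, a) / T_f(r)`. -/
def simpleDefect (η : HolomorphicForm S) (o : S) (r₀ : ℝ) (f : S → OnePoint ℂ)
    (a : OnePoint ℂ) : EReal :=
  1 - limsup (fun r : ℝ => ((simpleN η o r₀ f a r / charT η o r₀ f r : ℝ) : EReal))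
    (toRadius η o)

end Surface

end SNevanlinna

end

noncomputable section

namespace SNevanlinna

/-! The form has no zeros and no periods, so `hat` is a holomorphic function with nonvanishing
derivative, hence a local homeomorphism. It takes the value 0 only once and its discs are relatively
compact; a connectedness argument then makes it injective (`injective_hat`) with image the disc of
radius `R ≤ ∞` (`range_hat`). In this coordinate the surface is a disc or the plane, `f` is a map
`F` to the sphere, and `charT`, `simpleN` become `modelT`, `modelN` (`charT_eq`, `simpleN_eq`).

On the disc the argument is the method of singular metrics. Write `F = [g : h]` without common
zeros, let `W` be the Wronskian of `g, h`, and let `σ_j` be the squared chordal distance from `F` to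
`a_j`. Multiply the spherical density `|W|² / (|g|² + |h|²)²` by the product of the `σ_j ^ (ε - 1)`;
this gives `ξ` (`singDensity`). Its logarithm is a linear combination of `log |W|`, of the
logarithms of the linear forms vanishing over the `a_j`, and of `log (|g|² + |h|²)`. Jensen's
formula and Green's formula bound the growth of the circle mean of `log ξ` from below by `2 ((q (1 -
ε) - 2) T - (1 - ε) ∑ N̄_j)` (`smt_core`); the zeros of `W` absorb the multiplicities
(`jensen_wronskian`).

For the upper bound, concavity replaces the mean of `log ξ` by the logarithm of the mean of `ξ`
(`circleAverage_log_le`). Integrated twice over the radius, that mean is `O(1 + T)`: the function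
`(σ + δ) ^ ε` stays between 0 and 2, while its Laplacian dominates the singular density up to a
multiple of the spherical one (`le_lap_regPow`), so Green's formula and Fatou's lemma apply
(`llogInt_singular_le`). Since `F` cannot be close to two of the `a_j` at once, the product of the
singular factors is controlled by their sum (`exists_prod_rpow_le_sum`). Borel's lemma undoes the
two integrations: the radii where it fails have finite `γ`-mass, so good radii occur arbitrarily
near `R` (`exists_le_mul_rpow`, `exists_good_radius`).

The error consists of `log γ`, `log r` and `log (1 + T)`. The growth hypothesis gives `log γ ≤ η T +
c` near `R` for every `η > 0` (`isGrowthWeight`), the other two are small against `T`, and `T` is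
unbounded (`exists_le_modelT`). Hence `∑ N̄_j ≥ (q - 2 - η) T` at radii tending to `R`, which is
enough because the defects are defined by an upper limit (`sum_one_sub_limsup_le`). -/

/-! ### Green's formula in polar coordinates. -/

/-- The Laplacian of a function on the plane, by means of iterated Fréchet derivatives. -/
def lap (u : ℂ → ℝ) (z : ℂ) : ℝ :=
  fderiv ℝ (fderiv ℝ u) z 1 1 + fderiv ℝ (fderiv ℝ u) z Complex.I Complex.I

/-- The unit vector `e^{iθ}`. -/
def dir (θ : ℝ) : ℂ := Complex.exp (θ * Complex.I)

lemma circleMap_eq_dir (r θ : ℝ) : circleMap 0 r θ = r * dir θ := by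
  simp [circleMap, dir]

lemma norm_dir (θ : ℝ) : ‖dir θ‖ = 1 := Complex.norm_exp_ofReal_mul_I θ

lemma hasDerivAt_dir (θ : ℝ) : HasDerivAt dir (Complex.I * dir θ) θ := by
  have h1 : HasDerivAt (fun t : ℝ => (t : ℂ) * Complex.I) (1 * Complex.I) θ :=
    (Complex.ofRealCLM.hasDerivAt (x := θ)).mul_const Complex.I
  have := h1.cexp
  unfold dir
  convert this using 1
  ring

lemma contDiff_dir {n : WithTop ℕ∞} : ContDiff ℝ n dir := by
  unfold dir
  exact ((Complex.ofRealCLM.contDiff).mul contDiff_const).cexp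

@[fun_prop]
lemma continuous_dir : Continuous dir := (contDiff_dir (n := 0)).continuous

lemma dir_two_pi : dir (2 * Real.pi) = dir 0 := by
  simp [dir, Complex.exp_two_pi_mul_I]

lemma mul_dir_mem_ball {t R : ℝ} (ht : |t| < R) (θ : ℝ) : (t : ℂ) * dir θ ∈ Metric.ball (0 : ℂ) R := by
  simpa [norm_dir] using ht

/-- The trace of the Hessian is the same in every orthonormal basis, here the radial and tangential
directions. -/
lemma fderiv_fderiv_dir_add (u : ℂ → ℝ) (z : ℂ) (θ : ℝ) :
    fderiv ℝ (fderiv ℝ u) z (dir θ) (dir θ) +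
      fderiv ℝ (fderiv ℝ u) z (Complex.I * dir θ) (Complex.I * dir θ) = lap u z := by
  have h1 : dir θ = Real.cos θ • (1 : ℂ) + Real.sin θ • Complex.I := by
    simp [dir, Complex.exp_mul_I]
  have h2 : Complex.I * dir θ = Real.cos θ • Complex.I - Real.sin θ • (1 : ℂ) := by
    rw [h1]
    simp only [Complex.real_smul]
    linear_combination (Real.sin θ : ℂ) * Complex.I_mul_I
  rw [h2, h1, lap]
  simp only [map_add, map_sub, map_smul, add_apply, sub_apply,
    smul_apply, smul_eq_mul]
  have := Real.sin_sq_add_cos_sq θ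
  linear_combination (fderiv ℝ (fderiv ℝ u) z 1 1 + fderiv ℝ (fderiv ℝ u) z Complex.I Complex.I) * this

section Green

variable {u : ℂ → ℝ} {R : ℝ}

lemma contDiffOn_fderiv (hu : ContDiffOn ℝ 2 u (Metric.ball 0 R)) :
    ContDiffOn ℝ 1 (fderiv ℝ u) (Metric.ball 0 R) :=
  hu.fderiv_of_isOpen Metric.isOpen_ball (by norm_num)

lemma continuousOn_lap (hu : ContDiffOn ℝ 2 u (Metric.ball 0 R)) :
    ContinuousOn (lap u) (Metric.ball 0 R) := by
  have h := (contDiffOn_fderiv hu).continuousOn_fderiv_of_isOpen Metric.isOpen_ball le_rfl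
  unfold lap
  exact ((h.clm_apply continuousOn_const).clm_apply continuousOn_const).add
    ((h.clm_apply continuousOn_const).clm_apply continuousOn_const)

/-- The flux of the gradient of `u` through a circle is the integral of the Laplacian. -/
lemma integral_fderiv_dir_eq (hu : ContDiffOn ℝ 2 u (Metric.ball 0 R)) {t : ℝ} (ht : 0 ≤ t)
    (htR : t < R) :
    ∫ θ in (0 : ℝ)..2 * Real.pi, t * fderiv ℝ u (t * dir θ) (dir θ) =
      ∫ ρ in (0 : ℝ)..t, ∫ θ in (0 : ℝ)..2 * Real.pi, ρ * lap u (ρ * dir θ) := by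
  have hD := contDiffOn_fderiv hu
  let E : ℝ × ℝ → ℂ := fun x => x.1 * dir x.2
  have hE : ContDiff ℝ 1 E :=
    (Complex.ofRealCLM.contDiff.comp contDiff_fst).mul (contDiff_dir.comp contDiff_snd)
  have hd2 : ContDiff ℝ 1 (fun x : ℝ × ℝ => dir x.2) := contDiff_dir.comp contDiff_snd
  let U : Set (ℝ × ℝ) := {x | |x.1| < R}
  have hU : IsOpen U := isOpen_lt (by fun_prop) (by fun_prop)
  have hEU : MapsTo E U (Metric.ball 0 R) := fun x hx => mul_dir_mem_ball hx _
  have hDE : ContDiffOn ℝ 1 (fun x => fderiv ℝ u (E x)) U := hD.comp hE.contDiffOn hEU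
  -- `ρ Δu` is the divergence in `(ρ, θ)` of the field `(ρ ∂_ρ u, ρ⁻¹ ∂_θ u)`. Writing the second
  -- component as a derivative along the unit tangent avoids dividing by `ρ` at the origin.
  let f : ℝ × ℝ → ℝ := fun x => x.1 * fderiv ℝ u (E x) (dir x.2)
  let g : ℝ × ℝ → ℝ := fun x => fderiv ℝ u (E x) (Complex.I * dir x.2)
  have hf : ContDiffOn ℝ 1 f U :=
    contDiff_fst.contDiffOn.mul (hDE.clm_apply hd2.contDiffOn)
  have hg : ContDiffOn ℝ 1 g U :=
    hDE.clm_apply (contDiff_const.mul hd2).contDiffOn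
  have hfd : ∀ x ∈ U, HasFDerivAt f (fderiv ℝ f x) x := fun x hx =>
    ((hf.differentiableOn one_ne_zero).differentiableAt (hU.mem_nhds hx)).hasFDerivAt
  have hgd : ∀ x ∈ U, HasFDerivAt g (fderiv ℝ g x) x := fun x hx =>
    ((hg.differentiableOn one_ne_zero).differentiableAt (hU.mem_nhds hx)).hasFDerivAt
  have hDd : ∀ z ∈ Metric.ball (0 : ℂ) R,
      HasFDerivAt (fderiv ℝ u) (fderiv ℝ (fderiv ℝ u) z) z := fun z hz =>
    ((hD.differentiableOn one_ne_zero).differentiableAt (Metric.isOpen_ball.mem_nhds hz)).hasFDerivAt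
  have key : ∀ x ∈ U, fderiv ℝ f x (1, 0) + fderiv ℝ g x (0, 1) = x.1 * lap u (E x) := by
    rintro ⟨ρ, θ⟩ hx
    have hz := hDd _ (hEU hx)
    have h1 : HasDerivAt (fun s : ℝ => f (s, θ)) (fderiv ℝ f (ρ, θ) (1, 0)) ρ := by
      have h2 : HasDerivAt (fun s : ℝ => (s, θ)) ((1 : ℝ), (0 : ℝ)) ρ :=
        (hasDerivAt_id ρ).prodMk (hasDerivAt_const ρ θ)
      exact (hfd _ hx).comp_hasDerivAt ρ h2
    have h1' : HasDerivAt (fun s : ℝ => g (ρ, s)) (fderiv ℝ g (ρ, θ) (0, 1)) θ := by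
      have h2 : HasDerivAt (fun s : ℝ => (ρ, s)) ((0 : ℝ), (1 : ℝ)) θ :=
        (hasDerivAt_const θ ρ).prodMk (hasDerivAt_id θ)
      exact (hgd _ hx).comp_hasDerivAt θ h2
    have h3 : HasDerivAt (fun s : ℝ => fderiv ℝ u (s * dir θ))
        (fderiv ℝ (fderiv ℝ u) (E (ρ, θ)) (dir θ)) ρ := by
      have h2 : HasDerivAt (fun s : ℝ => (s : ℂ) * dir θ) (dir θ) ρ := by
        simpa using (Complex.ofRealCLM.hasDerivAt (x := ρ)).mul_const (dir θ)
      exact hz.comp_hasDerivAt ρ h2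
    have h4 : HasDerivAt (fun s : ℝ => f (s, θ))
        (1 * fderiv ℝ u (E (ρ, θ)) (dir θ) +
          ρ * fderiv ℝ (fderiv ℝ u) (E (ρ, θ)) (dir θ) (dir θ)) ρ := by
      refine ((hasDerivAt_id ρ).mul (h3.clm_apply (hasDerivAt_const ρ (dir θ)))).congr_deriv ?_
      simp [E]
    have h5 : HasDerivAt (fun s : ℝ => fderiv ℝ u (ρ * dir s))
        (fderiv ℝ (fderiv ℝ u) (E (ρ, θ)) (ρ * (Complex.I * dir θ))) θ :=
      hz.comp_hasDerivAt θ ((hasDerivAt_dir θ).const_mul (ρ : ℂ))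
    have h6 : HasDerivAt (fun s : ℝ => g (ρ, s))
        (fderiv ℝ (fderiv ℝ u) (E (ρ, θ)) (ρ * (Complex.I * dir θ)) (Complex.I * dir θ) +
          fderiv ℝ u (E (ρ, θ)) (Complex.I * (Complex.I * dir θ))) θ :=
      h5.clm_apply ((hasDerivAt_dir θ).const_mul Complex.I)
    rw [h1.unique h4, h1'.unique h6, ← fderiv_fderiv_dir_add u (E (ρ, θ)) θ]
    have e1 : Complex.I * (Complex.I * dir θ) = - dir θ := by
      rw [← mul_assoc, Complex.I_mul_I]; ring
    have e2 : (ρ : ℂ) * (Complex.I * dir θ) = ρ • (Complex.I * dir θ) := by simp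
    rw [e1, e2]
    simp only [map_neg, map_smul, smul_apply, smul_eq_mul]
    ring
  have hbox : uIcc 0 t ×ˢ uIcc 0 (2 * Real.pi) ⊆ U := by
    rintro ⟨ρ, θ⟩ ⟨h1, -⟩
    rw [uIcc_of_le ht] at h1
    show |ρ| < R
    rw [abs_of_nonneg h1.1]
    exact h1.2.trans_lt htR
  have hbox' : Ioo (min 0 t) (max 0 t) ×ˢ Ioo (min 0 (2 * Real.pi)) (max 0 (2 * Real.pi)) ⊆ U :=
    (Set.prod_mono Ioo_subset_Icc_self Ioo_subset_Icc_self).trans hbox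
  have hcont : ContinuousOn (fun x : ℝ × ℝ => x.1 * lap u (E x)) U :=
    continuousOn_fst.mul ((continuousOn_lap hu).comp hE.continuous.continuousOn hEU)
  have hint : IntegrableOn (fun x => fderiv ℝ f x (1, 0) + fderiv ℝ g x (0, 1))
      (uIcc 0 t ×ˢ uIcc 0 (2 * Real.pi)) := by
    refine ContinuousOn.integrableOn_compact (isCompact_uIcc.prod isCompact_uIcc) ?_
    exact (hcont.mono hbox).congr fun x hx => key x (hbox hx)
  have := integral2_divergence_prod_of_hasFDerivAt f g (fderiv ℝ f) (fderiv ℝ g) 0 0 t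
    (2 * Real.pi) (hf.continuousOn.mono hbox) (hg.continuousOn.mono hbox)
    (fun x hx => hfd x (hbox' hx)) (fun x hx => hgd x (hbox' hx)) hint
  have e3 : ∫ x in (0 : ℝ)..t, ∫ y in (0 : ℝ)..2 * Real.pi,
      fderiv ℝ f (x, y) (1, 0) + fderiv ℝ g (x, y) (0, 1) =
      ∫ ρ in (0 : ℝ)..t, ∫ θ in (0 : ℝ)..2 * Real.pi, ρ * lap u (ρ * dir θ) := by
    refine intervalIntegral.integral_congr fun ρ hρ => intervalIntegral.integral_congr fun θ hθ => ?_
    exact key (ρ, θ) (hbox ⟨hρ, hθ⟩)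
  rw [e3] at this
  rw [this]
  -- The sides `θ = 0` and `θ = 2π` cancel by periodicity; the side `ρ = 0` vanishes because of the
  -- factor `ρ`.
  simp [f, g, E, dir_two_pi]

/-- **Green-Jensen formula** for functions of class `C²`. -/
theorem circleAverage_sub_circleAverage (hu : ContDiffOn ℝ 2 u (Metric.ball 0 R)) {s r : ℝ}
    (hs : 0 < s) (hsr : s ≤ r) (hrR : r < R) :
    Real.circleAverage u 0 r - Real.circleAverage u 0 s =
      (2 * Real.pi)⁻¹ * ∫ t in s..r, (∫ ρ in (0 : ℝ)..t, ∫ θ in (0 : ℝ)..2 * Real.pi,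
        ρ * lap u (ρ * dir θ)) / t := by
  have hD := (contDiffOn_fderiv hu).continuousOn
  have hball : ∀ t ∈ uIcc s r, ∀ θ, (t : ℂ) * dir θ ∈ Metric.ball (0 : ℂ) R := by
    intro t ht θ
    rw [uIcc_of_le hsr] at ht
    refine mul_dir_mem_ball ?_ θ
    rw [abs_of_pos (hs.trans_le ht.1)]
    exact ht.2.trans_lt hrR
  have hcont : ContinuousOn (fun x : ℝ × ℝ => fderiv ℝ u (x.1 * dir x.2) (dir x.2))
      (uIcc s r ×ˢ univ) := by
    refine ContinuousOn.clm_apply (hD.comp ?_ ?_) ?_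
    · exact Continuous.continuousOn (by fun_prop)
    · rintro ⟨t, θ⟩ ⟨ht, -⟩
      exact hball t ht θ
    · exact Continuous.continuousOn (by fun_prop)
  have h1 : ∀ θ : ℝ, u (r * dir θ) - u (s * dir θ) =
      ∫ t in s..r, fderiv ℝ u (t * dir θ) (dir θ) := by
    intro θ
    symm
    refine intervalIntegral.integral_eq_sub_of_hasDerivAt (f := fun t : ℝ => u (t * dir θ)) ?_ ?_
    · intro t ht
      have h2 : HasDerivAt (fun s : ℝ => (s : ℂ) * dir θ) (dir θ) t := by
        simpa using (Complex.ofRealCLM.hasDerivAt (x := t)).mul_const (dir θ)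
      have h3 : HasFDerivAt u (fderiv ℝ u (t * dir θ)) (t * dir θ) :=
        ((hu.differentiableOn two_ne_zero).differentiableAt
          (Metric.isOpen_ball.mem_nhds (hball t ht θ))).hasFDerivAt
      exact h3.comp_hasDerivAt t h2
    · refine ContinuousOn.intervalIntegrable ?_
      exact hcont.comp (f := fun t : ℝ => (t, θ)) (Continuous.continuousOn (by fun_prop))
        fun t ht => ⟨ht, mem_univ _⟩
  have hui : ∀ t ∈ uIcc s r, IntervalIntegrable (fun θ => u (t * dir θ)) volume 0 (2 * Real.pi) :=
    fun t ht => ContinuousOn.intervalIntegrable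
      (hu.continuousOn.comp (Continuous.continuousOn (by fun_prop)) fun θ _ => hball t ht θ)
  simp only [Real.circleAverage_def, circleMap_eq_dir, smul_eq_mul]
  rw [← mul_sub, ← intervalIntegral.integral_sub (hui r right_mem_uIcc) (hui s left_mem_uIcc)]
  congr 1
  simp_rw [h1]
  rw [← intervalIntegral_intervalIntegral_swap (F := fun t θ => fderiv ℝ u (t * dir θ) (dir θ))]
  · refine intervalIntegral.integral_congr fun t ht => ?_
    have ht' := ht
    rw [uIcc_of_le hsr] at ht'
    have ht0 : 0 < t := hs.trans_le ht'.1
    rw [← integral_fderiv_dir_eq hu ht0.le (ht'.2.trans_lt hrR), intervalIntegral.integral_const_mul,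
      mul_div_cancel_left₀ _ ht0.ne']
  · refine IntegrableOn.mono_set (t := uIcc s r ×ˢ uIcc 0 (2 * Real.pi)) ?_
      (Set.prod_mono uIoc_subset_uIcc uIoc_subset_uIcc)
    exact ContinuousOn.integrableOn_compact (isCompact_uIcc.prod isCompact_uIcc)
      (hcont.mono (Set.prod_mono le_rfl (subset_univ _)))

end Green

/-! ### Laplacians of compositions and of logarithms of norms. -/

lemma hasDerivAt_line_fderiv {u : ℂ → ℝ} {z : ℂ} (hu : ContDiffAt ℝ 2 u z) (v : ℂ) :
    (∀ᶠ t : ℝ in 𝓝 0, HasDerivAt (fun s : ℝ => u (z + s * v)) (fderiv ℝ u (z + t * v) v) t) ∧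
    HasDerivAt (fun t : ℝ => fderiv ℝ u (z + t * v) v) (fderiv ℝ (fderiv ℝ u) z v v) 0 := by
  have hline : ∀ t : ℝ, HasDerivAt (fun s : ℝ => z + (s : ℂ) * v) v t := fun t => by
    simpa using ((Complex.ofRealCLM.hasDerivAt (x := t)).mul_const v).const_add z
  have htend : Tendsto (fun s : ℝ => z + (s : ℂ) * v) (𝓝 0) (𝓝 z) := by
    have := (hline 0).continuousAt.tendsto
    simpa using this
  have hev : ∀ᶠ y in 𝓝 z, DifferentiableAt ℝ u y := by
    filter_upwards [hu.eventually (by simp)] with y hy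
    exact hy.differentiableAt two_ne_zero
  constructor
  · filter_upwards [htend.eventually hev] with t hd
    exact hd.hasFDerivAt.comp_hasDerivAt t (hline t)
  · have h4 : HasFDerivAt (fderiv ℝ u) (fderiv ℝ (fderiv ℝ u) z) (z + ((0 : ℝ) : ℂ) * v) := by
      have : ContDiffAt ℝ 1 (fderiv ℝ u) z := hu.fderiv_right (by norm_num)
      simpa using (this.differentiableAt one_ne_zero).hasFDerivAt
    have h5 : HasDerivAt (fun t : ℝ => fderiv ℝ u (z + t * v)) (fderiv ℝ (fderiv ℝ u) z v) 0 :=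
      h4.comp_hasDerivAt (0 : ℝ) (hline 0)
    have h6 := h5.clm_apply (hasDerivAt_const (0 : ℝ) v)
    rwa [map_zero, add_zero] at h6

/-- Reduces the Laplacians below to one-variable calculus: differentiate twice along the line
through `z` in the direction `v`. -/
lemma fderiv_fderiv_apply_eq {u : ℂ → ℝ} {z : ℂ} (hu : ContDiffAt ℝ 2 u z) (v : ℂ)
    {φ' : ℝ → ℝ} {φ'' : ℝ}
    (h1 : ∀ᶠ t : ℝ in 𝓝 0, HasDerivAt (fun s : ℝ => u (z + s * v)) (φ' t) t)
    (h2 : HasDerivAt φ' φ'' 0) : fderiv ℝ (fderiv ℝ u) z v v = φ'' := by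
  obtain ⟨ha, hb⟩ := hasDerivAt_line_fderiv hu v
  have h3 : φ' =ᶠ[𝓝 0] fun t : ℝ => fderiv ℝ u (z + t * v) v := by
    filter_upwards [h1, ha] with t ht hd using ht.unique hd
  exact hb.unique (h2.congr_of_eventuallyEq h3.symm)

/-- The squared length of the gradient of a function on the plane. -/
def gradSq (u : ℂ → ℝ) (z : ℂ) : ℝ := (fderiv ℝ u z 1) ^ 2 + (fderiv ℝ u z Complex.I) ^ 2

/-- The chain rule for the Laplacian. -/
lemma lap_comp {φ φ' : ℝ → ℝ} {φ'' : ℝ} {u : ℂ → ℝ} {z : ℂ} (hu : ContDiffAt ℝ 2 u z)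
    (hφ : ContDiffAt ℝ 2 φ (u z)) (h1 : ∀ᶠ x in 𝓝 (u z), HasDerivAt φ (φ' x) x)
    (h2 : HasDerivAt φ' φ'' (u z)) :
    lap (fun w => φ (u w)) z = φ'' * gradSq u z + φ' (u z) * lap u z := by
  have key : ∀ v, fderiv ℝ (fderiv ℝ (fun w => φ (u w))) z v v =
      φ'' * (fderiv ℝ u z v) ^ 2 + φ' (u z) * fderiv ℝ (fderiv ℝ u) z v v := by
    intro v
    obtain ⟨ha, hb⟩ := hasDerivAt_line_fderiv hu v
    have hc : HasDerivAt (fun s : ℝ => u (z + s * v)) (fderiv ℝ u z v) 0 := by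
      simpa using ha.self_of_nhds
    have htend : Tendsto (fun s : ℝ => u (z + s * v)) (𝓝 0) (𝓝 (u z)) := by
      simpa using hc.continuousAt.tendsto
    refine fderiv_fderiv_apply_eq (ContDiffAt.comp z hφ hu) v
      (φ' := fun t => φ' (u (z + t * v)) * fderiv ℝ u (z + t * v) v) ?_ ?_
    · filter_upwards [ha, htend.eventually h1] with t ht ht'
      exact ht'.comp t ht
    · have h2' : HasDerivAt φ' φ'' (u (z + ((0 : ℝ) : ℂ) * v)) := by simpa using h2
      refine ((h2'.comp (0 : ℝ) hc).mul hb).congr_deriv ?_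
      simp
      ring
  simp only [lap, key, gradSq]
  ring

lemma gradSq_comp {φ : ℝ → ℝ} {φ' : ℝ} {u : ℂ → ℝ} {z : ℂ} (hu : DifferentiableAt ℝ u z)
    (h1 : HasDerivAt φ φ' (u z)) (v : ℂ) :
    fderiv ℝ (fun w => φ (u w)) z v = φ' * fderiv ℝ u z v := by
  have := (h1.comp_hasFDerivAt z hu.hasFDerivAt).fderiv
  have h2 : fderiv ℝ (fun w => φ (u w)) z = φ' • fderiv ℝ u z := this
  rw [h2]; simp

/-- The quadratic expression `a |k|² + b |l|²`. -/
def wnorm (a b : ℝ) (k l : ℂ → ℂ) (z : ℂ) : ℝ := a * ‖k z‖ ^ 2 + b * ‖l z‖ ^ 2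

section wnorm

variable {a b : ℝ} {k l : ℂ → ℂ} {z : ℂ}

lemma contDiffAt_wnorm (hk : AnalyticAt ℂ k z) (hl : AnalyticAt ℂ l z) :
    ContDiffAt ℝ 2 (wnorm a b k l) z := by
  have h1 : ContDiffAt ℝ 2 k z := (hk.contDiffAt (n := 2)).restrict_scalars ℝ
  have h2 : ContDiffAt ℝ 2 l z := (hl.contDiffAt (n := 2)).restrict_scalars ℝ
  exact (contDiffAt_const.mul (h1.norm_sq ℝ)).add (contDiffAt_const.mul (h2.norm_sq ℝ))

lemma hasDerivAt_line_comp {k : ℂ → ℂ} {z : ℂ} (hk : AnalyticAt ℂ k z) (v : ℂ) :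
    ∀ᶠ t : ℝ in 𝓝 0, HasDerivAt (fun s : ℝ => k (z + s * v)) (v * deriv k (z + t * v)) t := by
  have hline : ∀ t : ℝ, HasDerivAt (fun s : ℝ => z + (s : ℂ) * v) v t := fun t => by
    simpa using ((Complex.ofRealCLM.hasDerivAt (x := t)).mul_const v).const_add z
  have htend : Tendsto (fun s : ℝ => z + (s : ℂ) * v) (𝓝 0) (𝓝 z) := by
    have := (hline 0).continuousAt.tendsto
    simpa using this
  filter_upwards [htend.eventually hk.eventually_analyticAt] with t ht
  refine (ht.differentiableAt.hasDerivAt.scomp t (hline t)).congr_deriv ?_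
  simp

lemma fderiv_wnorm (hk : AnalyticAt ℂ k z) (hl : AnalyticAt ℂ l z) (v : ℂ) :
    fderiv ℝ (wnorm a b k l) z v =
      2 * a * inner ℝ (k z) (v * deriv k z) + 2 * b * inner ℝ (l z) (v * deriv l z) := by
  have h1 := (hasDerivAt_line_fderiv (contDiffAt_wnorm (a := a) (b := b) hk hl) v).1.self_of_nhds
  have hk1 := (hasDerivAt_line_comp hk v).self_of_nhds
  have hl1 := (hasDerivAt_line_comp hl v).self_of_nhds
  have h2 := (hk1.norm_sq.const_mul a).add (hl1.norm_sq.const_mul b)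
  have := h1.unique h2
  simp only [Complex.ofReal_zero, zero_mul, add_zero] at this
  rw [this]; ring

/-- Along direction `v` the second derivative of `|k|²` is `2 Re (conj k · v² k'') + 2 |v|² |k'|²`.
The values of `v²` for `v = 1` and `v = I` are opposite, so the terms with `k''` and `l''` cancel in
the sum. -/
lemma lap_wnorm (hk : AnalyticAt ℂ k z) (hl : AnalyticAt ℂ l z) :
    lap (wnorm a b k l) z = 4 * (a * ‖deriv k z‖ ^ 2 + b * ‖deriv l z‖ ^ 2) := by
  have key : ∀ v, fderiv ℝ (fderiv ℝ (wnorm a b k l)) z v v =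
      a * (2 * (inner ℝ (k z) (v * (v * deriv (deriv k) z)) + inner ℝ (v * deriv k z) (v * deriv k z))) +
      b * (2 * (inner ℝ (l z) (v * (v * deriv (deriv l) z)) + inner ℝ (v * deriv l z) (v * deriv l z))) := by
    intro v
    refine fderiv_fderiv_apply_eq (contDiffAt_wnorm hk hl) v
      (φ' := fun t => a * (2 * inner ℝ (k (z + t * v)) (v * deriv k (z + t * v))) +
        b * (2 * inner ℝ (l (z + t * v)) (v * deriv l (z + t * v)))) ?_ ?_
    · filter_upwards [hasDerivAt_line_comp hk v, hasDerivAt_line_comp hl v] with t h1 h2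
      exact (h1.norm_sq.const_mul a).add (h2.norm_sq.const_mul b)
    · have hk1 := (hasDerivAt_line_comp hk v).self_of_nhds
      have hl1 := (hasDerivAt_line_comp hl v).self_of_nhds
      have hk2 := ((hasDerivAt_line_comp hk.deriv v).self_of_nhds).const_mul v
      have hl2 := ((hasDerivAt_line_comp hl.deriv v).self_of_nhds).const_mul v
      refine ((((hk1.inner ℝ hk2).const_mul 2).const_mul a).add
        (((hl1.inner ℝ hl2).const_mul 2).const_mul b)).congr_deriv ?_
      simp
  simp only [lap, key, Complex.inner, Complex.sq_norm, Complex.normSq_apply]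
  simp
  ring

/-- With `N` the quadratic expression, `Δ log N = (N ΔN - |∇N|²) / N²`, and Lagrange's identity
turns the numerator into a multiple of the squared Wronskian. For `a = b = 1` the result is four
times the spherical density of `[k : l]`. -/
lemma lap_log_wnorm (hk : AnalyticAt ℂ k z) (hl : AnalyticAt ℂ l z)
    (hN : 0 < wnorm a b k l z) :
    lap (fun w => Real.log (wnorm a b k l w)) z =
      4 * a * b * ‖k z * deriv l z - deriv k z * l z‖ ^ 2 / wnorm a b k l z ^ 2 := by
  rw [lap_comp (φ' := fun x => x⁻¹) (φ'' := -(wnorm a b k l z ^ 2)⁻¹) (contDiffAt_wnorm hk hl)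
    (Real.contDiffAt_log.2 hN.ne') ?_ (hasDerivAt_inv hN.ne'), lap_wnorm hk hl, gradSq,
    fderiv_wnorm hk hl, fderiv_wnorm hk hl]
  · have hN' := hN.ne'
    field_simp
    simp only [wnorm, Complex.inner, Complex.sq_norm, Complex.normSq_apply]
    simp
    ring
  · filter_upwards [isOpen_ne.mem_nhds hN.ne'] with x hx
    exact Real.hasDerivAt_log hx

lemma contDiffAt_log_wnorm (hk : AnalyticAt ℂ k z) (hl : AnalyticAt ℂ l z)
    (hN : 0 < wnorm a b k l z) : ContDiffAt ℝ 2 (fun w => Real.log (wnorm a b k l w)) z :=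
  (contDiffAt_wnorm hk hl).log hN.ne'

end wnorm

lemma lap_sub {u v : ℂ → ℝ} {z : ℂ} (hu : ContDiffAt ℝ 2 u z) (hv : ContDiffAt ℝ 2 v z) :
    lap (fun w => u w - v w) z = lap u z - lap v z := by
  have key : ∀ y, fderiv ℝ (fderiv ℝ (fun w => u w - v w)) z y y =
      fderiv ℝ (fderiv ℝ u) z y y - fderiv ℝ (fderiv ℝ v) z y y := by
    intro y
    obtain ⟨h1, h2⟩ := hasDerivAt_line_fderiv hu y
    obtain ⟨h3, h4⟩ := hasDerivAt_line_fderiv hv y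
    refine fderiv_fderiv_apply_eq (hu.sub hv) y ?_ (h2.sub h4)
    filter_upwards [h1, h3] with t ha hb using ha.sub hb
  simp only [lap, key]
  ring

/-! ### Regularized powers of the chordal distance. -/

section power

variable {k l : ℂ → ℂ} {z : ℂ} {s ε : ℝ}

/-- The regularized power `(σ + s)^ε` of `σ = |k|² / (|k|² + |l|²)`. -/
def regPow (s ε : ℝ) (k l : ℂ → ℂ) (w : ℂ) : ℝ :=
  Real.exp (ε * (Real.log (wnorm (1 + s) s k l w) - Real.log (wnorm 1 1 k l w)))

lemma wnorm_one_add (s : ℝ) (k l : ℂ → ℂ) (w : ℂ) :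
    wnorm (1 + s) s k l w = ‖k w‖ ^ 2 + s * wnorm 1 1 k l w := by
  simp [wnorm]; ring

lemma wnorm_one_add_pos (hP : 0 < wnorm 1 1 k l z) (hs : 0 < s) : 0 < wnorm (1 + s) s k l z := by
  rw [wnorm_one_add]; positivity

lemma regPow_eq (hP : 0 < wnorm 1 1 k l z) (hs : 0 < s) :
    regPow s ε k l z = (‖k z‖ ^ 2 / wnorm 1 1 k l z + s) ^ ε := by
  have h1 := wnorm_one_add_pos hP hs
  rw [regPow, ← Real.log_div h1.ne' hP.ne', wnorm_one_add, add_div, mul_div_cancel_right₀ _ hP.ne',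
    mul_comm, Real.rpow_def_of_pos (by positivity)]

lemma contDiffAt_regPow (hk : AnalyticAt ℂ k z) (hl : AnalyticAt ℂ l z)
    (hP : 0 < wnorm 1 1 k l z) (hs : 0 < s) : ContDiffAt ℝ 2 (regPow s ε k l) z :=
  (contDiffAt_const.mul ((contDiffAt_log_wnorm hk hl (wnorm_one_add_pos hP hs)).sub
    (contDiffAt_log_wnorm hk hl hP))).exp

/-- Put `σ = A / P`, `x = σ + s`, `y = x ^ ε`, `d = w / P²`. The first term on the right is `4 d y
((ε (1 + s) s + ε² σ (1 - σ)) / x² - ε)`, and the inner numerator is at least `ε² (1 - σ) x`. What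
is missing from `4 ε² d y / x` is `4 d y (ε² σ / x + ε)`; since `y ≤ 2` and the bracket is at most
`2 ε`, the correction `16 ε d` pays for it. -/
lemma le_lap_regPow_aux {P A B w s ε : ℝ} (hP : 0 < P) (hPAB : P = A + B) (hA : 0 ≤ A)
    (hB : 0 ≤ B) (hw : 0 ≤ w) (hs : 0 < s) (hs1 : s ≤ 1) (hε : 0 < ε) (hε1 : ε ≤ 1) :
    4 * ε ^ 2 * (w / P ^ 2 * (A / P + s) ^ (ε - 1)) ≤
      (A / P + s) ^ ε * (ε * (4 * (1 + s) * s * w / (A + s * P) ^ 2 - 4 * w / P ^ 2) +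
        ε ^ 2 * (4 * A * B * w / ((A + s * P) ^ 2 * P ^ 2))) + 16 * ε * (w / P ^ 2) := by
  obtain ⟨σ, hσ⟩ : ∃ σ, σ = A / P := ⟨_, rfl⟩
  obtain ⟨x, hx⟩ : ∃ x, x = σ + s := ⟨_, rfl⟩
  obtain ⟨d, hd⟩ : ∃ d, d = w / P ^ 2 := ⟨_, rfl⟩
  have hσ0 : 0 ≤ σ := by rw [hσ]; positivity
  have hσ1 : σ ≤ 1 := by rw [hσ, div_le_one hP]; linarith
  have hx0 : 0 < x := by linarith
  have hkσ : A = σ * P := by rw [hσ, div_mul_cancel₀ _ hP.ne']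
  have hlσ : B = (1 - σ) * P := by linarith
  have hNx : A + s * P = x * P := by rw [hkσ, hx]; ring
  have hd0 : 0 ≤ d := by rw [hd]; positivity
  have hwd : w = d * P ^ 2 := by rw [hd, div_mul_cancel₀ _ (by positivity)]
  rw [← hσ, ← hx, ← hd, hNx, hkσ, hlσ, hwd, Real.rpow_sub hx0, Real.rpow_one]
  clear hσ hkσ hlσ hNx hd hwd hPAB hA hB hw
  obtain ⟨y, hy⟩ : ∃ y, y = x ^ ε := ⟨_, rfl⟩
  have hy0 : 0 < y := by rw [hy]; exact Real.rpow_pos_of_pos hx0 _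
  have hy2 : y ≤ 2 := by
    have hx2 : x ≤ 2 := by linarith
    calc y = x ^ ε := hy
      _ ≤ 2 ^ ε := Real.rpow_le_rpow hx0.le hx2 hε.le
      _ ≤ 2 ^ (1 : ℝ) := Real.rpow_le_rpow_of_exponent_le one_le_two hε1
      _ = 2 := Real.rpow_one 2
  rw [← hy]
  clear hy
  have h3 : ε ^ 2 ≤ ε := by nlinarith
  have e1 : y * (ε * (4 * (1 + s) * s * (d * P ^ 2) / (x * P) ^ 2 - 4 * (d * P ^ 2) / P ^ 2) +
      ε ^ 2 * (4 * (σ * P) * ((1 - σ) * P) * (d * P ^ 2) / ((x * P) ^ 2 * P ^ 2))) =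
      4 * d * y * ((ε * ((1 + s) * s) + ε ^ 2 * (σ * (1 - σ))) / x ^ 2 - ε) := by
    field_simp
    ring
  have h4 : ε ^ 2 * ((1 - σ) * x) / x ^ 2 ≤ (ε * ((1 + s) * s) + ε ^ 2 * (σ * (1 - σ))) / x ^ 2 := by
    gcongr
    have h4 : 0 ≤ (1 + s) * s := by positivity
    have h5 : ε ^ 2 * ((1 + s) * s) ≤ ε * ((1 + s) * s) := by gcongr
    have h6 : 0 ≤ ε ^ 2 * (s ^ 2 + s * σ) := by positivity
    rw [hx]
    nlinarith
  have h7 : 4 * d * y * (ε ^ 2 * ((1 - σ) * x) / x ^ 2 - ε) ≤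
      4 * d * y * ((ε * ((1 + s) * s) + ε ^ 2 * (σ * (1 - σ))) / x ^ 2 - ε) := by gcongr
  rw [e1]
  refine le_trans ?_ (add_le_add h7 le_rfl)
  have h8 : σ / x ≤ 1 := by rw [div_le_one hx0, hx]; linarith
  have h9 : 4 * ε ^ 2 * (d * (y / x)) = 4 * d * y * (ε ^ 2 * ((1 - σ) * x) / x ^ 2 - ε) +
      4 * d * y * (ε ^ 2 * (σ / x) + ε) := by field_simp; ring
  rw [h9]
  have h10 : ε ^ 2 * (σ / x) ≤ ε * 1 := mul_le_mul h3 h8 (by positivity) hε.le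
  have h11 : 4 * d * y * (ε ^ 2 * (σ / x) + ε) ≤ 4 * d * 2 * (2 * ε) := by
    gcongr
    linarith
  linarith

/-- Lower bound for the Laplacian of the regularized power of the chordal distance. -/
theorem le_lap_regPow (hk : AnalyticAt ℂ k z) (hl : AnalyticAt ℂ l z)
    (hP : 0 < wnorm 1 1 k l z) (hs : 0 < s) (hs1 : s ≤ 1) (hε : 0 < ε) (hε1 : ε ≤ 1) :
    4 * ε ^ 2 * (‖k z * deriv l z - deriv k z * l z‖ ^ 2 / wnorm 1 1 k l z ^ 2 *
        (‖k z‖ ^ 2 / wnorm 1 1 k l z + s) ^ (ε - 1)) ≤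
      lap (regPow s ε k l) z +
        16 * ε * (‖k z * deriv l z - deriv k z * l z‖ ^ 2 / wnorm 1 1 k l z ^ 2) := by
  have hN := wnorm_one_add_pos hP hs
  have hL1 := contDiffAt_log_wnorm hk hl hN
  have hL2 := contDiffAt_log_wnorm hk hl hP
  set w := ‖k z * deriv l z - deriv k z * l z‖ ^ 2 with hw
  set P := wnorm 1 1 k l z with hPdef
  set N := wnorm (1 + s) s k l z with hNdef
  set L : ℂ → ℝ := fun y => Real.log (wnorm (1 + s) s k l y) - Real.log (wnorm 1 1 k l y) with hL
  have hLd : ContDiffAt ℝ 2 L z := hL1.sub hL2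
  have hlapL : lap L z = 4 * (1 + s) * s * w / N ^ 2 - 4 * w / P ^ 2 := by
    rw [hL, lap_sub hL1 hL2, lap_log_wnorm hk hl hN, lap_log_wnorm hk hl hP]
    ring
  -- The squared gradient of `log (N / P)` is again proportional to the squared Wronskian, as `log
  -- (N / P)` depends only on the quotient of `k` and `l`.
  have hgradL : gradSq L z = 4 * ‖k z‖ ^ 2 * ‖l z‖ ^ 2 * w / (N ^ 2 * P ^ 2) := by
    have hd : ∀ v, fderiv ℝ L z v = N⁻¹ * fderiv ℝ (wnorm (1 + s) s k l) z v -
        P⁻¹ * fderiv ℝ (wnorm 1 1 k l) z v := by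
      intro v
      have e : fderiv ℝ L z = fderiv ℝ (fun y => Real.log (wnorm (1 + s) s k l y)) z -
          fderiv ℝ (fun y => Real.log (wnorm 1 1 k l y)) z :=
        fderiv_sub (hL1.differentiableAt two_ne_zero) (hL2.differentiableAt two_ne_zero)
      rw [e, sub_apply,
        gradSq_comp ((contDiffAt_wnorm hk hl).differentiableAt two_ne_zero)
          (Real.hasDerivAt_log hN.ne'),
        gradSq_comp ((contDiffAt_wnorm hk hl).differentiableAt two_ne_zero)
          (Real.hasDerivAt_log hP.ne')]
    have hN' := hN.ne'
    have hP' := hP.ne'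
    rw [gradSq, hd, hd]
    simp only [fderiv_wnorm hk hl]
    rw [eq_div_iff (by positivity)]
    have e1 : ∀ x y x' y' : ℝ, ((N⁻¹ * x - P⁻¹ * y) ^ 2 + (N⁻¹ * x' - P⁻¹ * y') ^ 2) * (N ^ 2 * P ^ 2)
        = (P * x - N * y) ^ 2 + (P * x' - N * y') ^ 2 := by
      intro x y x' y'
      field_simp
    rw [e1, hw, hNdef, hPdef]
    simp only [wnorm, Complex.inner, Complex.sq_norm, Complex.normSq_apply]
    simp
    ring
  have hu : lap (regPow s ε k l) z =
      regPow s ε k l z * (ε * lap L z + ε ^ 2 * gradSq L z) := by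
    have h1 : ∀ x, HasDerivAt (fun x => Real.exp (ε * x)) (ε * Real.exp (ε * x)) x := fun x => by
      simpa [mul_comm] using ((hasDerivAt_id x).const_mul ε).exp
    have := lap_comp (φ := fun x => Real.exp (ε * x)) (φ' := fun x => ε * Real.exp (ε * x)) hLd
      (contDiff_const.mul contDiff_id).exp.contDiffAt (Eventually.of_forall h1) ((h1 (L z)).const_mul ε)
    have e : (fun y => Real.exp (ε * L y)) = regPow s ε k l := rfl
    rw [e] at this
    rw [this]
    have e' : Real.exp (ε * L z) = regPow s ε k l z := rfl
    rw [e']; ring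
  have hP2 : P = ‖k z‖ ^ 2 + ‖l z‖ ^ 2 := by rw [hPdef, wnorm]; ring
  have hN2 : N = ‖k z‖ ^ 2 + s * P := wnorm_one_add s k l z
  have hpow : regPow s ε k l z = (‖k z‖ ^ 2 / P + s) ^ ε := regPow_eq hP hs
  rw [hu, hlapL, hgradL, hpow, hN2]
  exact le_lap_regPow_aux hP hP2 (sq_nonneg _) (sq_nonneg _) (sq_nonneg _) hs hs1 hε hε1

end power

/-! ### Jensen's formula and the Wronskian. -/

/-- The weight of a point `u` in the Jensen formula between the circles of radii `s` and `r`. -/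
def jensenWeight (s r : ℝ) (u : ℂ) : ℝ := Real.log (r / max s ‖u‖)

lemma jensenWeight_nonneg {s r : ℝ} {u : ℂ} (hs : 0 < s) (hsr : s ≤ r) (hu : ‖u‖ ≤ r) :
    0 ≤ jensenWeight s r u := by
  have h0 : 0 < max s ‖u‖ := lt_max_of_lt_left hs
  exact Real.log_nonneg (by rw [le_div_iff₀ h0, one_mul]; exact max_le hsr hu)

lemma divisor_eq_analyticOrderNatAt {k : ℂ → ℂ} {U : Set ℂ} (hk : AnalyticOnNhd ℂ k U) {u : ℂ}
    (hu : u ∈ U) : MeromorphicOn.divisor k U u = analyticOrderNatAt k u := by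
  rw [MeromorphicOn.divisor_apply hk.meromorphicOn hu, (hk u hu).meromorphicOrderAt_eq,
    analyticOrderNatAt]
  cases h : analyticOrderAt k u <;> simp

/-- **Jensen's formula** between two circles. -/
theorem jensen_sub {k : ℂ → ℂ} {s r : ℝ} (hs : 0 < s) (hsr : s ≤ r)
    (hk : AnalyticOnNhd ℂ k (Metric.closedBall 0 r)) (Z : Finset ℂ)
    (hZ : ∀ u ∈ Metric.closedBall (0 : ℂ) r, k u = 0 → u ∈ Z)
    (hZr : ∀ u ∈ Z, u ∈ Metric.closedBall (0 : ℂ) r) :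
    Real.circleAverage (fun z => Real.log ‖k z‖) 0 r -
      Real.circleAverage (fun z => Real.log ‖k z‖) 0 s =
      ∑ u ∈ Z, analyticOrderNatAt k u * jensenWeight s r u := by
  have hr : 0 < r := hs.trans_le hsr
  have hks : AnalyticOnNhd ℂ k (Metric.closedBall 0 s) :=
    hk.mono (Metric.closedBall_subset_closedBall hsr)
  -- Jensen's formula for every radius up to `r`, with the zeros summed over the same finite set, so
  -- that two radii can be subtracted term by term.
  have gen : ∀ t, 0 < t → t ≤ r → Real.circleAverage (fun z => Real.log ‖k z‖) 0 t =
      ∑ u ∈ Z, (if ‖u‖ ≤ t then (analyticOrderNatAt k u : ℝ) * Real.log (t * ‖u‖⁻¹) else 0) +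
        analyticOrderNatAt k 0 * Real.log t + Real.log ‖meromorphicTrailingCoeffAt k 0‖ := by
    intro t ht htr
    have hkt : AnalyticOnNhd ℂ k (Metric.closedBall 0 t) :=
      hk.mono (Metric.closedBall_subset_closedBall htr)
    have := MeromorphicOn.circleAverage_log_norm (c := 0) (R := t) (f := k) ht.ne'
      (by rw [abs_of_pos ht]; exact hkt.meromorphicOn)
    rw [this, abs_of_pos ht]
    have h1 : ∀ u, ((MeromorphicOn.divisor k (Metric.closedBall 0 t) u : ℤ) : ℝ) =
        if ‖u‖ ≤ t then (analyticOrderNatAt k u : ℝ) else 0 := by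
      intro u
      split_ifs with h
      · rw [divisor_eq_analyticOrderNatAt hkt (by simpa using h)]; simp
      · rw [Function.locallyFinsuppWithin.apply_eq_zero_of_notMem _ (by simpa using h)]; simp
    simp only [h1, zero_sub, norm_neg, norm_zero, ht.le, if_true]
    congr 2
    rw [finsum_eq_sum_of_support_subset]
    · refine Finset.sum_congr rfl fun u _ => ?_
      split_ifs <;> simp
    · intro u hu
      rw [Function.mem_support] at hu
      have h2 : ‖u‖ ≤ t := by
        by_contra h
        simp [h] at hu
      refine hZ u (by simpa using h2.trans htr) ?_
      by_contra h
      have : analyticOrderNatAt k u = 0 := by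
        rw [analyticOrderNatAt, (hk u (by simpa using h2.trans htr)).analyticOrderAt_eq_zero.2 h]
        rfl
      simp [this] at hu
  rw [gen r hr le_rfl, gen s hs hsr]
  -- A zero at the origin enters only through the separate term with `log t`; its term in the sum is
  -- 0, because `0⁻¹ = 0` and `log 0 = 0`. The separate term is now moved into the sum.
  have h0 : ∀ c : ℝ, analyticOrderNatAt k 0 * c =
      ∑ u ∈ Z, if u = 0 then (analyticOrderNatAt k u : ℝ) * c else 0 := by
    intro c
    rw [Finset.sum_ite_eq']
    split_ifs with h
    · rfl
    · have : analyticOrderNatAt k 0 = 0 := by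
        have h00 : (0 : ℂ) ∈ Metric.closedBall (0 : ℂ) r := by simpa using hr.le
        rw [analyticOrderNatAt, (hk 0 h00).analyticOrderAt_eq_zero.2 fun h' => h (hZ 0 h00 h')]
        rfl
      simp [this]
  rw [h0, h0, add_sub_add_right_eq_sub, ← Finset.sum_add_distrib, ← Finset.sum_add_distrib,
    ← Finset.sum_sub_distrib]
  refine Finset.sum_congr rfl fun u hu => ?_
  have hur : ‖u‖ ≤ r := by simpa using hZr u hu
  rw [jensenWeight]
  by_cases hu0 : u = 0
  · subst hu0
    simp [hr.le, hs.le, Real.log_div hr.ne' hs.ne']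
    ring
  · have hun : 0 < ‖u‖ := norm_pos_iff.2 hu0
    by_cases hus : ‖u‖ ≤ s
    · simp only [hur, hus, hu0, if_true, if_false, max_eq_left]
      rw [Real.log_mul hr.ne' (inv_ne_zero hun.ne'), Real.log_mul hs.ne' (inv_ne_zero hun.ne'),
        Real.log_div hr.ne' hs.ne']
      ring
    · simp only [hur, hus, hu0, if_true, if_false, max_eq_right (not_le.1 hus).le]
      simp [div_eq_mul_inv]

/-- Both products in the Wronskian vanish at least to the order of `k'`, which is one less than the
order of `k`. -/
lemma analyticOrderAt_le_wronskian {k l : ℂ → ℂ} {u : ℂ} (hk : AnalyticAt ℂ k u)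
    (hl : AnalyticAt ℂ l u) (h0 : k u = 0) :
    analyticOrderAt k u ≤ analyticOrderAt (fun z => k z * deriv l z - deriv k z * l z) u + 1 := by
  have h1 := hk.analyticOrderAt_deriv_add_one
  simp only [h0, sub_zero] at h1
  have h2 : analyticOrderAt (deriv k) u ≤ analyticOrderAt (k * deriv l) u := by
    rw [analyticOrderAt_mul hk hl.deriv, ← h1, add_assoc]
    exact le_self_add
  have h3 : analyticOrderAt (deriv k) u ≤ analyticOrderAt (deriv k * l) u := by
    rw [analyticOrderAt_mul hk.deriv hl]
    exact le_self_add
  have h4 : analyticOrderAt (deriv k) u ≤ analyticOrderAt (k * deriv l - deriv k * l) u :=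
    (le_min h2 h3).trans le_analyticOrderAt_sub
  have h5 : k * deriv l - deriv k * l = fun z => k z * deriv l z - deriv k z * l z := rfl
  rw [← h1, ← h5]
  gcongr

/-- The linear form `a₁ g - a₀ h`, which vanishes where `[g : h] = [a₀ : a₁]`. -/
def comb (a : ℂ × ℂ) (g h : ℂ → ℂ) (z : ℂ) : ℂ := a.2 * g z - a.1 * h z

/-- The linear form orthogonal to `comb a g h`. -/
def coComb (a : ℂ × ℂ) (g h : ℂ → ℂ) (z : ℂ) : ℂ := star a.1 * g z + star a.2 * h z

/-- The Wronskian of a pair of functions. -/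
def wronskian (g h : ℂ → ℂ) (z : ℂ) : ℂ := g z * deriv h z - deriv g z * h z

section comb

variable {a b : ℂ × ℂ} {g h : ℂ → ℂ} {z : ℂ}

lemma analyticAt_comb (hg : AnalyticAt ℂ g z) (hh : AnalyticAt ℂ h z) :
    AnalyticAt ℂ (comb a g h) z :=
  (analyticAt_const.mul hg).sub (analyticAt_const.mul hh)

lemma analyticAt_coComb (hg : AnalyticAt ℂ g z) (hh : AnalyticAt ℂ h z) :
    AnalyticAt ℂ (coComb a g h) z :=
  (analyticAt_const.mul hg).add (analyticAt_const.mul hh)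

lemma analyticAt_wronskian (hg : AnalyticAt ℂ g z) (hh : AnalyticAt ℂ h z) :
    AnalyticAt ℂ (wronskian g h) z :=
  (hg.mul hh.deriv).sub (hg.deriv.mul hh)

lemma mul_star_add_mul_star (ha : ‖a.1‖ ^ 2 + ‖a.2‖ ^ 2 = 1) :
    a.1 * star a.1 + a.2 * star a.2 = 1 := by
  have h1 := Complex.mul_conj a.1
  have h2 := Complex.mul_conj a.2
  rw [Complex.normSq_eq_norm_sq] at h1 h2
  change a.1 * (starRingEnd ℂ) a.1 + a.2 * (starRingEnd ℂ) a.2 = 1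
  rw [h1, h2]
  exact_mod_cast ha

/-- The passage from `(g, h)` to `(comb, coComb)` is unitary of determinant 1. It therefore
preserves the Wronskian, and the Hermitian norm in `wnorm_comb`; in the estimates `comb` may play
the role of a coordinate vanishing over the point `a`. -/
lemma comb_wronskian (ha : ‖a.1‖ ^ 2 + ‖a.2‖ ^ 2 = 1) (hg : AnalyticAt ℂ g z)
    (hh : AnalyticAt ℂ h z) :
    comb a g h z * deriv (coComb a g h) z - deriv (comb a g h) z * coComb a g h z =
      wronskian g h z := by
  have h1 : deriv (comb a g h) z = a.2 * deriv g z - a.1 * deriv h z :=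
    ((hg.differentiableAt.hasDerivAt.const_mul a.2).sub
      (hh.differentiableAt.hasDerivAt.const_mul a.1)).deriv
  have h2 : deriv (coComb a g h) z = star a.1 * deriv g z + star a.2 * deriv h z :=
    ((hg.differentiableAt.hasDerivAt.const_mul _).add
      (hh.differentiableAt.hasDerivAt.const_mul _)).deriv
  rw [h1, h2, comb, coComb, wronskian]
  linear_combination (g z * deriv h z - deriv g z * h z) * mul_star_add_mul_star ha

lemma wnorm_comb (ha : ‖a.1‖ ^ 2 + ‖a.2‖ ^ 2 = 1) :
    wnorm 1 1 (comb a g h) (coComb a g h) z = wnorm 1 1 g h z := by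
  have h1 := ha
  simp only [wnorm, comb, coComb, Complex.sq_norm, Complex.normSq_apply] at h1 ⊢
  simp
  linear_combination ((g z).re ^ 2 + (g z).im ^ 2 + (h z).re ^ 2 + (h z).im ^ 2) * h1

/-- Cramer's rule recovers `g` and `h` from the two linear forms, so both forms cannot be small at
once. -/
lemma wnorm_le_comb (ha : ‖a.1‖ ^ 2 + ‖a.2‖ ^ 2 = 1) (hb : ‖b.1‖ ^ 2 + ‖b.2‖ ^ 2 = 1) :
    ‖a.1 * b.2 - a.2 * b.1‖ ^ 2 * wnorm 1 1 g h z ≤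
      4 * (‖comb a g h z‖ ^ 2 + ‖comb b g h z‖ ^ 2) := by
  have key : ∀ x y p q : ℂ, ‖x‖ ≤ 1 → ‖y‖ ≤ 1 → ‖x * p - y * q‖ ^ 2 ≤ 2 * (‖p‖ ^ 2 + ‖q‖ ^ 2) := by
    intro x y p q hx hy
    have h1 : ‖x * p - y * q‖ ≤ ‖p‖ + ‖q‖ := by
      refine (norm_sub_le _ _).trans ?_
      rw [norm_mul, norm_mul]
      nlinarith [norm_nonneg p, norm_nonneg q]
    nlinarith [norm_nonneg (x * p - y * q), sq_nonneg (‖p‖ - ‖q‖)]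
  have hle : ∀ x y : ℝ, x ^ 2 + y ^ 2 = 1 → x ≤ 1 ∧ y ≤ 1 := fun x y h =>
    ⟨by nlinarith [sq_nonneg y], by nlinarith [sq_nonneg x]⟩
  have e1 : b.1 * comb a g h z - a.1 * comb b g h z = -((a.1 * b.2 - a.2 * b.1) * g z) := by
    simp only [comb]; ring
  have e2 : b.2 * comb a g h z - a.2 * comb b g h z = -((a.1 * b.2 - a.2 * b.1) * h z) := by
    simp only [comb]; ring
  have k1 := key b.1 a.1 (comb a g h z) (comb b g h z) (hle _ _ hb).1 (hle _ _ ha).1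
  have k2 := key b.2 a.2 (comb a g h z) (comb b g h z) (hle _ _ hb).2 (hle _ _ ha).2
  rw [e1, norm_neg, norm_mul, mul_pow] at k1
  rw [e2, norm_neg, norm_mul, mul_pow] at k2
  rw [wnorm]
  linarith

end comb

/-- Infinitely many zeros would accumulate in the compact disc, contradicting the isolation of
zeros. -/
lemma finite_zeros {k : ℂ → ℂ} {r : ℝ} (hk : AnalyticOnNhd ℂ k (Metric.closedBall 0 r))
    (hk0 : ∀ u ∈ Metric.closedBall (0 : ℂ) r, ¬ ∀ᶠ z in 𝓝 u, k z = 0) :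
    {u ∈ Metric.closedBall (0 : ℂ) r | k u = 0}.Finite := by
  by_contra hinf
  obtain ⟨x, hx, hacc⟩ := Set.Infinite.exists_accPt_of_subset_isCompact hinf
    (isCompact_closedBall (0 : ℂ) r) (sep_subset _ _)
  rcases (hk x hx).eventually_eq_zero_or_eventually_ne_zero with h | h
  · exact hk0 x hx h
  · rw [accPt_iff_frequently_nhdsNE] at hacc
    obtain ⟨y, hy, hy'⟩ := (hacc.and_eventually h).exists
    exact hy' hy.2

/-- The Jensen formula for the linear forms of a pair and its Wronskian: the zeros of the Wronskian
compensate for the multiplicities. -/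
theorem jensen_wronskian {g h : ℂ → ℂ} {s r : ℝ} (hs : 0 < s) (hsr : s ≤ r)
    (hg : AnalyticOnNhd ℂ g (Metric.closedBall 0 r)) (hh : AnalyticOnNhd ℂ h (Metric.closedBall 0 r))
    {q : ℕ} (a : Fin q → ℂ × ℂ) (ha : ∀ j, ‖(a j).1‖ ^ 2 + ‖(a j).2‖ ^ 2 = 1)
    (hone : ∀ u ∈ Metric.closedBall (0 : ℂ) r, ∀ i j, comb (a i) g h u = 0 → comb (a j) g h u = 0 →
      i = j)
    (hW0 : ∀ u ∈ Metric.closedBall (0 : ℂ) r, ¬ ∀ᶠ z in 𝓝 u, wronskian g h z = 0)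
    (Z : Fin q → Finset ℂ)
    (hZ : ∀ j u, u ∈ Z j ↔ u ∈ Metric.closedBall (0 : ℂ) r ∧ comb (a j) g h u = 0)
    {c : ℝ} (hc : 0 ≤ c) (hc1 : c ≤ 1) :
    -c * ∑ j, ∑ u ∈ Z j, jensenWeight s r u ≤
      (Real.circleAverage (fun z => Real.log ‖wronskian g h z‖) 0 r -
        Real.circleAverage (fun z => Real.log ‖wronskian g h z‖) 0 s) -
      c * ∑ j, (Real.circleAverage (fun z => Real.log ‖comb (a j) g h z‖) 0 r -
        Real.circleAverage (fun z => Real.log ‖comb (a j) g h z‖) 0 s) := by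
  classical
  have hW : AnalyticOnNhd ℂ (wronskian g h) (Metric.closedBall 0 r) := fun u hu =>
    analyticAt_wronskian (hg u hu) (hh u hu)
  have hk : ∀ j, AnalyticOnNhd ℂ (comb (a j) g h) (Metric.closedBall 0 r) := fun j u hu =>
    analyticAt_comb (hg u hu) (hh u hu)
  -- All zeros of the Wronskian and of the forms together: every Jensen sum is taken over this set
  -- and the inequality is proved point by point.
  set Y : Finset ℂ := (finite_zeros hW hW0).toFinset ∪ Finset.univ.biUnion Z with hY
  have hYr : ∀ u ∈ Y, u ∈ Metric.closedBall (0 : ℂ) r := by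
    intro u hu
    rw [hY, Finset.mem_union, Finite.mem_toFinset, Finset.mem_biUnion] at hu
    rcases hu with hu | ⟨j, -, hu⟩
    · exact hu.1
    · exact ((hZ j u).1 hu).1
  rw [jensen_sub hs hsr hW Y (fun u hu h0 => by
    rw [hY, Finset.mem_union, Finite.mem_toFinset]; exact Or.inl ⟨hu, h0⟩) hYr]
  have hkj : ∀ j, Real.circleAverage (fun z => Real.log ‖comb (a j) g h z‖) 0 r -
      Real.circleAverage (fun z => Real.log ‖comb (a j) g h z‖) 0 s =
      ∑ u ∈ Y, analyticOrderNatAt (comb (a j) g h) u * jensenWeight s r u := fun j =>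
    jensen_sub hs hsr (hk j) Y (fun u hu h0 => by
      rw [hY, Finset.mem_union, Finset.mem_biUnion]
      exact Or.inr ⟨j, Finset.mem_univ _, (hZ j u).2 ⟨hu, h0⟩⟩) hYr
  simp only [hkj]
  have hZY : ∀ j, ∑ u ∈ Z j, jensenWeight s r u =
      ∑ u ∈ Y, if u ∈ Z j then jensenWeight s r u else 0 := by
    intro j
    rw [← Finset.sum_filter]
    refine Finset.sum_congr ?_ fun _ _ => rfl
    ext u
    simp only [Finset.mem_filter]
    refine ⟨fun hu => ⟨?_, hu⟩, fun hu => hu.2⟩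
    rw [hY, Finset.mem_union, Finset.mem_biUnion]
    exact Or.inr ⟨j, Finset.mem_univ _, hu⟩
  simp only [hZY]
  rw [Finset.sum_comm (s := Finset.univ) (t := Y), Finset.sum_comm (s := Finset.univ) (t := Y),
    Finset.mul_sum, Finset.mul_sum, ← Finset.sum_sub_distrib]
  refine Finset.sum_le_sum fun u hu => ?_
  have hur := hYr u hu
  have hG : 0 ≤ jensenWeight s r u := jensenWeight_nonneg hs hsr (by simpa using hur)
  have hord : ∀ j, comb (a j) g h u ≠ 0 → analyticOrderNatAt (comb (a j) g h) u = 0 := by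
    intro j hj
    rw [analyticOrderNatAt, (hk j u hur).analyticOrderAt_eq_zero.2 hj]; rfl
  have hWnn : (0 : ℝ) ≤ analyticOrderNatAt (wronskian g h) u := Nat.cast_nonneg _
  -- At most one form vanishes at `u`. If it does so to order `m`, the Wronskian vanishes at least
  -- to order `m - 1`, and `0 ≤ c ≤ 1` gives `c m ≤ c + ord W`.
  by_cases hex : ∃ j, comb (a j) g h u = 0
  · obtain ⟨j, hj⟩ := hex
    have hother : ∀ i, i ≠ j → comb (a i) g h u ≠ 0 := fun i hij h0 => hij (hone u hur i j h0 hj)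
    rw [Finset.sum_eq_single j, Finset.sum_eq_single j]
    · rw [if_pos ((hZ j u).2 ⟨hur, hj⟩)]
      have hle : (analyticOrderNatAt (comb (a j) g h) u : ℝ) ≤
          analyticOrderNatAt (wronskian g h) u + 1 := by
        have h1 := analyticOrderAt_le_wronskian (hk j u hur)
          (analyticAt_coComb (a := a j) (hg u hur) (hh u hur)) hj
        have h2 : (fun z => comb (a j) g h z * deriv (coComb (a j) g h) z -
            deriv (comb (a j) g h) z * coComb (a j) g h z) =ᶠ[𝓝 u] wronskian g h := by
          filter_upwards [(hg u hur).eventually_analyticAt, (hh u hur).eventually_analyticAt]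
            with z hz hz' using comb_wronskian (ha j) hz hz'
        rw [analyticOrderAt_congr h2] at h1
        have h3 : analyticOrderAt (wronskian g h) u ≠ ⊤ := by
          rw [Ne, analyticOrderAt_eq_top]; exact hW0 u hur
        have h4 : analyticOrderAt (comb (a j) g h) u ≠ ⊤ :=
          ne_top_of_le_ne_top (by simpa using h3) h1
        rw [← Nat.cast_analyticOrderNatAt h3, ← Nat.cast_analyticOrderNatAt h4] at h1
        exact_mod_cast h1
      have h5 : (analyticOrderNatAt (comb (a j) g h) u : ℝ) * jensenWeight s r u ≤
          (analyticOrderNatAt (wronskian g h) u + 1) * jensenWeight s r u := by gcongr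
      have h6 : c * ((analyticOrderNatAt (comb (a j) g h) u : ℝ) * jensenWeight s r u) ≤
          c * ((analyticOrderNatAt (wronskian g h) u + 1) * jensenWeight s r u) := by gcongr
      have h7 : c * ((analyticOrderNatAt (wronskian g h) u : ℝ) * jensenWeight s r u) ≤
          1 * (analyticOrderNatAt (wronskian g h) u * jensenWeight s r u) := by gcongr
      linarith
    · intro i _ hij
      rw [hord i (hother i hij)]; simp
    · simp
    · intro i _ hij
      rw [if_neg fun hu => hother i hij ((hZ i u).1 hu).2]
    · simp
  · push Not at hex
    rw [Finset.sum_eq_zero, Finset.sum_eq_zero]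
    · have : (0 : ℝ) ≤ analyticOrderNatAt (wronskian g h) u * jensenWeight s r u := by positivity
      linarith
    · intro i _
      rw [hord i (hex i)]; simp
    · intro i _
      rw [if_neg fun hu => hex i ((hZ i u).1 hu).2]

/-! ### Holomorphic maps to the sphere and homogeneous coordinates. -/

/-- Holomorphy of a map from the plane to the sphere, at a point. -/
def HoloAt (F : ℂ → OnePoint ℂ) (z : ℂ) : Prop :=
  ContinuousAt F z ∧ AnalyticAt ℂ (fun w => sphereCoord (F z) (F w)) z

@[simp] lemma affineCoord_infty : affineCoord OnePoint.infty = 0 := rfl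

lemma infinityCoord_eq (p : OnePoint ℂ) : infinityCoord p = (affineCoord p)⁻¹ := by
  induction p using OnePoint.rec with
  | infty => simp [infinityCoord]
  | coe c => rfl

lemma sphereCoord_infty : sphereCoord OnePoint.infty = infinityCoord := if_pos rfl

lemma sphereCoord_of_ne {p : OnePoint ℂ} (hp : p ≠ OnePoint.infty) : sphereCoord p = affineCoord :=
  if_neg hp

lemma coe_affineCoord {p : OnePoint ℂ} (hp : p ≠ OnePoint.infty) : (affineCoord p : OnePoint ℂ) = p := by
  induction p using OnePoint.rec with
  | infty => exact absurd rfl hp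
  | coe c => rfl

/-- Each of the two coordinates takes the value 0 both at `0` and at `∞`, one of them as a junk
value. Continuity keeps `F w` away from the wrong one of these points, and there the coordinate is
injective. -/
lemma eventually_eq_of_sphereCoord_eq {F : ℂ → OnePoint ℂ} {z : ℂ} (hF : ContinuousAt F z) :
    ∀ᶠ w in 𝓝 z, sphereCoord (F z) (F w) = sphereCoord (F z) (F z) → F w = F z := by
  by_cases hz : F z = OnePoint.infty
  · have : ∀ᶠ w in 𝓝 z, F w ≠ ((0 : ℂ) : OnePoint ℂ) :=
      hF.eventually_ne (by rw [hz]; exact OnePoint.infty_ne_coe 0)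
    filter_upwards [this] with w hw h
    rw [hz, sphereCoord_infty, infinityCoord_eq, infinityCoord_eq, affineCoord_infty, inv_zero,
      inv_eq_zero] at h
    rw [hz]
    by_contra hne
    exact hw (by rw [← coe_affineCoord hne, h])
  · filter_upwards [hF.eventually_ne hz] with w hw h
    rw [sphereCoord_of_ne hz] at h
    rw [← coe_affineCoord hw, h, coe_affineCoord hz]

/-- The identity principle for maps to the sphere. -/
lemma eq_of_eventually_eq {F : ℂ → OnePoint ℂ} {U : Set ℂ} (hU' : IsPreconnected U)
    (hF : ∀ z ∈ U, HoloAt F z) {z₀ : ℂ} (hz₀ : z₀ ∈ U) {c : OnePoint ℂ}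
    (h : ∀ᶠ w in 𝓝 z₀, F w = c) : ∀ z ∈ U, F z = c := by
  -- The set of points near which `F = c` is open. It is relatively closed in `U`: at a limit point
  -- `F = c` by continuity, and the coordinate is then either locally constant or avoids its central
  -- value on a punctured neighbourhood.
  have hsub : U ⊆ {z | ∀ᶠ w in 𝓝 z, F w = c} := by
    refine hU'.subset_of_closure_inter_subset ?_ ⟨z₀, hz₀, h⟩ ?_
    · rw [isOpen_iff_mem_nhds]
      intro z hz
      exact hz.eventually_nhds
    · rintro z ⟨hz, hzU⟩
      have hfreq : ∃ᶠ w in 𝓝 z, F w = c := by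
        rw [mem_closure_iff_frequently] at hz
        exact hz.mono fun w hw => hw.self_of_nhds
      have hzc : F z = c := by
        by_contra hne
        exact hfreq ((hF z hzU).1.eventually_ne hne)
      have hinj := eventually_eq_of_sphereCoord_eq (hF z hzU).1
      rcases (hF z hzU).2.eventually_eq_or_eventually_ne
        (analyticAt_const (v := sphereCoord (F z) (F z))) with h1 | h1
      · filter_upwards [h1, hinj] with w hw hw'
        rw [← hzc]; exact hw' hw
      · exfalso
        have hz' := mem_closure_iff_frequently.1 hz
        obtain ⟨w, hw, hw'⟩ := (hz'.and_eventually (eventually_nhdsWithin_iff.1 h1).eventually_nhds).exists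
        have h2 : ∀ᶠ y in 𝓝[≠] w, False := by
          have hne : ∀ᶠ y in 𝓝[≠] w, y ≠ z := by
            rcases eq_or_ne w z with rfl | hwz
            · exact eventually_mem_nhdsWithin
            · exact (eventually_ne_nhds hwz).filter_mono nhdsWithin_le_nhds
          filter_upwards [hne, hw.filter_mono nhdsWithin_le_nhds,
            hw'.filter_mono nhdsWithin_le_nhds] with y hy1 hy2 hy3
          exact hy3 hy1 (by rw [hy2, hzc])
        exact (h2.exists).elim fun _ h => h
  exact fun z hz => (hsub hz).self_of_nhds

/-- The point of the sphere with homogeneous coordinates `[g : h]`. -/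
def sphereProj (g h : ℂ) : OnePoint ℂ := open Classical in if h = 0 then OnePoint.infty else ((g / h : ℂ) : OnePoint ℂ)

lemma affineCoord_sphereProj (g h : ℂ) : affineCoord (sphereProj g h) = g / h := by
  unfold sphereProj
  split_ifs with hh
  · simp [hh]
  · rfl

lemma sphereProj_eq_infty {g h : ℂ} : sphereProj g h = OnePoint.infty ↔ h = 0 := by
  unfold sphereProj
  split_ifs with hh
  · simp [hh]
  · simp [hh]

/-- A unit vector of homogeneous coordinates. -/
def sphereVec (p : OnePoint ℂ) : ℂ × ℂ :=
  p.elim (1, 0) fun c => (c / (√(1 + ‖c‖ ^ 2) : ℝ), 1 / ((√(1 + ‖c‖ ^ 2) : ℝ) : ℂ))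

lemma sphereVec_infty : sphereVec OnePoint.infty = (1, 0) := rfl

lemma sphereVec_coe (c : ℂ) : sphereVec (c : OnePoint ℂ) =
    (c / (√(1 + ‖c‖ ^ 2) : ℝ), 1 / ((√(1 + ‖c‖ ^ 2) : ℝ) : ℂ)) := rfl

lemma norm_sphereVec (p : OnePoint ℂ) : ‖(sphereVec p).1‖ ^ 2 + ‖(sphereVec p).2‖ ^ 2 = 1 := by
  induction p using OnePoint.rec with
  | infty => simp [sphereVec_infty]
  | coe c =>
    have h : (0 : ℝ) < 1 + ‖c‖ ^ 2 := by positivity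
    simp only [sphereVec_coe, norm_div, norm_one, Complex.norm_real, Real.norm_eq_abs, div_pow, sq_abs,
      Real.sq_sqrt h.le]
    field_simp
    ring

/-- The square of the chordal distance. -/
def chordSq (p a : OnePoint ℂ) : ℝ :=
  ‖(sphereVec a).2 * (sphereVec p).1 - (sphereVec a).1 * (sphereVec p).2‖ ^ 2

/-- The density of the pull-back of the spherical metric. -/
def sphDensity (F : ℂ → OnePoint ℂ) (z : ℂ) : ℝ :=
  (‖deriv (fun w => sphereCoord (F z) (F w)) z‖ / (1 + ‖sphereCoord (F z) (F z)‖ ^ 2)) ^ 2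

lemma comb_sphereVec_eq_zero_iff {a : OnePoint ℂ} {g h : ℂ → ℂ} {z : ℂ} (h0 : g z ≠ 0 ∨ h z ≠ 0) :
    comb (sphereVec a) g h z = 0 ↔ sphereProj (g z) (h z) = a := by
  induction a using OnePoint.rec with
  | infty => rw [sphereProj_eq_infty]; simp [comb, sphereVec_infty]
  | coe c =>
    have hn : ((√(1 + ‖c‖ ^ 2) : ℝ) : ℂ) ≠ 0 := by
      rw [Complex.ofReal_ne_zero]; positivity
    have e : comb (sphereVec c) g h z = (g z - c * h z) / (√(1 + ‖c‖ ^ 2) : ℝ) := by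
      simp only [comb, sphereVec_coe]; ring
    rw [e, div_eq_zero_iff, or_iff_left hn, sub_eq_zero]
    unfold sphereProj
    split_ifs with hh
    · simp [hh] at h0 ⊢; exact h0
    · rw [OnePoint.coe_eq_coe, div_eq_iff hh]

lemma chordSq_eq {a p : OnePoint ℂ} {g h : ℂ → ℂ} {z : ℂ} (h0 : g z ≠ 0 ∨ h z ≠ 0)
    (hp : p = sphereProj (g z) (h z)) :
    chordSq p a = ‖comb (sphereVec a) g h z‖ ^ 2 / wnorm 1 1 g h z := by
  subst hp
  by_cases hh : h z = 0
  · have hg : g z ≠ 0 := by simpa [hh] using h0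
    rw [sphereProj_eq_infty.2 hh, chordSq, sphereVec_infty]
    simp only [comb, wnorm, hh]
    have : ‖g z‖ ≠ 0 := norm_ne_zero_iff.2 hg
    simp [mul_pow]
    field_simp
  · have e1 : sphereProj (g z) (h z) = ((g z / h z : ℂ) : OnePoint ℂ) := if_neg hh
    have hc : (0 : ℝ) < 1 + ‖g z / h z‖ ^ 2 := by positivity
    have hhn : ‖h z‖ ≠ 0 := norm_ne_zero_iff.2 hh
    have e2 : (sphereVec a).2 * (g z / h z / (√(1 + ‖g z / h z‖ ^ 2) : ℝ)) -
        (sphereVec a).1 * (1 / ((√(1 + ‖g z / h z‖ ^ 2) : ℝ) : ℂ)) =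
        comb (sphereVec a) g h z / (h z * (√(1 + ‖g z / h z‖ ^ 2) : ℝ)) := by
      have hn : ((√(1 + ‖g z / h z‖ ^ 2) : ℝ) : ℂ) ≠ 0 := by
        rw [Complex.ofReal_ne_zero]; positivity
      rw [comb]
      field_simp
    rw [e1, chordSq, sphereVec_coe, e2, norm_div, norm_mul, Complex.norm_real, Real.norm_eq_abs,
      div_pow, mul_pow, sq_abs, Real.sq_sqrt hc.le, norm_div, wnorm]
    congr 1
    field_simp
    ring

lemma wnorm_pos {g h : ℂ → ℂ} {z : ℂ} (h0 : g z ≠ 0 ∨ h z ≠ 0) : 0 < wnorm 1 1 g h z := by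
  rw [wnorm]
  rcases h0 with h0 | h0
  · have := norm_pos_iff.2 h0; positivity
  · have := norm_pos_iff.2 h0; positivity

lemma sphereVec_det_ne_zero {a b : OnePoint ℂ} (hab : a ≠ b) :
    (sphereVec a).1 * (sphereVec b).2 - (sphereVec a).2 * (sphereVec b).1 ≠ 0 := by
  have h0 : ∀ p : OnePoint ℂ, (sphereVec p).1 ≠ 0 ∨ (sphereVec p).2 ≠ 0 := by
    intro p
    by_contra! h
    have := norm_sphereVec p
    simp [h.1, h.2] at this
  have hp : ∀ p : OnePoint ℂ, sphereProj (sphereVec p).1 (sphereVec p).2 = p := by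
    intro p
    have := (comb_sphereVec_eq_zero_iff (a := p) (g := fun _ => (sphereVec p).1)
      (h := fun _ => (sphereVec p).2) (z := 0) (h0 p)).1
    exact this (by simp only [comb]; ring)
  intro h
  apply hab
  have := (comb_sphereVec_eq_zero_iff (a := b) (g := fun _ => (sphereVec a).1)
      (h := fun _ => (sphereVec a).2) (z := 0) (h0 a)).1
  rw [← hp a]
  exact this (by simp only [comb]; linear_combination h)

/-- The pair `g, h` of holomorphic functions without common zeros represents `F` on `U`. -/
structure IsRep (F : ℂ → OnePoint ℂ) (g h : ℂ → ℂ) (U : Set ℂ) : Prop where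
  isOpen : IsOpen U
  left : ∀ z ∈ U, AnalyticAt ℂ g z
  right : ∀ z ∈ U, AnalyticAt ℂ h z
  ne : ∀ z ∈ U, g z ≠ 0 ∨ h z ≠ 0
  eq : ∀ z ∈ U, F z = sphereProj (g z) (h z)

namespace IsRep

variable {F : ℂ → OnePoint ℂ} {g h : ℂ → ℂ} {U : Set ℂ} {z : ℂ}

lemma coord_of_ne (H : IsRep F g h U) (hz : z ∈ U) (hh : h z ≠ 0) :
    (fun w => sphereCoord (F z) (F w)) =ᶠ[𝓝 z] fun w => g w / h w := by
  have : F z ≠ OnePoint.infty := by rwa [H.eq z hz, Ne, sphereProj_eq_infty]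
  rw [sphereCoord_of_ne this]
  filter_upwards [H.isOpen.mem_nhds hz] with w hw
  rw [H.eq w hw, affineCoord_sphereProj]

lemma coord_of_eq (H : IsRep F g h U) (hz : z ∈ U) (hh : h z = 0) :
    (fun w => sphereCoord (F z) (F w)) =ᶠ[𝓝 z] fun w => h w / g w := by
  have : F z = OnePoint.infty := by rwa [H.eq z hz, sphereProj_eq_infty]
  rw [this, sphereCoord_infty]
  filter_upwards [H.isOpen.mem_nhds hz] with w hw
  rw [H.eq w hw, infinityCoord_eq, affineCoord_sphereProj, inv_div]

/-- The quotient rule gives the same expression in both coordinates of the sphere. In this form the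
density is visibly continuous across the poles of `F`. -/
lemma sphDensity_eq (H : IsRep F g h U) (hz : z ∈ U) :
    sphDensity F z = ‖wronskian g h z‖ ^ 2 / wnorm 1 1 g h z ^ 2 := by
  have hg := (H.left z hz).differentiableAt.hasDerivAt
  have hh := (H.right z hz).differentiableAt.hasDerivAt
  have hP := wnorm_pos (H.ne z hz)
  by_cases h0 : h z = 0
  · have hg0 : g z ≠ 0 := by simpa [h0] using H.ne z hz
    have e := H.coord_of_eq hz h0
    have e' : sphereCoord (F z) (F z) = h z / g z := e.self_of_nhds
    have hgn : ‖g z‖ ≠ 0 := norm_ne_zero_iff.2 hg0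
    rw [sphDensity, e.deriv_eq, (hh.fun_div hg hg0).deriv, e', wronskian, wnorm]
    simp only [h0]
    simp only [norm_div, norm_pow, norm_mul, zero_mul, mul_zero, sub_zero, norm_zero, zero_div]
    field_simp
    ring
  · have e := H.coord_of_ne hz h0
    have e' : sphereCoord (F z) (F z) = g z / h z := e.self_of_nhds
    have hhn : ‖h z‖ ≠ 0 := norm_ne_zero_iff.2 h0
    rw [sphDensity, e.deriv_eq, (hg.fun_div hh h0).deriv, e', wronskian, wnorm, ← norm_neg (g z * _ - _),
      neg_sub]
    simp only [norm_div, norm_pow]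
    have : (0 : ℝ) < ‖h z‖ ^ 2 + ‖g z‖ ^ 2 := by positivity
    field_simp
    ring

lemma chordSq_eq (H : IsRep F g h U) (hz : z ∈ U) (a : OnePoint ℂ) :
    chordSq (F z) a = ‖comb (sphereVec a) g h z‖ ^ 2 / wnorm 1 1 g h z :=
  SNevanlinna.chordSq_eq (H.ne z hz) (H.eq z hz)

lemma comb_eq_zero_iff (H : IsRep F g h U) (hz : z ∈ U) (a : OnePoint ℂ) :
    comb (sphereVec a) g h z = 0 ↔ F z = a := by
  rw [comb_sphereVec_eq_zero_iff (H.ne z hz), H.eq z hz]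

lemma not_eventually_comb (H : IsRep F g h U) (hz : z ∈ U) (a : OnePoint ℂ)
    (hF : ∀ c, ¬ ∀ᶠ w in 𝓝 z, F w = c) : ¬ ∀ᶠ w in 𝓝 z, comb (sphereVec a) g h w = 0 := by
  intro hk
  refine hF a ?_
  filter_upwards [hk, H.isOpen.mem_nhds hz] with w hw hwU using (H.comb_eq_zero_iff hwU a).1 hw

/-- Up to sign the Wronskian is the numerator of the derivative of `g / h` or `h / g`; if it
vanished near `z`, the map would be locally constant. -/
lemma not_eventually_wronskian (H : IsRep F g h U) (hz : z ∈ U) (hFc : HoloAt F z)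
    (hF : ∀ c, ¬ ∀ᶠ w in 𝓝 z, F w = c) : ¬ ∀ᶠ w in 𝓝 z, wronskian g h w = 0 := by
  intro hW
  refine hF (F z) ?_
  set u := fun w => sphereCoord (F z) (F w) with hu
  suffices hd : ∀ᶠ w in 𝓝 z, deriv u w = 0 by
    have h1 := hFc.2.analyticOrderAt_deriv_add_one
    rw [analyticOrderAt_eq_top.2 hd, top_add] at h1
    filter_upwards [analyticOrderAt_eq_top.1 h1.symm, eventually_eq_of_sphereCoord_eq hFc.1]
      with w hw hw'
    exact hw' (sub_eq_zero.1 hw)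
  by_cases h0 : h z = 0
  · have hg0 : g z ≠ 0 := by simpa [h0] using H.ne z hz
    have e := (H.coord_of_eq hz h0).eventuallyEq_nhds
    filter_upwards [hW, e, (H.left z hz).eventually_analyticAt, (H.right z hz).eventually_analyticAt,
      (H.left z hz).continuousAt.eventually_ne hg0] with w hw1 hw2 hw3 hw4 hw5
    rw [hw2.deriv_eq, (hw4.differentiableAt.hasDerivAt.fun_div hw3.differentiableAt.hasDerivAt hw5).deriv,
      div_eq_zero_iff]
    left
    rw [wronskian] at hw1
    linear_combination hw1
  · have e := (H.coord_of_ne hz h0).eventuallyEq_nhds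
    filter_upwards [hW, e, (H.left z hz).eventually_analyticAt, (H.right z hz).eventually_analyticAt,
      (H.right z hz).continuousAt.eventually_ne h0] with w hw1 hw2 hw3 hw4 hw5
    rw [hw2.deriv_eq, (hw3.differentiableAt.hasDerivAt.fun_div hw4.differentiableAt.hasDerivAt hw5).deriv,
      div_eq_zero_iff]
    left
    rw [wronskian] at hw1
    linear_combination -hw1

end IsRep

namespace HoloAt

variable {F : ℂ → OnePoint ℂ} {z : ℂ}

lemma meromorphicAt (hF : HoloAt F z) : MeromorphicAt (fun w => affineCoord (F w)) z := by
  by_cases hz : F z = OnePoint.infty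
  · have h := hF.2.meromorphicAt
    rw [hz, sphereCoord_infty] at h
    simp only [infinityCoord_eq] at h
    have h2 := h.inv
    have : (fun w => (affineCoord (F w))⁻¹)⁻¹ = fun w => affineCoord (F w) := by
      ext w; simp
    rwa [this] at h2
  · have h := hF.2.meromorphicAt
    rwa [sphereCoord_of_ne hz] at h

lemma eventually_ne_infty (hF : HoloAt F z) (hnc : ∀ c, ¬ ∀ᶠ w in 𝓝 z, F w = c) :
    ∀ᶠ w in 𝓝[≠] z, F w ≠ OnePoint.infty := by
  by_cases hz : F z = OnePoint.infty
  · rcases hF.2.eventually_eq_or_eventually_ne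
      (analyticAt_const (v := sphereCoord (F z) (F z))) with h1 | h1
    · refine absurd ?_ (hnc (F z))
      filter_upwards [h1, eventually_eq_of_sphereCoord_eq hF.1] with w hw hw' using hw' hw
    · filter_upwards [h1] with w hw h0
      exact hw (by rw [h0, hz])
  · exact (hF.1.eventually_ne hz).filter_mono nhdsWithin_le_nhds

/-- The affine coordinate is also 0 at `∞`, so poles must be excluded near `z` before its vanishing
can be read as `F = 0`. -/
lemma meromorphicOrderAt_ne_top (hF : HoloAt F z) (hnc : ∀ c, ¬ ∀ᶠ w in 𝓝 z, F w = c) :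
    meromorphicOrderAt (fun w => affineCoord (F w)) z ≠ ⊤ := by
  rw [Ne, meromorphicOrderAt_eq_top_iff]
  intro h
  have h0 : ∀ᶠ w in 𝓝[≠] z, F w = ((0 : ℂ) : OnePoint ℂ) := by
    filter_upwards [h, hF.eventually_ne_infty hnc] with w hw hw'
    rw [← coe_affineCoord hw', hw]
  have hz : F z = ((0 : ℂ) : OnePoint ℂ) := by
    have h1 : Tendsto F (𝓝[≠] z) (𝓝 (F z)) := hF.1.tendsto.mono_left nhdsWithin_le_nhds
    exact tendsto_nhds_unique h1 (tendsto_const_nhds.congr' (h0.mono fun w hw => hw.symm))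
  refine hnc _ (?_ : ∀ᶠ w in 𝓝 z, F w = ((0 : ℂ) : OnePoint ℂ))
  rw [eventually_nhdsWithin_iff] at h0
  filter_upwards [h0] with w hw
  by_cases hwz : w = z
  · rw [hwz, hz]
  · exact hw hwz

end HoloAt

/-- A holomorphic map from a disc to the sphere is represented, on a smaller disc, by a pair of
holomorphic functions without common zeros. -/
theorem exists_isRep {F : ℂ → OnePoint ℂ} {r : ℝ}
    (hF : ∀ z ∈ Metric.closedBall (0 : ℂ) r, HoloAt F z)
    (hnc : ∀ z ∈ Metric.closedBall (0 : ℂ) r, ∀ c, ¬ ∀ᶠ w in 𝓝 z, F w = c) :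
    ∃ g h, IsRep F g h (Metric.ball 0 r) := by
  set K := Metric.closedBall (0 : ℂ) r with hK
  set m : ℂ → ℂ := fun w => affineCoord (F w) with hm
  have hmer : MeromorphicOn m K := fun z hz => (hF z hz).meromorphicAt
  have hfin := (MeromorphicOn.divisor m K).finiteSupport (isCompact_closedBall 0 r)
  obtain ⟨g₀, hg₀, hg₀0, heq⟩ := hmer.extract_zeros_poles
    (fun u => (hF u u.2).meromorphicOrderAt_ne_top (hnc u u.2)) hfin
  set D := MeromorphicOn.divisor m K with hD
  set Z := hfin.toFinset with hZ
  have hprod : ∀ w, (∏ᶠ u, (fun y : ℂ => y - u) ^ D u) w = ∏ u ∈ Z, (w - u) ^ D u := by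
    intro w
    rw [finprod_eq_prod_of_mulSupport_subset (s := Z)]
    · simp [Finset.prod_apply]
    · intro u hu
      rw [hZ, Finite.coe_toFinset, Function.mem_support]
      intro h0
      simp [h0] at hu
  -- Poles go into `h` and zeros into `g`. The integers `D u` and `-D u` are not both positive,
  -- hence there is no common zero.
  let h : ℂ → ℂ := fun w => ∏ u ∈ Z, (w - u) ^ (-D u).toNat
  let g : ℂ → ℂ := fun w => (∏ u ∈ Z, (w - u) ^ (D u).toNat) * g₀ w
  have hpoly : ∀ n : ℂ → ℕ, ∀ z, AnalyticAt ℂ (fun w => ∏ u ∈ Z, (w - u) ^ n u) z := by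
    intro n z
    refine Finset.analyticAt_fun_prod _ fun u _ => ?_
    exact (analyticAt_id.sub analyticAt_const).pow _
  have hgan : ∀ z ∈ K, AnalyticAt ℂ g z := fun z hz => (hpoly _ z).mul (hg₀ z hz)
  have hhan : ∀ z, AnalyticAt ℂ h z := fun z => hpoly _ z
  have hne : ∀ z ∈ K, g z ≠ 0 ∨ h z ≠ 0 := by
    intro z hz
    by_contra! hc
    obtain ⟨hc1, hc2⟩ := hc
    obtain ⟨u, -, hu⟩ := Finset.prod_eq_zero_iff.1 ((mul_eq_zero.1 hc1).resolve_right (hg₀0 ⟨z, hz⟩))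
    obtain ⟨v, -, hv⟩ := Finset.prod_eq_zero_iff.1 hc2
    rw [pow_eq_zero_iff', sub_eq_zero] at hu hv
    have : u = v := hu.1.symm.trans hv.1
    subst this
    omega
  refine ⟨g, h, Metric.isOpen_ball, fun z hz => hgan z (Metric.ball_subset_closedBall hz),
    fun z _ => hhan z, fun z hz => hne z (Metric.ball_subset_closedBall hz), fun z hz => ?_⟩
  have hzK : z ∈ K := Metric.ball_subset_closedBall hz
  -- The factorization holds only off a discrete set. The value of `F` at `z` is recovered below by
  -- taking limits, in the coordinate that is valid at `F z`.
  have hmul : ∀ᶠ w in 𝓝[≠] z, m w * h w = g w := by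
    have hacc : AccPt z (𝓟 K) := by
      have : K ∈ 𝓝 z := Metric.closedBall_mem_nhds_of_mem hz
      rw [accPt_iff_frequently_nhdsNE]
      exact ((eventually_of_mem (mem_nhdsWithin_of_mem_nhds this) fun w hw => hw)).frequently
    have h1 := (hmer z hzK).eventuallyEq_nhdsNE_of_eventuallyEq_codiscreteWithin
      (((Function.FactorizedRational.meromorphicNFOn D K).meromorphicOn z hzK).smul
        (hg₀ z hzK).meromorphicAt) hzK hacc heq
    have h2 : ∀ᶠ w in 𝓝[≠] z, w ∉ (Z : Set ℂ) := by
      have h3 : ∀ᶠ w in 𝓝[≠] z, w ∉ (Z : Set ℂ) \ {z} := by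
        refine Eventually.filter_mono nhdsWithin_le_nhds ?_
        exact ((Z.finite_toSet.subset sdiff_subset).isClosed.isOpen_compl).mem_nhds (by simp)
      filter_upwards [h3, eventually_mem_nhdsWithin] with w hw hw' hwZ
      exact hw ⟨hwZ, hw'⟩
    filter_upwards [h1, h2] with w hw hwZ
    rw [hw]
    show ((∏ᶠ u, (fun y : ℂ => y - u) ^ D u) w • g₀ w) * h w = g w
    rw [hprod, smul_eq_mul]
    have h4 : (∏ u ∈ Z, (w - u) ^ D u) * h w = ∏ u ∈ Z, (w - u) ^ (D u).toNat := by
      rw [← Finset.prod_mul_distrib]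
      refine Finset.prod_congr rfl fun u hu => ?_
      have hwu : w - u ≠ 0 := by
        rw [sub_ne_zero]
        rintro rfl
        exact hwZ hu
      rw [← zpow_natCast, ← zpow_natCast, ← zpow_add₀ hwu]
      congr 1
      omega
    show _ = (∏ u ∈ Z, (w - u) ^ (D u).toNat) * g₀ w
    rw [← h4]; ring
  have hgc : Tendsto g (𝓝[≠] z) (𝓝 (g z)) :=
    (hgan z hzK).continuousAt.tendsto.mono_left nhdsWithin_le_nhds
  have hhc : Tendsto h (𝓝[≠] z) (𝓝 (h z)) :=
    (hhan z).continuousAt.tendsto.mono_left nhdsWithin_le_nhds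
  have hcoord := (hF z hzK).2.continuousAt.tendsto.mono_left (nhdsWithin_le_nhds (s := {z}ᶜ))
  by_cases hinf : F z = OnePoint.infty
  · rw [hinf, eq_comm, sphereProj_eq_infty]
    rw [hinf, sphereCoord_infty, infinityCoord_eq OnePoint.infty, affineCoord_infty, inv_zero] at hcoord
    have h1 : Tendsto (fun w => g w * infinityCoord (F w)) (𝓝[≠] z) (𝓝 (g z * 0)) :=
      hgc.mul hcoord
    have h2 : ∀ᶠ w in 𝓝[≠] z, h w = g w * infinityCoord (F w) := by
      have h0 : ∀ᶠ w in 𝓝[≠] z, F w ≠ ((0 : ℂ) : OnePoint ℂ) :=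
        ((hF z hzK).1.eventually_ne (by rw [hinf]; exact OnePoint.infty_ne_coe 0)).filter_mono
          nhdsWithin_le_nhds
      filter_upwards [hmul, h0, (hF z hzK).eventually_ne_infty (hnc z hzK)] with w hw hw0 hwi
      have hm0 : affineCoord (F w) ≠ 0 := by
        intro hc
        exact hw0 (by rw [← coe_affineCoord hwi, hc])
      rw [← hw, infinityCoord_eq, hm]
      field_simp
    have := tendsto_nhds_unique hhc (h1.congr' (h2.mono fun w hw => hw.symm))
    rw [this, mul_zero]
  · rw [sphereCoord_of_ne hinf] at hcoord
    have h1 := tendsto_nhds_unique ((hcoord.mul hhc).congr' hmul) hgc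
    have hh0 : h z ≠ 0 := by
      intro h0
      rw [h0, mul_zero] at h1
      exact (hne z hzK).elim (fun h => h h1.symm) fun h => h h0
    rw [← coe_affineCoord hinf]
    unfold sphereProj
    rw [if_neg hh0, ← h1, mul_div_cancel_right₀ _ hh0]

lemma IsRep.continuousOn_sphDensity {F : ℂ → OnePoint ℂ} {g h : ℂ → ℂ} {U : Set ℂ}
    (H : IsRep F g h U) : ContinuousOn (sphDensity F) U := by
  have h1 : ContinuousOn g U := fun z hz => (H.left z hz).continuousAt.continuousWithinAt
  have h2 : ContinuousOn h U := fun z hz => (H.right z hz).continuousAt.continuousWithinAt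
  have h3 : ContinuousOn (wronskian g h) U := fun z hz =>
    (analyticAt_wronskian (H.left z hz) (H.right z hz)).continuousAt.continuousWithinAt
  have h4 : ContinuousOn (wnorm 1 1 g h) U := by unfold wnorm; fun_prop
  refine ((h3.norm.pow 2).div (h4.pow 2) fun z hz => ?_).congr fun z hz => H.sphDensity_eq hz
  exact pow_ne_zero _ (wnorm_pos (H.ne z hz)).ne'

lemma IsRep.continuousOn_chordSq {F : ℂ → OnePoint ℂ} {g h : ℂ → ℂ} {U : Set ℂ}
    (H : IsRep F g h U) (a : OnePoint ℂ) : ContinuousOn (fun z => chordSq (F z) a) U := by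
  have h1 : ContinuousOn g U := fun z hz => (H.left z hz).continuousAt.continuousWithinAt
  have h2 : ContinuousOn h U := fun z hz => (H.right z hz).continuousAt.continuousWithinAt
  have h4 : ContinuousOn (wnorm 1 1 g h) U := by unfold wnorm; fun_prop
  have h3 : ContinuousOn (comb (sphereVec a) g h) U := by unfold comb; fun_prop
  refine ((h3.norm.pow 2).div h4 fun z hz => ?_).congr fun z hz => H.chordSq_eq hz a
  exact (wnorm_pos (H.ne z hz)).ne'

/-! ### Chordal distances to several points. -/

lemma chordSq_nonneg (p a : OnePoint ℂ) : 0 ≤ chordSq p a := sq_nonneg _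

lemma exists_homogeneous (p : OnePoint ℂ) :
    ∃ g h : ℂ, (g ≠ 0 ∨ h ≠ 0) ∧ p = sphereProj g h := by
  induction p using OnePoint.rec with
  | infty => exact ⟨1, 0, by simp, (sphereProj_eq_infty.2 rfl).symm⟩
  | coe c => exact ⟨c, 1, by simp, by simp [sphereProj]⟩

lemma chordSq_le_one (p a : OnePoint ℂ) : chordSq p a ≤ 1 := by
  obtain ⟨g, h, h0, hp⟩ := exists_homogeneous p
  rw [chordSq_eq (g := fun _ => g) (h := fun _ => h) (z := 0) h0 hp, div_le_one (wnorm_pos h0),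
    ← wnorm_comb (norm_sphereVec a)]
  simp only [wnorm, one_mul]
  nlinarith [sq_nonneg ‖coComb (sphereVec a) (fun _ => g) (fun _ => h) (0 : ℂ)‖]

lemma chordSq_eq_zero_iff {p a : OnePoint ℂ} : chordSq p a = 0 ↔ p = a := by
  obtain ⟨g, h, h0, hp⟩ := exists_homogeneous p
  rw [chordSq_eq (g := fun _ => g) (h := fun _ => h) (z := 0) h0 hp, div_eq_zero_iff,
    or_iff_left (wnorm_pos h0).ne', pow_eq_zero_iff two_ne_zero, norm_eq_zero,
    comb_sphereVec_eq_zero_iff h0, hp]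

/-- Two distinct points of the sphere cannot both be close to a third one. -/
lemma exists_le_chordSq_add {a b : OnePoint ℂ} (hab : a ≠ b) :
    ∃ c > 0, ∀ p, c ≤ chordSq p a + chordSq p b := by
  refine ⟨‖(sphereVec a).1 * (sphereVec b).2 - (sphereVec a).2 * (sphereVec b).1‖ ^ 2 / 4, ?_, ?_⟩
  · have := norm_pos_iff.2 (sphereVec_det_ne_zero hab)
    positivity
  · intro p
    obtain ⟨g, h, h0, hp⟩ := exists_homogeneous p
    have hP := wnorm_pos (g := fun _ => g) (h := fun _ => h) (z := 0) h0
    have := wnorm_le_comb (g := fun _ => g) (h := fun _ => h) (z := 0) (norm_sphereVec a)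
      (norm_sphereVec b)
    rw [chordSq_eq (g := fun _ => g) (h := fun _ => h) (z := 0) h0 hp,
      chordSq_eq (g := fun _ => g) (h := fun _ => h) (z := 0) h0 hp, ← add_div, le_div_iff₀ hP]
    linarith

lemma exists_le_chordSq {q : ℕ} {a : Fin q → OnePoint ℂ} (ha : Function.Injective a) :
    ∃ c > 0, c ≤ 1 ∧ ∀ p i j, i ≠ j → c ≤ chordSq p (a i) + chordSq p (a j) := by
  have h : ∀ ij : Fin q × Fin q, ∃ c > 0, c ≤ 1 ∧
      (ij.1 ≠ ij.2 → ∀ p, c ≤ chordSq p (a ij.1) + chordSq p (a ij.2)) := by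
    rintro ⟨i, j⟩
    by_cases hij : i = j
    · exact ⟨1, one_pos, le_rfl, fun h => absurd hij h⟩
    · obtain ⟨c, hc, h⟩ := exists_le_chordSq_add (ha.ne hij)
      exact ⟨min c 1, lt_min hc one_pos, min_le_right _ _, fun _ p => (min_le_left _ _).trans (h p)⟩
  choose c hc hc1 hcs using h
  rcases isEmpty_or_nonempty (Fin q × Fin q) with he | hne
  · refine ⟨1, one_pos, le_rfl, fun p i j => (he.false (i, j)).elim⟩
  · obtain ⟨ij, hij⟩ := Finite.exists_min c
    exact ⟨c ij, hc ij, hc1 ij, fun p i j h => (hij (i, j)).trans (hcs (i, j) h p)⟩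

/-- The product of the negative powers of the distances is controlled by their sum. -/
lemma exists_prod_rpow_le_sum {q : ℕ} (hq : 0 < q) {a : Fin q → OnePoint ℂ}
    (ha : Function.Injective a) {e : ℝ} (he : e ≤ 0) (he1 : -1 ≤ e) :
    ∃ M > 0, ∀ p, (∀ j, p ≠ a j) → ∏ j, chordSq p (a j) ^ e ≤ M * ∑ j, chordSq p (a j) ^ e := by
  obtain ⟨c, hc, hc1, hcs⟩ := exists_le_chordSq ha
  refine ⟨(2 / c) ^ q, by positivity, fun p hp => ?_⟩
  have : Nonempty (Fin q) := ⟨⟨0, hq⟩⟩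
  have hpos : ∀ j, 0 < chordSq p (a j) := fun j =>
    (chordSq_nonneg _ _).lt_of_ne fun h => hp j (chordSq_eq_zero_iff.1 h.symm)
  -- Let `a i` be the closest point to `p`. For every other `j` the squared distance is at least `c
  -- / 2 ≤ 1`, so with `-1 ≤ e ≤ 0` its factor is at most `2 / c`; only the factor of `i` can be
  -- large.
  obtain ⟨i, hi⟩ := Finite.exists_min fun j => chordSq p (a j)
  have hother : ∀ j ∈ Finset.univ.erase i, chordSq p (a j) ^ e ≤ 2 / c := by
    intro j hj
    have hji := (Finset.mem_erase.1 hj).1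
    have h1 : c / 2 ≤ chordSq p (a j) := by
      have := hcs p j i hji
      have := hi j
      linarith
    calc chordSq p (a j) ^ e ≤ (c / 2) ^ e := Real.rpow_le_rpow_of_nonpos (by positivity) h1 he
      _ ≤ (c / 2) ^ (-1 : ℝ) := Real.rpow_le_rpow_of_exponent_ge (by positivity) (by linarith) he1
      _ = 2 / c := by rw [Real.rpow_neg_one, inv_div]
  rw [← Finset.mul_prod_erase _ _ (Finset.mem_univ i), mul_comm]
  have hbig : 1 ≤ 2 / c := by rw [le_div_iff₀ hc]; linarith
  have h2 : ∏ j ∈ Finset.univ.erase i, chordSq p (a j) ^ e ≤ (2 / c) ^ q := by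
    calc ∏ j ∈ Finset.univ.erase i, chordSq p (a j) ^ e
        ≤ ∏ j ∈ Finset.univ.erase i, (2 / c) :=
          Finset.prod_le_prod (fun j _ => (Real.rpow_pos_of_pos (hpos j) _).le) hother
      _ = (2 / c) ^ (Finset.univ.erase i).card := by rw [Finset.prod_const]
      _ ≤ (2 / c) ^ q := by
          refine pow_le_pow_right₀ hbig ?_
          refine (Finset.card_le_univ _).trans ?_
          simp
  have h3 : chordSq p (a i) ^ e ≤ ∑ j, chordSq p (a j) ^ e :=
    Finset.single_le_sum (f := fun j => chordSq p (a j) ^ e)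
      (fun j _ => (Real.rpow_pos_of_pos (hpos j) _).le) (Finset.mem_univ i)
  exact mul_le_mul h2 h3 (Real.rpow_pos_of_pos (hpos i) _).le (by positivity)

/-! ### Iterated integrals in polar coordinates. -/

/-- The integral of `κ` over the directions, on the circle of radius `ρ`. -/
def angInt (κ : ℂ → ℝ) (ρ : ℝ) : ℝ := ∫ θ in (0 : ℝ)..2 * Real.pi, κ (ρ * dir θ)

/-- The integral of `κ` over the disc of radius `t`, in polar coordinates. -/
def radInt (κ : ℂ → ℝ) (t : ℝ) : ℝ := ∫ ρ in (0 : ℝ)..t, ρ * angInt κ ρ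

/-- The logarithmic mean of the integrals of `κ` over discs. -/
def logInt (κ : ℂ → ℝ) (s r : ℝ) : ℝ := ∫ t in s..r, radInt κ t / t

/-- Version of `angInt` with values in `[0, ∞]`. -/
def langInt (κ : ℂ → ℝ≥0∞) (ρ : ℝ) : ℝ≥0∞ := ∫⁻ θ in Ioc (-Real.pi) Real.pi, κ (ρ * dir θ)

/-- Version of `radInt` with values in `[0, ∞]`. -/
def lradInt (κ : ℂ → ℝ≥0∞) (t : ℝ) : ℝ≥0∞ := ∫⁻ ρ in Ioc 0 t, ENNReal.ofReal ρ * langInt κ ρ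

/-- Version of `logInt` with values in `[0, ∞]`. -/
def llogInt (κ : ℂ → ℝ≥0∞) (s r : ℝ) : ℝ≥0∞ := ∫⁻ t in Ioc s r, ENNReal.ofReal t⁻¹ * lradInt κ t

section real

variable {κ κ' : ℂ → ℝ} {R : ℝ}

lemma continuousOn_angInt (hκ : ContinuousOn κ (Metric.ball 0 R)) :
    ContinuousOn (angInt κ) (Ico 0 R) := by
  rw [continuousOn_iff_continuous_domRestrict] at *
  apply intervalIntegral.continuous_parametric_intervalIntegral_of_continuous'
  have (x : Ico 0 R × ℝ) : ((x.1 : ℝ) : ℂ) * dir x.2 ∈ Metric.ball (0 : ℂ) R :=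
    mul_dir_mem_ball (by rw [abs_of_nonneg x.1.2.1]; exact x.1.2.2) _
  exact hκ.comp (f := fun x : Ico 0 R × ℝ => (⟨((x.1 : ℝ) : ℂ) * dir x.2, this x⟩ :
    Metric.ball (0 : ℂ) R)) (by fun_prop)

lemma intervalIntegrable_ang (hκ : ContinuousOn κ (Metric.ball 0 R)) {ρ : ℝ} (hρ : 0 ≤ ρ)
    (hρR : ρ < R) (a b : ℝ) : IntervalIntegrable (fun θ => κ (ρ * dir θ)) volume a b := by
  refine ContinuousOn.intervalIntegrable (hκ.comp (Continuous.continuousOn (by fun_prop)) ?_)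
  exact fun θ _ => mul_dir_mem_ball (by rwa [abs_of_nonneg hρ]) θ

lemma intervalIntegrable_rad (hκ : ContinuousOn κ (Metric.ball 0 R)) {t : ℝ} (ht : 0 ≤ t)
    (htR : t < R) : IntervalIntegrable (fun ρ => ρ * angInt κ ρ) volume 0 t := by
  refine ContinuousOn.intervalIntegrable (continuousOn_id.mul ((continuousOn_angInt hκ).mono ?_))
  rw [uIcc_of_le ht]
  exact fun x hx => ⟨hx.1, hx.2.trans_lt htR⟩

lemma continuousOn_radInt (hκ : ContinuousOn κ (Metric.ball 0 R)) {r : ℝ} (hr : 0 ≤ r)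
    (hrR : r < R) : ContinuousOn (radInt κ) (Icc 0 r) := by
  have := intervalIntegral.continuousOn_primitive_interval (a := 0) (b := r)
    (f := fun ρ => ρ * angInt κ ρ) (μ := volume) ?_
  · rwa [uIcc_of_le hr] at this
  · rw [← intervalIntegrable_iff']
    · exact intervalIntegrable_rad hκ hr hrR

lemma intervalIntegrable_log (hκ : ContinuousOn κ (Metric.ball 0 R)) {s r : ℝ} (hs : 0 < s)
    (hsr : s ≤ r) (hrR : r < R) : IntervalIntegrable (fun t => radInt κ t / t) volume s r := by
  refine ContinuousOn.intervalIntegrable ?_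
  rw [uIcc_of_le hsr]
  refine ((continuousOn_radInt hκ (hs.le.trans hsr) hrR).mono ?_).div continuousOn_id ?_
  · exact Icc_subset_Icc_left hs.le
  · exact fun x hx => (hs.trans_le hx.1).ne'

lemma angInt_mono (hκ : ContinuousOn κ (Metric.ball 0 R)) (hκ' : ContinuousOn κ' (Metric.ball 0 R))
    (h : ∀ z ∈ Metric.ball (0 : ℂ) R, κ z ≤ κ' z) {ρ : ℝ} (hρ : 0 ≤ ρ) (hρR : ρ < R) :
    angInt κ ρ ≤ angInt κ' ρ :=
  intervalIntegral.integral_mono_on (by positivity) (intervalIntegrable_ang hκ hρ hρR _ _)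
    (intervalIntegrable_ang hκ' hρ hρR _ _) fun θ _ =>
      h _ (mul_dir_mem_ball (by rwa [abs_of_nonneg hρ]) θ)

lemma radInt_mono (hκ : ContinuousOn κ (Metric.ball 0 R)) (hκ' : ContinuousOn κ' (Metric.ball 0 R))
    (h : ∀ z ∈ Metric.ball (0 : ℂ) R, κ z ≤ κ' z) {t : ℝ} (ht : 0 ≤ t) (htR : t < R) :
    radInt κ t ≤ radInt κ' t :=
  intervalIntegral.integral_mono_on ht (intervalIntegrable_rad hκ ht htR)
    (intervalIntegrable_rad hκ' ht htR) fun _ hρ =>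
      mul_le_mul_of_nonneg_left (angInt_mono hκ hκ' h hρ.1 (hρ.2.trans_lt htR)) hρ.1

lemma logInt_mono (hκ : ContinuousOn κ (Metric.ball 0 R)) (hκ' : ContinuousOn κ' (Metric.ball 0 R))
    (h : ∀ z ∈ Metric.ball (0 : ℂ) R, κ z ≤ κ' z) {s r : ℝ} (hs : 0 < s) (hsr : s ≤ r)
    (hrR : r < R) : logInt κ s r ≤ logInt κ' s r :=
  intervalIntegral.integral_mono_on hsr (intervalIntegrable_log hκ hs hsr hrR)
    (intervalIntegrable_log hκ' hs hsr hrR) fun _ ht =>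
      div_le_div_of_nonneg_right
        (radInt_mono hκ hκ' h (hs.le.trans ht.1) (ht.2.trans_lt hrR)) (hs.le.trans ht.1)

lemma logInt_const_mul (c : ℝ) (κ : ℂ → ℝ) (s r : ℝ) :
    logInt (fun z => c * κ z) s r = c * logInt κ s r := by
  have h1 : ∀ ρ, angInt (fun z => c * κ z) ρ = c * angInt κ ρ := fun ρ =>
    intervalIntegral.integral_const_mul _ _
  have h2 : ∀ t, radInt (fun z => c * κ z) t = c * radInt κ t := fun t => by
    rw [radInt, radInt, ← intervalIntegral.integral_const_mul]
    simp only [h1]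
    congr 1; ext; ring
  rw [logInt, logInt, ← intervalIntegral.integral_const_mul]
  simp only [h2, mul_div_assoc]

lemma angInt_add (hκ : ContinuousOn κ (Metric.ball 0 R)) (hκ' : ContinuousOn κ' (Metric.ball 0 R))
    {ρ : ℝ} (hρ : 0 ≤ ρ) (hρR : ρ < R) :
    angInt (fun z => κ z + κ' z) ρ = angInt κ ρ + angInt κ' ρ :=
  intervalIntegral.integral_add (intervalIntegrable_ang hκ hρ hρR _ _)
    (intervalIntegrable_ang hκ' hρ hρR _ _)

lemma radInt_add (hκ : ContinuousOn κ (Metric.ball 0 R)) (hκ' : ContinuousOn κ' (Metric.ball 0 R))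
    {t : ℝ} (ht : 0 ≤ t) (htR : t < R) :
    radInt (fun z => κ z + κ' z) t = radInt κ t + radInt κ' t := by
  rw [radInt, radInt, radInt, ← intervalIntegral.integral_add (intervalIntegrable_rad hκ ht htR)
    (intervalIntegrable_rad hκ' ht htR)]
  refine intervalIntegral.integral_congr fun ρ hρ => ?_
  rw [uIcc_of_le ht] at hρ
  simp only [angInt_add hκ hκ' hρ.1 (hρ.2.trans_lt htR), mul_add]

lemma logInt_add (hκ : ContinuousOn κ (Metric.ball 0 R)) (hκ' : ContinuousOn κ' (Metric.ball 0 R))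
    {s r : ℝ} (hs : 0 < s) (hsr : s ≤ r) (hrR : r < R) :
    logInt (fun z => κ z + κ' z) s r = logInt κ s r + logInt κ' s r := by
  rw [logInt, logInt, logInt, ← intervalIntegral.integral_add
    (intervalIntegrable_log hκ hs hsr hrR) (intervalIntegrable_log hκ' hs hsr hrR)]
  refine intervalIntegral.integral_congr fun t ht => ?_
  rw [uIcc_of_le hsr] at ht
  simp only [radInt_add hκ hκ' (hs.le.trans ht.1) (ht.2.trans_lt hrR), add_div]

/-- The Green-Jensen formula in terms of `logInt`. -/
lemma circleAverage_sub_eq_logInt {u : ℂ → ℝ} (hu : ContDiffOn ℝ 2 u (Metric.ball 0 R)) {s r : ℝ}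
    (hs : 0 < s) (hsr : s ≤ r) (hrR : r < R) :
    Real.circleAverage u 0 r - Real.circleAverage u 0 s =
      (2 * Real.pi)⁻¹ * logInt (lap u) s r := by
  rw [circleAverage_sub_circleAverage hu hs hsr hrR]
  simp only [logInt, radInt, angInt, intervalIntegral.integral_const_mul]

variable (hκ0 : ∀ z ∈ Metric.ball (0 : ℂ) R, 0 ≤ κ z)

include hκ0

lemma angInt_nonneg {ρ : ℝ} (hρ : 0 ≤ ρ) (hρR : ρ < R) : 0 ≤ angInt κ ρ :=
  intervalIntegral.integral_nonneg (by positivity) fun θ _ =>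
    hκ0 _ (mul_dir_mem_ball (by rwa [abs_of_nonneg hρ]) θ)

lemma radInt_nonneg {t : ℝ} (ht : 0 ≤ t) (htR : t < R) : 0 ≤ radInt κ t :=
  intervalIntegral.integral_nonneg ht fun _ hρ =>
    mul_nonneg hρ.1 (angInt_nonneg hκ0 hρ.1 (hρ.2.trans_lt htR))

/-- The extended version runs over `(-π, π]`, the range of polar coordinates, and the real one over
`[0, 2π]`; periodicity identifies them. -/
lemma langInt_ofReal (hκ : ContinuousOn κ (Metric.ball 0 R)) {ρ : ℝ} (hρ : 0 ≤ ρ) (hρR : ρ < R) :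
    langInt (fun z => ENNReal.ofReal (κ z)) ρ = ENNReal.ofReal (angInt κ ρ) := by
  have hmem : ∀ θ, ((ρ : ℂ) * dir θ) ∈ Metric.ball (0 : ℂ) R :=
    mul_dir_mem_ball (by rwa [abs_of_nonneg hρ])
  have hper : Function.Periodic (fun θ : ℝ => κ (ρ * dir θ)) (2 * Real.pi) := by
    intro θ
    have : dir (θ + 2 * Real.pi) = dir θ := by
      simp only [dir]
      push_cast
      rw [add_mul, Complex.exp_add, Complex.exp_two_pi_mul_I, mul_one]
    simp only [this]
  have e : angInt κ ρ = ∫ θ in (-Real.pi)..Real.pi, κ (ρ * dir θ) := by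
    have := hper.intervalIntegral_add_eq 0 (-Real.pi)
    rw [zero_add] at this
    rw [angInt, this]
    congr 1; ring
  have hle : -Real.pi ≤ Real.pi := by linarith [Real.pi_pos]
  rw [e, intervalIntegral.integral_of_le hle, langInt, ofReal_integral_eq_lintegral_ofReal]
  · exact (intervalIntegrable_iff_integrableOn_Ioc_of_le hle).1 (intervalIntegrable_ang hκ hρ hρR _ _)
  · exact Eventually.of_forall fun θ => hκ0 _ (hmem θ)

lemma lradInt_ofReal (hκ : ContinuousOn κ (Metric.ball 0 R)) {t : ℝ} (ht : 0 ≤ t) (htR : t < R) :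
    lradInt (fun z => ENNReal.ofReal (κ z)) t = ENNReal.ofReal (radInt κ t) := by
  rw [radInt, intervalIntegral.integral_of_le ht, lradInt, ofReal_integral_eq_lintegral_ofReal]
  · refine setLIntegral_congr_fun measurableSet_Ioc fun ρ hρ => ?_
    rw [langInt_ofReal hκ0 hκ hρ.1.le (hρ.2.trans_lt htR), ENNReal.ofReal_mul hρ.1.le]
  · exact (intervalIntegrable_iff_integrableOn_Ioc_of_le ht).1 (intervalIntegrable_rad hκ ht htR)
  · refine (ae_restrict_iff' measurableSet_Ioc).2 (Eventually.of_forall fun ρ hρ => ?_)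
    exact mul_nonneg hρ.1.le (angInt_nonneg hκ0 hρ.1.le (hρ.2.trans_lt htR))

lemma llogInt_ofReal (hκ : ContinuousOn κ (Metric.ball 0 R)) {s r : ℝ} (hs : 0 < s) (hsr : s ≤ r)
    (hrR : r < R) :
    llogInt (fun z => ENNReal.ofReal (κ z)) s r = ENNReal.ofReal (logInt κ s r) := by
  rw [logInt, intervalIntegral.integral_of_le hsr, llogInt, ofReal_integral_eq_lintegral_ofReal]
  · refine setLIntegral_congr_fun measurableSet_Ioc fun t ht => ?_
    have ht0 : 0 < t := hs.trans ht.1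
    rw [lradInt_ofReal hκ0 hκ ht0.le (ht.2.trans_lt hrR), ← ENNReal.ofReal_mul (inv_nonneg.2 ht0.le),
      inv_mul_eq_div]
  · exact (intervalIntegrable_iff_integrableOn_Ioc_of_le hsr).1 (intervalIntegrable_log hκ hs hsr hrR)
  · refine (ae_restrict_iff' measurableSet_Ioc).2 (Eventually.of_forall fun t ht => ?_)
    have ht0 : 0 < t := hs.trans ht.1
    exact div_nonneg (radInt_nonneg hκ0 ht0.le (ht.2.trans_lt hrR)) ht0.le

end real

section ennreal

variable {κ κ' : ℂ → ℝ≥0∞}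

lemma measurable_langInt (hκ : Measurable κ) : Measurable (langInt κ) :=
  Measurable.lintegral_prod_right' (f := fun p : ℝ × ℝ => κ (p.1 * dir p.2))
    (hκ.comp (Continuous.measurable (by fun_prop)))

lemma lradInt_mono {κ : ℂ → ℝ≥0∞} {s t : ℝ} (h : s ≤ t) : lradInt κ s ≤ lradInt κ t :=
  lintegral_mono_set (Ioc_subset_Ioc_right h)

lemma measurable_lradInt (κ : ℂ → ℝ≥0∞) : Measurable (lradInt κ) :=
  Monotone.measurable fun _ _ h => lradInt_mono h

lemma langInt_mono_on {ρ : ℝ} (h : ∀ z : ℂ, ‖z‖ = |ρ| → κ z ≤ κ' z) : langInt κ ρ ≤ langInt κ' ρ :=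
  lintegral_mono fun θ => h _ (by simp [norm_dir])

lemma lradInt_mono_on {t : ℝ} (h : ∀ z : ℂ, ‖z‖ ≤ t → κ z ≤ κ' z) : lradInt κ t ≤ lradInt κ' t := by
  refine setLIntegral_mono' measurableSet_Ioc fun ρ hρ => ?_
  gcongr
  exact langInt_mono_on fun z hz => h z (by rw [hz, abs_of_pos hρ.1]; exact hρ.2)

lemma llogInt_mono_on {s r : ℝ} (h : ∀ z : ℂ, ‖z‖ ≤ r → κ z ≤ κ' z) :
    llogInt κ s r ≤ llogInt κ' s r := by
  refine setLIntegral_mono' measurableSet_Ioc fun t ht => ?_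
  gcongr
  exact lradInt_mono_on fun z hz => h z (hz.trans ht.2)

lemma const_mul_liminf_le (c : ℝ) (u : ℕ → ℝ≥0∞) :
    ENNReal.ofReal c * liminf u atTop ≤ liminf (fun n => ENNReal.ofReal c * u n) atTop := by
  have := ENNReal.le_liminf_mul (f := atTop) (u := fun _ : ℕ => ENNReal.ofReal c) (v := u)
  rwa [liminf_const] at this

/-- Fatou's lemma for the iterated integrals. -/
lemma llogInt_liminf_le {κ : ℕ → ℂ → ℝ≥0∞} (hκ : ∀ n, Measurable (κ n)) (s r : ℝ) :
    llogInt (fun z => liminf (fun n => κ n z) atTop) s r ≤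
      liminf (fun n => llogInt (κ n) s r) atTop := by
  have h1 : ∀ ρ, langInt (fun z => liminf (fun n => κ n z) atTop) ρ ≤
      liminf (fun n => langInt (κ n) ρ) atTop := fun ρ =>
    lintegral_liminf_le fun n => (hκ n).comp (Continuous.measurable (by fun_prop))
  have h2 : ∀ t, lradInt (fun z => liminf (fun n => κ n z) atTop) t ≤
      liminf (fun n => lradInt (κ n) t) atTop := by
    intro t
    refine le_trans (lintegral_mono fun ρ => ?_) (lintegral_liminf_le fun n =>
      (ENNReal.measurable_ofReal.mul (measurable_langInt (hκ n))))
    exact (mul_le_mul_right (h1 ρ) _).trans (const_mul_liminf_le _ _)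
  refine le_trans (lintegral_mono fun t => ?_) (lintegral_liminf_le fun n =>
    ((ENNReal.measurable_ofReal.comp measurable_inv).mul (measurable_lradInt (κ n))))
  exact (mul_le_mul_right (h2 t) _).trans (const_mul_liminf_le _ _)

/-- The integral over a disc in polar coordinates. -/
lemma setLIntegral_ball_eq (hκ : Measurable κ) (t : ℝ) :
    ∫⁻ z in Metric.ball (0 : ℂ) t, κ z = lradInt κ t := by
  have hball : MeasurableSet (Metric.ball (0 : ℂ) t) := measurableSet_ball
  rw [← lintegral_indicator hball, ← Complex.lintegral_comp_polarCoord_symm, polarCoord_target,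
    Measure.volume_eq_prod, ← Measure.prod_restrict, lintegral_prod]
  · have h1 : ∀ ρ ∈ Ioi (0 : ℝ), ∫⁻ θ in Ioo (-Real.pi) Real.pi, ENNReal.ofReal ρ •
        (Metric.ball (0 : ℂ) t).indicator κ (Complex.polarCoord.symm (ρ, θ)) =
        (Iio t).indicator (fun ρ => ENNReal.ofReal ρ * langInt κ ρ) ρ := by
      intro ρ hρ
      have e : ∀ θ, Complex.polarCoord.symm (ρ, θ) = ρ * dir θ := by
        intro θ
        rw [Complex.polarCoord_symm_apply, dir, Complex.exp_mul_I]
        simp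
      simp only [e, smul_eq_mul]
      by_cases hρt : ρ < t
      · rw [indicator_of_mem (s := Iio t) hρt, langInt, ← restrict_Ioo_eq_restrict_Ioc,
          lintegral_const_mul]
        · congr 1
          refine lintegral_congr fun θ => ?_
          rw [indicator_of_mem (mul_dir_mem_ball (by rwa [abs_of_pos hρ]) θ)]
        · exact (hκ.indicator hball).comp (Continuous.measurable (by fun_prop))
      · rw [indicator_of_notMem (s := Iio t) hρt]
        have : ∀ θ, (Metric.ball (0 : ℂ) t).indicator κ (ρ * dir θ) = 0 := fun θ => by
          refine indicator_of_notMem ?_ _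
          simpa [norm_dir, abs_of_pos (mem_Ioi.1 hρ)] using not_lt.1 hρt
        simp [this]
    rw [setLIntegral_congr_fun measurableSet_Ioi h1, lintegral_indicator measurableSet_Iio,
      Measure.restrict_restrict measurableSet_Iio, lradInt, Iio_inter_Ioi, restrict_Ioo_eq_restrict_Ioc]
  · refine Measurable.aemeasurable ?_
    refine (ENNReal.measurable_ofReal.comp measurable_fst).smul ((hκ.indicator hball).comp ?_)
    have : (Complex.polarCoord.symm : ℝ × ℝ → ℂ) = fun p : ℝ × ℝ => (p.1 : ℂ) * dir p.2 := by
      ext p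
      rw [Complex.polarCoord_symm_apply, dir, Complex.exp_mul_I]
      simp
    rw [this]
    exact Continuous.measurable (by fun_prop)

end ennreal

lemma logInt_congr {κ κ' : ℂ → ℝ} {s r : ℝ} (hs : 0 ≤ s) (hsr : s ≤ r)
    (h : ∀ z : ℂ, ‖z‖ ≤ r → κ z = κ' z) : logInt κ s r = logInt κ' s r := by
  refine intervalIntegral.integral_congr fun t ht => ?_
  rw [uIcc_of_le hsr] at ht
  have : radInt κ t = radInt κ' t := by
    refine intervalIntegral.integral_congr fun ρ hρ => ?_
    rw [uIcc_of_le (hs.trans ht.1)] at hρ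
    have : angInt κ ρ = angInt κ' ρ := by
      refine intervalIntegral.integral_congr fun θ _ => h _ ?_
      simpa [norm_dir, abs_of_nonneg hρ.1] using hρ.2.trans ht.2
    simp only [this]
  simp only [this]

/-! ### The characteristic function and the area in a singular metric. -/

/-- The characteristic function of a map from the disc to the sphere. -/
def modelT (F : ℂ → OnePoint ℂ) (s r : ℝ) : ℝ :=
  logInt (fun z => 1 / Real.pi * sphDensity F z) s r

lemma sphDensity_nonneg (F : ℂ → OnePoint ℂ) (z : ℂ) : 0 ≤ sphDensity F z := sq_nonneg _

namespace IsRep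

variable {F : ℂ → OnePoint ℂ} {g h : ℂ → ℂ} {R s r : ℝ}

/-- The **first main theorem** in the form of Ahlfors and Shimizu. -/
theorem circleAverage_log_wnorm (H : IsRep F g h (Metric.ball 0 R)) (hs : 0 < s) (hsr : s ≤ r)
    (hrR : r < R) :
    Real.circleAverage (fun z => Real.log (wnorm 1 1 g h z)) 0 r -
      Real.circleAverage (fun z => Real.log (wnorm 1 1 g h z)) 0 s = 2 * modelT F s r := by
  rw [circleAverage_sub_eq_logInt (R := R) _ hs hsr hrR]
  · have : logInt (lap fun z => Real.log (wnorm 1 1 g h z)) s r =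
        logInt (fun z => 4 * Real.pi * (1 / Real.pi * sphDensity F z)) s r := by
      refine logInt_congr hs.le hsr fun z hz => ?_
      have hzR : z ∈ Metric.ball (0 : ℂ) R := by simpa using hz.trans_lt hrR
      rw [lap_log_wnorm (H.left z hzR) (H.right z hzR) (wnorm_pos (H.ne z hzR)), H.sphDensity_eq hzR,
        wronskian]
      have := Real.pi_pos
      field_simp
    rw [this, logInt_const_mul, modelT]
    have := Real.pi_pos
    field_simp
    ring
  · exact fun z hz => (contDiffAt_log_wnorm (H.left z hz) (H.right z hz)
      (wnorm_pos (H.ne z hz))).contDiffWithinAt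

/-- The area of the image with respect to a regularized singular metric. -/
lemma logInt_regular_le (H : IsRep F g h (Metric.ball 0 R)) (hs : 0 < s) (hsr : s ≤ r)
    (hrR : r < R) (a : OnePoint ℂ) {δ ε : ℝ} (hδ : 0 < δ) (hδ1 : δ ≤ 1) (hε : 0 < ε) (hε1 : ε ≤ 1) :
    logInt (fun z => sphDensity F z * (chordSq (F z) a + δ) ^ (ε - 1)) s r ≤
      4 * Real.pi / ε ^ 2 * (1 + modelT F s r) := by
  set k := comb (sphereVec a) g h with hk
  set l := coComb (sphereVec a) g h with hl
  have hka : ∀ z ∈ Metric.ball (0 : ℂ) R, AnalyticAt ℂ k z := fun z hz =>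
    analyticAt_comb (H.left z hz) (H.right z hz)
  have hla : ∀ z ∈ Metric.ball (0 : ℂ) R, AnalyticAt ℂ l z := fun z hz =>
    analyticAt_coComb (H.left z hz) (H.right z hz)
  have hP : ∀ z, wnorm 1 1 k l z = wnorm 1 1 g h z := fun z => wnorm_comb (norm_sphereVec a)
  have hPpos : ∀ z ∈ Metric.ball (0 : ℂ) R, 0 < wnorm 1 1 k l z := fun z hz => by
    rw [hP]; exact wnorm_pos (H.ne z hz)
  have hd : ∀ z ∈ Metric.ball (0 : ℂ) R, sphDensity F z =
      ‖k z * deriv l z - deriv k z * l z‖ ^ 2 / wnorm 1 1 k l z ^ 2 := fun z hz => by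
    rw [H.sphDensity_eq hz, hP, comb_wronskian (norm_sphereVec a) (H.left z hz) (H.right z hz)]
  have hσ : ∀ z ∈ Metric.ball (0 : ℂ) R, chordSq (F z) a = ‖k z‖ ^ 2 / wnorm 1 1 k l z := fun z hz => by
    rw [H.chordSq_eq hz, hP]
  have hu : ContDiffOn ℝ 2 (regPow δ ε k l) (Metric.ball 0 R) := fun z hz =>
    (contDiffAt_regPow (hka z hz) (hla z hz) (hPpos z hz) hδ).contDiffWithinAt
  have hr : 0 < r := hs.trans_le hsr
  have hbound : ∀ z ∈ Metric.ball (0 : ℂ) R, 0 ≤ regPow δ ε k l z ∧ regPow δ ε k l z ≤ 2 := by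
    intro z hz
    refine ⟨(Real.exp_pos _).le, ?_⟩
    rw [regPow_eq (hPpos z hz) hδ, ← hσ z hz]
    have h1 := chordSq_le_one (F z) a
    have h0 := chordSq_nonneg (F z) a
    calc (chordSq (F z) a + δ) ^ ε ≤ 2 ^ ε := Real.rpow_le_rpow (by positivity) (by linarith) hε.le
      _ ≤ 2 ^ (1 : ℝ) := Real.rpow_le_rpow_of_exponent_le one_le_two hε1
      _ = 2 := Real.rpow_one 2
  have hci : ∀ t, 0 < t → t < R → CircleIntegrable (regPow δ ε k l) 0 t := by
    intro t ht htR
    refine ContinuousOn.circleIntegrable ht.le (hu.continuousOn.mono ?_)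
    exact fun z hz => by simpa using (by simpa using hz : ‖z‖ = t).trans_lt htR
  have hav : Real.circleAverage (regPow δ ε k l) 0 r ≤ 2 := by
    refine Real.circleAverage_mono_on_of_le_circle (hci r hr hrR) fun z hz => ?_
    rw [abs_of_pos hr] at hz
    exact (hbound z (by simpa using (by simpa using hz : ‖z‖ = r).trans_lt hrR)).2
  have hav0 : 0 ≤ Real.circleAverage (regPow δ ε k l) 0 s := by
    refine Real.circleAverage_nonneg_of_nonneg fun z hz => ?_
    exact (Real.exp_pos _).le
  have hgreen := circleAverage_sub_eq_logInt hu hs hsr hrR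
  -- The function lies between 0 and 2 on both circles, so Green's formula leaves at most `2 · 2π`,
  -- uniformly in `δ`.
  have hlap : logInt (lap (regPow δ ε k l)) s r ≤ 4 * Real.pi := by
    have : (2 * Real.pi)⁻¹ * logInt (lap (regPow δ ε k l)) s r ≤ 2 := by linarith
    have hpi := Real.pi_pos
    rw [inv_mul_le_iff₀ (by positivity)] at this
    linarith
  have hdc := H.continuousOn_sphDensity
  have hκc : ContinuousOn (fun z => sphDensity F z * (chordSq (F z) a + δ) ^ (ε - 1))
      (Metric.ball 0 R) := by
    refine hdc.mul (ContinuousOn.rpow_const ((H.continuousOn_chordSq a).add continuousOn_const) ?_)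
    intro z _
    left
    have := chordSq_nonneg (F z) a
    positivity
  have hpi := Real.pi_pos
  have hdc2 : ContinuousOn (fun z => 16 * ε * Real.pi * (1 / Real.pi * sphDensity F z))
      (Metric.ball 0 R) := by fun_prop
  have hmain : logInt (fun z => 4 * ε ^ 2 * (sphDensity F z * (chordSq (F z) a + δ) ^ (ε - 1))) s r ≤
      logInt (fun z => lap (regPow δ ε k l) z + 16 * ε * Real.pi * (1 / Real.pi * sphDensity F z)) s r := by
    refine logInt_mono (R := R) (continuousOn_const.mul hκc)
      ((continuousOn_lap hu).add hdc2) ?_ hs hsr hrR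
    intro z hz
    have := le_lap_regPow (hka z hz) (hla z hz) (hPpos z hz) hδ hδ1 hε hε1
    rw [← hd z hz, ← hσ z hz] at this
    have e : 16 * ε * Real.pi * (1 / Real.pi * sphDensity F z) = 16 * ε * sphDensity F z := by
      field_simp
    show _ ≤ lap (regPow δ ε k l) z + 16 * ε * Real.pi * (1 / Real.pi * sphDensity F z)
    rwa [e]
  rw [logInt_const_mul, logInt_add (R := R) (continuousOn_lap hu) hdc2 hs hsr hrR, logInt_const_mul, ← modelT] at hmain
  have hT : 0 ≤ modelT F s r := by
    rw [modelT, logInt]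
    refine intervalIntegral.integral_nonneg hsr fun t ht => ?_
    refine div_nonneg ?_ (hs.le.trans ht.1)
    exact radInt_nonneg (R := R) (fun z _ => mul_nonneg (by positivity) (sphDensity_nonneg F z))
      (hs.le.trans ht.1) (ht.2.trans_lt hrR)
  -- `4 ε²` times the left side is at most `4π + 16 ε π T`, hence at most `16π (1 + T)`.
  rw [div_mul_eq_mul_div, le_div_iff₀ (by positivity)]
  have : 16 * ε * Real.pi * modelT F s r ≤ 16 * 1 * Real.pi * modelT F s r := by gcongr
  nlinarith

/-- The area of the image with respect to the singular metric is controlled by the characteristic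
function. -/
theorem llogInt_singular_le (H : IsRep F g h (Metric.ball 0 R)) (hs : 0 < s) (hsr : s ≤ r)
    (hrR : r < R) (a : OnePoint ℂ) {ε : ℝ} (hε : 0 < ε) (hε1 : ε < 1) :
    llogInt (fun z => ENNReal.ofReal (sphDensity F z * chordSq (F z) a ^ (ε - 1))) s r ≤
      ENNReal.ofReal (4 * Real.pi / ε ^ 2 * (1 + modelT F s r)) := by
  classical
  -- Regularize with `δ = 1 / (n + 1)`. The bound does not depend on `n`, so Fatou's lemma passes to
  -- the singular density.
  let κ : ℕ → ℂ → ℝ := fun n z => sphDensity F z * (chordSq (F z) a + 1 / (n + 1)) ^ (ε - 1)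
  have hκc : ∀ n, ContinuousOn (κ n) (Metric.ball 0 R) := by
    intro n
    refine H.continuousOn_sphDensity.mul
      (ContinuousOn.rpow_const ((H.continuousOn_chordSq a).add continuousOn_const) ?_)
    intro z _
    left
    have := chordSq_nonneg (F z) a
    positivity
  let κ' : ℕ → ℂ → ℝ≥0∞ := fun n =>
    (Metric.ball (0 : ℂ) R).piecewise (fun z => ENNReal.ofReal (κ n z)) 0
  have hκ'm : ∀ n, Measurable (κ' n) := fun n =>
    ContinuousOn.measurable_piecewise (ENNReal.continuous_ofReal.comp_continuousOn (hκc n))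
      continuousOn_const measurableSet_ball
  have hκ' : ∀ n, ∀ z : ℂ, ‖z‖ ≤ r → κ' n z = ENNReal.ofReal (κ n z) := fun n z hz =>
    piecewise_eq_of_mem _ _ _ (by simpa using hz.trans_lt hrR)
  have hκ0 : ∀ n z, 0 ≤ κ n z := fun n z => by
    have := chordSq_nonneg (F z) a
    exact mul_nonneg (sphDensity_nonneg F z) (Real.rpow_nonneg (by positivity) _)
  have hle : ∀ n, llogInt (κ' n) s r ≤ ENNReal.ofReal (4 * Real.pi / ε ^ 2 * (1 + modelT F s r)) := by
    intro n
    refine (llogInt_mono_on (κ' := fun z => ENNReal.ofReal (κ n z)) fun z hz => (hκ' n z hz).le).trans ?_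
    rw [llogInt_ofReal (R := R) (fun z _ => hκ0 n z) (hκc n) hs hsr hrR]
    refine ENNReal.ofReal_le_ofReal (H.logInt_regular_le hs hsr hrR a (by positivity) ?_ hε hε1.le)
    rw [div_le_one (by positivity)]
    have : (0 : ℝ) ≤ n := Nat.cast_nonneg n
    linarith
  refine le_trans (llogInt_mono_on (κ' := fun z => liminf (fun n => κ' n z) atTop) fun z hz => ?_)
    ((llogInt_liminf_le hκ'm s r).trans ?_)
  · simp only [hκ' _ z hz]
    -- On the fibre of `a` the singular density is 0 by the convention for `0 ^ (ε - 1)`, so nothing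
    -- is asked there.
    rcases (chordSq_nonneg (F z) a).eq_or_lt with h0 | h0
    · rw [← h0, Real.zero_rpow (by linarith)]
      simp
    · refine (Tendsto.liminf_eq (ENNReal.tendsto_ofReal ?_)).ge
      refine Tendsto.const_mul _ ?_
      have h1 : Tendsto (fun n : ℕ => chordSq (F z) a + 1 / ((n : ℝ) + 1)) atTop
          (𝓝 (chordSq (F z) a)) := by
        simpa using tendsto_one_div_add_atTop_nhds_zero_nat.const_add (chordSq (F z) a)
      exact h1.rpow_const (Or.inl h0.ne')
  · have := liminf_le_liminf (f := atTop) (Eventually.of_forall hle)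
    rwa [liminf_const] at this

end IsRep

/-! ### Borel's growth lemma. -/

/-- If `A` has a maximum, one interval contains it. Otherwise `A` is covered by the intervals ending
at a countable dense subset of `A`, a directed family, and the integral over the union is the
supremum. -/
lemma setLIntegral_le_of_forall_Ioc {φ : ℝ → ℝ≥0∞} {s : ℝ} {A : Set ℝ} (hA : A ⊆ Ioi s)
    {y : ℝ≥0∞} (h : ∀ r ∈ A, ∫⁻ x in Ioc s r, φ x ≤ y) : ∫⁻ x in A, φ x ≤ y := by
  by_cases hmax : ∃ r ∈ A, ∀ x ∈ A, x ≤ r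
  · obtain ⟨r, hr, hmax⟩ := hmax
    exact (lintegral_mono_set (show A ⊆ Ioc s r from fun x hx => ⟨hA hx, hmax x hx⟩)).trans (h r hr)
  · push Not at hmax
    obtain ⟨D, hDA, hDc, hD⟩ :=
      (TopologicalSpace.IsSeparable.of_separableSpace A).exists_countable_dense_subset
    have hsub : A ⊆ ⋃ d ∈ D, Ioc s d := by
      intro x hx
      obtain ⟨x', hx', hlt⟩ := hmax x hx
      obtain ⟨d, hd, hdD⟩ := mem_closure_iff.1 (hD hx') (Ioi x) isOpen_Ioi hlt
      exact mem_biUnion hdD ⟨hA hx, le_of_lt hd⟩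
    refine (lintegral_mono_set hsub).trans ?_
    rw [← withDensity_apply _ (MeasurableSet.biUnion hDc fun d _ => measurableSet_Ioc),
      measure_biUnion_eq_iSup hDc]
    · refine iSup₂_le fun d hd => ?_
      rw [withDensity_apply _ measurableSet_Ioc]
      exact h d (hDA hd)
    · intro a ha b hb
      rcases le_total a b with hab | hab
      · exact ⟨b, hb, Ioc_subset_Ioc_right hab, le_rfl⟩
      · exact ⟨a, ha, le_rfl, Ioc_subset_Ioc_right hab⟩

/-- Writing the negative power as an integral over a half-line lets Tonelli's theorem replace
differentiation of the primitive of `φ` in Borel's lemma. -/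
lemma lintegral_Ioi_rpow {x δ : ℝ} (hx : 0 < x) (hδ : 0 < δ) :
    ∫⁻ y in Ioi x, ENNReal.ofReal ((1 + δ) * y ^ (-(2 + δ))) = ENNReal.ofReal (x ^ (-(1 + δ))) := by
  rw [← ofReal_integral_eq_lintegral_ofReal, integral_const_mul, integral_Ioi_rpow_of_lt (by linarith) hx]
  · congr 1
    have : -(2 + δ) + 1 = -(1 + δ) := by ring
    rw [this]
    field_simp
  · exact (integrableOn_Ioi_rpow_of_lt (by linarith) hx).const_mul _
  · refine (ae_restrict_iff' measurableSet_Ioi).2 (Eventually.of_forall fun y hy => ?_)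
    have : 0 < y := hx.trans hy
    positivity

/-- The measure-theoretic form of **Borel's growth lemma**. -/
theorem setLIntegral_mul_rpow_le {φ : ℝ → ℝ≥0∞} (hφ : Measurable φ) {s : ℝ} {J : Set ℝ}
    (hJ : J ⊆ Ioi s) (hJm : MeasurableSet J) {δ : ℝ} (hδ : 0 < δ)
    (hfin : ∀ r ∈ J, ∫⁻ x in Ioc s r, φ x ≠ ⊤) :
    ∫⁻ r in J, φ r * (1 + ∫⁻ x in Ioc s r, φ x) ^ (-(1 + δ)) ≤ ENNReal.ofReal ((1 + δ) / δ) := by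
  set H : ℝ → ℝ≥0∞ := fun r => 1 + ∫⁻ x in Ioc s r, φ x with hH
  have hHmono : Monotone H := fun a b hab =>
    add_le_add le_rfl (lintegral_mono_set (Ioc_subset_Ioc_right hab))
  have hHm : Measurable H := hHmono.measurable
  let w : ℝ → ℝ≥0∞ := fun y => ENNReal.ofReal ((1 + δ) * y ^ (-(2 + δ)))
  have hw : Measurable w := by fun_prop
  let G : ℝ → ℝ → ℝ≥0∞ := fun r y => φ r * {p : ℝ × ℝ | H p.1 < ENNReal.ofReal p.2}.indicator
    (fun p => w p.2) (r, y)
  have hset : MeasurableSet {p : ℝ × ℝ | H p.1 < ENNReal.ofReal p.2} :=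
    measurableSet_lt (hHm.comp measurable_fst) (ENNReal.measurable_ofReal.comp measurable_snd)
  have hGm : Measurable (Function.uncurry G) :=
    (hφ.comp measurable_fst).mul ((hw.comp measurable_snd).indicator hset)
  have hindm : ∀ r, Measurable fun y => {p : ℝ × ℝ | H p.1 < ENNReal.ofReal p.2}.indicator
      (fun p => w p.2) (r, y) := fun r =>
    ((hw.comp measurable_snd).indicator hset).comp measurable_prodMk_left
  have h1 : ∀ r ∈ J, φ r * (H r) ^ (-(1 + δ)) = ∫⁻ y, G r y := by
    intro r hr
    have hHr : H r ≠ ⊤ := ENNReal.add_ne_top.2 ⟨ENNReal.one_ne_top, hfin r hr⟩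
    have hx1 : 1 ≤ (H r).toReal := by
      rw [← ENNReal.toReal_one]
      exact ENNReal.toReal_mono hHr le_self_add
    rw [lintegral_const_mul _ (hindm r)]
    congr 1
    have e : ∀ y, {p : ℝ × ℝ | H p.1 < ENNReal.ofReal p.2}.indicator (fun p => w p.2) (r, y) =
        (Ioi (H r).toReal).indicator w y := by
      intro y
      simp only [indicator, mem_ofPred_eq, mem_Ioi, ENNReal.lt_ofReal_iff_toReal_lt hHr]
    simp only [e]
    rw [lintegral_indicator measurableSet_Ioi, lintegral_Ioi_rpow (by linarith) hδ,
      ← ENNReal.ofReal_rpow_of_pos (by linarith), ENNReal.ofReal_toReal hHr]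
  -- After Tonelli, the set `H < y` has `φ`-mass at most `y` because `H` bounds that mass, and it is
  -- empty for `y ≤ 1` because `H ≥ 1`. There remains the integral of `(1 + δ) y ^ (-(1 + δ))` over
  -- `y > 1`, equal to `(1 + δ) / δ`.
  rw [setLIntegral_congr_fun hJm h1, lintegral_lintegral_swap hGm.aemeasurable]
  have h2 : ∀ y, ∫⁻ r in J, G r y ≤ (Ioi (1 : ℝ)).indicator
      (fun y => ENNReal.ofReal ((1 + δ) * y ^ (-(1 + δ)))) y := by
    intro y
    have hA : MeasurableSet {r | H r < ENNReal.ofReal y} := measurableSet_lt hHm measurable_const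
    have e : ∀ r, G r y = {r | H r < ENNReal.ofReal y}.indicator (fun r => φ r * w y) r := by
      intro r
      simp only [G, indicator, mem_ofPred_eq]
      split_ifs <;> simp
    simp only [e]
    rw [lintegral_indicator hA, Measure.restrict_restrict hA, lintegral_mul_const _ hφ]
    by_cases hy : 1 < y
    · rw [indicator_of_mem (s := Ioi (1 : ℝ)) hy]
      have h3 : ∫⁻ r in {r | H r < ENNReal.ofReal y} ∩ J, φ r ≤ ENNReal.ofReal y := by
        refine setLIntegral_le_of_forall_Ioc (fun r hr => hJ hr.2) fun r hr => ?_
        exact le_trans le_add_self (le_of_lt hr.1)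
      refine (mul_le_mul_left h3 _).trans (le_of_eq ?_)
      have hy0 : 0 < y := by linarith
      rw [← ENNReal.ofReal_mul hy0.le]
      congr 1
      have : y ^ (-(1 + δ)) = y * y ^ (-(2 + δ)) := by
        rw [← Real.rpow_one_add' hy0.le (by linarith)]
        congr 1; ring
      rw [this]; ring
    · rw [indicator_of_notMem (s := Ioi (1 : ℝ)) hy]
      have : {r | H r < ENNReal.ofReal y} ∩ J = ∅ := by
        refine eq_empty_of_forall_notMem fun r hr => ?_
        have h4 : H r < ENNReal.ofReal y := hr.1
        have h5 : ENNReal.ofReal y ≤ 1 := by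
          rw [← ENNReal.ofReal_one]; exact ENNReal.ofReal_le_ofReal (not_lt.1 hy)
        exact absurd (h4.trans_le h5) (not_lt.2 le_self_add)
      rw [this]; simp
  refine (lintegral_mono h2).trans ?_
  rw [lintegral_indicator measurableSet_Ioi, ← ofReal_integral_eq_lintegral_ofReal, integral_const_mul,
    integral_Ioi_rpow_of_lt (by linarith) one_pos]
  · refine ENNReal.ofReal_le_ofReal (le_of_eq ?_)
    rw [Real.one_rpow]
    have : -(1 + δ) + 1 = -δ := by ring
    rw [this]
    field_simp
  · exact (integrableOn_Ioi_rpow_of_lt (by linarith) one_pos).const_mul _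
  · refine (ae_restrict_iff' measurableSet_Ioi).2 (Eventually.of_forall fun y hy => ?_)
    have : (0 : ℝ) < y := one_pos.trans hy
    positivity

/-- **Borel's growth lemma** for two functions and a divergent weight. -/
theorem exists_le_mul_rpow {φ ψ : ℝ → ℝ≥0∞} (hφ : Measurable φ) (hψ : Measurable ψ) {s : ℝ}
    {J : Set ℝ} (hJ : J ⊆ Ioi s) (hJm : MeasurableSet J) {δ : ℝ} (hδ : 0 < δ)
    (hφfin : ∀ r ∈ J, ∫⁻ x in Ioc s r, φ x ≠ ⊤) (hψfin : ∀ r ∈ J, ∫⁻ x in Ioc s r, ψ x ≠ ⊤)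
    {γ : ℝ → ℝ≥0∞} (hγ : ∫⁻ r in J, γ r = ⊤) :
    ∃ r ∈ J, φ r ≤ γ r * (1 + ∫⁻ x in Ioc s r, φ x) ^ (1 + δ) ∧
      ψ r ≤ γ r * (1 + ∫⁻ x in Ioc s r, ψ x) ^ (1 + δ) := by
  by_contra! hcon
  have hmeas : ∀ χ : ℝ → ℝ≥0∞, Measurable χ →
      Measurable fun r => χ r * (1 + ∫⁻ x in Ioc s r, χ x) ^ (-(1 + δ)) := by
    intro χ hχ
    have : Monotone fun r => 1 + ∫⁻ x in Ioc s r, χ x := fun a b hab =>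
      add_le_add le_rfl (lintegral_mono_set (Ioc_subset_Ioc_right hab))
    exact hχ.mul (this.measurable.pow_const _)
  have key : ∀ (χ : ℝ → ℝ≥0∞), (∀ r ∈ J, ∫⁻ x in Ioc s r, χ x ≠ ⊤) → ∀ r ∈ J,
      γ r * (1 + ∫⁻ x in Ioc s r, χ x) ^ (1 + δ) ≤ χ r →
      γ r ≤ χ r * (1 + ∫⁻ x in Ioc s r, χ x) ^ (-(1 + δ)) := by
    intro χ hfin r hr hle
    set H := 1 + ∫⁻ x in Ioc s r, χ x with hH
    have hH0 : H ≠ 0 := by rw [hH]; simp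
    have hHt : H ≠ ⊤ := ENNReal.add_ne_top.2 ⟨ENNReal.one_ne_top, hfin r hr⟩
    rw [ENNReal.rpow_neg, ← div_eq_mul_inv, ENNReal.le_div_iff_mul_le]
    · exact hle
    · left; exact (ENNReal.rpow_pos (pos_iff_ne_zero.2 hH0) hHt).ne'
    · left; exact ENNReal.rpow_ne_top_of_nonneg (by linarith) hHt
  -- Without a good radius, one of the two inequalities fails at each `r` in `J`, so `γ` is bounded
  -- there by a sum of two functions of finite integral.
  have h1 : ∫⁻ r in J, γ r ≤ ∫⁻ r in J, (φ r * (1 + ∫⁻ x in Ioc s r, φ x) ^ (-(1 + δ)) +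
      ψ r * (1 + ∫⁻ x in Ioc s r, ψ x) ^ (-(1 + δ))) := by
    refine setLIntegral_mono' hJm fun r hr => ?_
    by_cases h : φ r ≤ γ r * (1 + ∫⁻ x in Ioc s r, φ x) ^ (1 + δ)
    · exact (key ψ hψfin r hr (hcon r hr h).le).trans le_add_self
    · exact (key φ hφfin r hr (not_le.1 h).le).trans le_self_add
  rw [lintegral_add_left (hmeas φ hφ), hγ, top_le_iff] at h1
  refine absurd h1 (ENNReal.add_ne_top.2 ⟨?_, ?_⟩)
  · exact ne_top_of_le_ne_top ENNReal.ofReal_ne_top (setLIntegral_mul_rpow_le hφ hJ hJm hδ hφfin)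
  · exact ne_top_of_le_ne_top ENNReal.ofReal_ne_top (setLIntegral_mul_rpow_le hψ hJ hJm hδ hψfin)

/-! ### The singular density and the core of the second main theorem. -/

/-- The density of the pull-back of a metric with singularities at the points `a j`. -/
def singDensity (F : ℂ → OnePoint ℂ) {q : ℕ} (a : Fin q → OnePoint ℂ) (ε : ℝ) (z : ℂ) : ℝ :=
  sphDensity F z * ∏ j, chordSq (F z) (a j) ^ (ε - 1)

lemma singDensity_nonneg (F : ℂ → OnePoint ℂ) {q : ℕ} (a : Fin q → OnePoint ℂ) (ε : ℝ) (z : ℂ) :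
    0 ≤ singDensity F a ε z :=
  mul_nonneg (sphDensity_nonneg F z)
    (Finset.prod_nonneg fun _ _ => Real.rpow_nonneg (chordSq_nonneg _ _) _)

namespace IsRep

variable {F : ℂ → OnePoint ℂ} {g h : ℂ → ℂ} {R s r : ℝ} {q : ℕ} {a : Fin q → OnePoint ℂ} {ε : ℝ}

/-- Substitute `σ_j = |k_j|² / P` and the density `|W|² / P²`, where `k_j` is the linear form of
`a_j` and `P = |g|² + |h|²`. The coefficient of `log P` combines `1 - ε` from each `σ_j` with `-2`
from the density, and it becomes the coefficient of `T`. -/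
lemma log_singDensity {U : Set ℂ} (H : IsRep F g h U) {z : ℂ} (hz : z ∈ U) (hW : wronskian g h z ≠ 0)
    (hk : ∀ j, comb (sphereVec (a j)) g h z ≠ 0) :
    Real.log (singDensity F a ε z) = 2 * Real.log ‖wronskian g h z‖ -
      2 * (1 - ε) * ∑ j, Real.log ‖comb (sphereVec (a j)) g h z‖ +
      (q * (1 - ε) - 2) * Real.log (wnorm 1 1 g h z) := by
  have hP := wnorm_pos (H.ne z hz)
  have hWn := norm_pos_iff.2 hW
  have hkn : ∀ j, 0 < ‖comb (sphereVec (a j)) g h z‖ := fun j => norm_pos_iff.2 (hk j)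
  have hσ : ∀ j, 0 < chordSq (F z) (a j) := fun j => by
    rw [H.chordSq_eq hz]; exact div_pos (pow_pos (hkn j) 2) hP
  have h1 : ∀ j, Real.log (chordSq (F z) (a j) ^ (ε - 1)) =
      (ε - 1) * (2 * Real.log ‖comb (sphereVec (a j)) g h z‖ - Real.log (wnorm 1 1 g h z)) := by
    intro j
    rw [Real.log_rpow (hσ j), H.chordSq_eq hz, Real.log_div (pow_pos (hkn j) 2).ne' hP.ne', Real.log_pow]
    norm_num
  rw [singDensity, Real.log_mul, Real.log_prod]
  · simp only [h1]
    rw [H.sphDensity_eq hz, Real.log_div (by positivity) (by positivity), Real.log_pow, Real.log_pow,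
      ← Finset.mul_sum, Finset.sum_sub_distrib, Finset.sum_const, ← Finset.mul_sum]
    simp only [Finset.card_univ, Fintype.card_fin, nsmul_eq_mul]
    push_cast
    ring
  · exact fun j _ => (Real.rpow_pos_of_pos (hσ j) _).ne'
  · rw [H.sphDensity_eq hz]; positivity
  · exact (Finset.prod_pos fun j _ => Real.rpow_pos_of_pos (hσ j) _).ne'

section averages

variable (H : IsRep F g h (Metric.ball 0 R)) (hr : 0 < r) (hrR : r < R)
  (hF : ∀ z ∈ Metric.ball (0 : ℂ) R, HoloAt F z)
  (hnc : ∀ z ∈ Metric.ball (0 : ℂ) R, ∀ c, ¬ ∀ᶠ w in 𝓝 z, F w = c)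

include H hr hrR hF hnc

omit hr in
/-- Outside a finite set, the singular density does not vanish. -/
lemma finite_bad : {z ∈ Metric.closedBall (0 : ℂ) r | wronskian g h z = 0 ∨
    ∃ j, comb (sphereVec (a j)) g h z = 0}.Finite := by
  have hsub : Metric.closedBall (0 : ℂ) r ⊆ Metric.ball 0 R := Metric.closedBall_subset_ball hrR
  have h1 := finite_zeros (k := wronskian g h) (r := r)
    (fun z hz => analyticAt_wronskian (H.left z (hsub hz)) (H.right z (hsub hz)))
    (fun z hz => H.not_eventually_wronskian (hsub hz) (hF z (hsub hz)) (hnc z (hsub hz)))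
  have h2 : ∀ j, {u ∈ Metric.closedBall (0 : ℂ) r | comb (sphereVec (a j)) g h u = 0}.Finite :=
    fun j => finite_zeros
      (fun z hz => analyticAt_comb (H.left z (hsub hz)) (H.right z (hsub hz)))
      (fun z hz => H.not_eventually_comb (hsub hz) (a j) (hnc z (hsub hz)))
  refine (h1.union (finite_iUnion h2)).subset ?_
  rintro z ⟨hz, h | ⟨j, h⟩⟩
  · exact Or.inl ⟨hz, h⟩
  · exact Or.inr (mem_iUnion.2 ⟨j, hz, h⟩)

lemma log_singDensity_congr : (fun z => Real.log (singDensity F a ε z)) =ᶠ[codiscreteWithin (Metric.sphere (0 : ℂ) |r|)]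
    fun z => 2 * Real.log ‖wronskian g h z‖ -
      2 * (1 - ε) * ∑ j, Real.log ‖comb (sphereVec (a j)) g h z‖ +
      (q * (1 - ε) - 2) * Real.log (wnorm 1 1 g h z) := by
  have hfin := H.finite_bad (a := a) hrR hF hnc
  have h1 := compl_finite_mem_codiscreteWithin hfin (s := Metric.sphere (0 : ℂ) |r|)
  filter_upwards [h1, self_mem_codiscreteWithin _] with z hz hzs
  rw [abs_of_pos hr] at hzs
  have hzc : z ∈ Metric.closedBall (0 : ℂ) r := Metric.sphere_subset_closedBall hzs
  have hzn : ¬ (wronskian g h z = 0 ∨ ∃ j, comb (sphereVec (a j)) g h z = 0) := fun hh => hz ⟨hzc, hh⟩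
  push Not at hzn
  exact H.log_singDensity (Metric.closedBall_subset_ball hrR hzc) hzn.1 hzn.2

omit hF hnc in
lemma circleIntegrable_logs : CircleIntegrable (fun z => Real.log ‖wronskian g h z‖) 0 r ∧
    (∀ j, CircleIntegrable (fun z => Real.log ‖comb (sphereVec (a j)) g h z‖) 0 r) ∧
    CircleIntegrable (fun z => Real.log (wnorm 1 1 g h z)) 0 r := by
  have hsub : Metric.sphere (0 : ℂ) r ⊆ Metric.ball 0 R :=
    Metric.sphere_subset_closedBall.trans (Metric.closedBall_subset_ball hrR)
  refine ⟨?_, fun j => ?_, ?_⟩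
  · refine MeromorphicOn.circleIntegrable_log_norm fun z hz => ?_
    rw [abs_of_pos hr] at hz
    exact (analyticAt_wronskian (H.left z (hsub hz)) (H.right z (hsub hz))).meromorphicAt
  · refine MeromorphicOn.circleIntegrable_log_norm fun z hz => ?_
    rw [abs_of_pos hr] at hz
    exact (analyticAt_comb (H.left z (hsub hz)) (H.right z (hsub hz))).meromorphicAt
  · refine ContinuousOn.circleIntegrable hr.le fun z hz => ?_
    exact (contDiffAt_log_wnorm (H.left z (hsub hz)) (H.right z (hsub hz))
      (wnorm_pos (H.ne z (hsub hz)))).continuousAt.continuousWithinAt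

lemma circleIntegrable_log_singDensity :
    CircleIntegrable (fun z => Real.log (singDensity F a ε z)) 0 r := by
  obtain ⟨h1, h2, h3⟩ := H.circleIntegrable_logs (a := a) hr hrR
  rw [circleIntegrable_congr_codiscreteWithin (H.log_singDensity_congr hr hrR hF hnc)]
  refine CircleIntegrable.add (CircleIntegrable.sub (h1.const_fun_smul (a := (2 : ℝ))) ?_) (h3.const_fun_smul (a := (q * (1 - ε) - 2 : ℝ)))
  refine CircleIntegrable.const_fun_smul (a := (2 * (1 - ε) : ℝ)) ?_
  exact CircleIntegrable.fun_sum _ fun j _ => h2 j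

lemma circleAverage_log_singDensity :
    Real.circleAverage (fun z => Real.log (singDensity F a ε z)) 0 r =
      2 * Real.circleAverage (fun z => Real.log ‖wronskian g h z‖) 0 r -
      2 * (1 - ε) * ∑ j, Real.circleAverage (fun z => Real.log ‖comb (sphereVec (a j)) g h z‖) 0 r +
      (q * (1 - ε) - 2) * Real.circleAverage (fun z => Real.log (wnorm 1 1 g h z)) 0 r := by
  obtain ⟨h1, h2, h3⟩ := H.circleIntegrable_logs (a := a) hr hrR
  rw [Real.circleAverage_congr_codiscreteWithin (H.log_singDensity_congr hr hrR hF hnc) hr.ne']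
  have i1 := h1.const_fun_smul (a := (2 : ℝ))
  have i2' := CircleIntegrable.fun_sum Finset.univ fun j _ => h2 j
  have i2 := i2'.const_fun_smul (a := (2 * (1 - ε) : ℝ))
  have i3 := h3.const_fun_smul (a := (q * (1 - ε) - 2 : ℝ))
  have e1 := Real.circleAverage_fun_add (i1.sub i2) i3
  have e2 := Real.circleAverage_fun_sub i1 i2
  have e3 := Real.circleAverage_fun_smul (f := fun z => Real.log ‖wronskian g h z‖) (c := 0) (R := r) (a := (2 : ℝ))
  have e4 := Real.circleAverage_fun_smul (f := fun z => ∑ j, Real.log ‖comb (sphereVec (a j)) g h z‖) (c := 0) (R := r) (a := (2 * (1 - ε) : ℝ))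
  have e5 := Real.circleAverage_fun_smul (f := fun z => Real.log (wnorm 1 1 g h z)) (c := 0) (R := r) (a := (q * (1 - ε) - 2 : ℝ))
  have e6 := Real.circleAverage_fun_sum (s := Finset.univ) fun j _ => h2 j
  simp only [smul_eq_mul, Pi.sub_apply] at e1 e2 e3 e4 e5
  rw [e1]
  have e2' : Real.circleAverage ((fun z => 2 * Real.log ‖wronskian g h z‖) - fun z =>
      2 * (1 - ε) * ∑ j, Real.log ‖comb (sphereVec (a j)) g h z‖) 0 r = _ := e2
  rw [e2', e3, e4, e5, e6]

end averages

/-- The **second main theorem** before the estimate of the error term. -/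
theorem smt_core (H : IsRep F g h (Metric.ball 0 R)) (hs : 0 < s) (hsr : s ≤ r) (hrR : r < R)
    (hF : ∀ z ∈ Metric.ball (0 : ℂ) R, HoloAt F z)
    (hnc : ∀ z ∈ Metric.ball (0 : ℂ) R, ∀ c, ¬ ∀ᶠ w in 𝓝 z, F w = c)
    (ha : Function.Injective a) (hε : 0 ≤ ε) (hε1 : ε ≤ 1)
    (Z : Fin q → Finset ℂ) (hZ : ∀ j u, u ∈ Z j ↔ u ∈ Metric.closedBall (0 : ℂ) r ∧ F u = a j) :
    2 * ((q * (1 - ε) - 2) * modelT F s r - (1 - ε) * ∑ j, ∑ u ∈ Z j, jensenWeight s r u) ≤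
      Real.circleAverage (fun z => Real.log (singDensity F a ε z)) 0 r -
        Real.circleAverage (fun z => Real.log (singDensity F a ε z)) 0 s := by
  have hsub : Metric.closedBall (0 : ℂ) r ⊆ Metric.ball 0 R := Metric.closedBall_subset_ball hrR
  have h1 := jensen_wronskian hs hsr (fun z hz => H.left z (hsub hz)) (fun z hz => H.right z (hsub hz))
    (fun j => sphereVec (a j)) (fun j => norm_sphereVec (a j))
    (fun u hu i j hi hj => ha (((H.comb_eq_zero_iff (hsub hu) _).1 hi).symm.trans
      ((H.comb_eq_zero_iff (hsub hu) _).1 hj)))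
    (fun u hu => H.not_eventually_wronskian (hsub hu) (hF u (hsub hu)) (hnc u (hsub hu))) Z
    (fun j u => by
      rw [hZ]
      exact and_congr_right fun hu => (H.comb_eq_zero_iff (hsub hu) _).symm)
    (c := 1 - ε) (by linarith) (by linarith)
  have h2 := H.circleAverage_log_wnorm hs hsr hrR
  rw [H.circleAverage_log_singDensity (hs.trans_le hsr) hrR hF hnc,
    H.circleAverage_log_singDensity hs (hsr.trans_lt hrR) hF hnc]
  rw [Finset.sum_sub_distrib] at h1
  have h3 : Real.circleAverage (fun z => Real.log (wnorm 1 1 g h z)) 0 r =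
      2 * modelT F s r + Real.circleAverage (fun z => Real.log (wnorm 1 1 g h z)) 0 s := by linarith
  rw [h3]
  linarith

end IsRep

lemma measurable_indicator_of_continuousOn {f : ℂ → ℝ} {U : Set ℂ} (hU : IsOpen U)
    (hf : ContinuousOn f U) : Measurable (U.indicator f) := by
  classical
  rw [← piecewise_eq_indicator]
  exact hf.measurable_piecewise continuousOn_const hU.measurableSet

section linear

variable {q : ℕ} {κ : Fin q → ℂ → ℝ≥0∞}

lemma llogInt_const_mul_sum (hκ : ∀ j, Measurable (κ j)) (c : ℝ≥0∞) (s r : ℝ) :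
    llogInt (fun z => c * ∑ j, κ j z) s r = c * ∑ j, llogInt (κ j) s r := by
  have h1 : ∀ ρ, langInt (fun z => c * ∑ j, κ j z) ρ = c * ∑ j, langInt (κ j) ρ := by
    intro ρ
    have hm : ∀ j, Measurable fun θ : ℝ => κ j (ρ * dir θ) := fun j =>
      (hκ j).comp (Continuous.measurable (by fun_prop))
    rw [langInt, lintegral_const_mul _ (Finset.measurable_fun_sum _ fun j _ => hm j),
      lintegral_finsetSum _ fun j _ => hm j]
    rfl
  have h2 : ∀ t, lradInt (fun z => c * ∑ j, κ j z) t = c * ∑ j, lradInt (κ j) t := by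
    intro t
    have hm : ∀ j, Measurable fun ρ : ℝ => ENNReal.ofReal ρ * langInt (κ j) ρ := fun j =>
      ENNReal.measurable_ofReal.mul (measurable_langInt (hκ j))
    have e : ∀ ρ, ENNReal.ofReal ρ * langInt (fun z => c * ∑ j, κ j z) ρ =
        c * ∑ j, ENNReal.ofReal ρ * langInt (κ j) ρ := fun ρ => by
      rw [h1, mul_left_comm, Finset.mul_sum]
    simp only [lradInt, e]
    rw [lintegral_const_mul _ (Finset.measurable_fun_sum _ fun j _ => hm j),
      lintegral_finsetSum _ fun j _ => hm j]
  have hm : ∀ j, Measurable fun t : ℝ => ENNReal.ofReal t⁻¹ * lradInt (κ j) t := fun j =>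
    (ENNReal.measurable_ofReal.comp measurable_inv).mul (measurable_lradInt (κ j))
  have e : ∀ t, ENNReal.ofReal t⁻¹ * lradInt (fun z => c * ∑ j, κ j z) t =
      c * ∑ j, ENNReal.ofReal t⁻¹ * lradInt (κ j) t := fun ρ => by
    rw [h2, mul_left_comm, Finset.mul_sum]
  simp only [llogInt, e]
  rw [lintegral_const_mul _ (Finset.measurable_fun_sum _ fun j _ => hm j),
    lintegral_finsetSum _ fun j _ => hm j]

end linear

/-- The concavity of the logarithm, for means over circles. -/
lemma circleAverage_log_le {ξ : ℂ → ℝ} (hξm : Measurable ξ) (hξ0 : ∀ z, 0 ≤ ξ z) {r M : ℝ}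
    (hr : 0 < r) (hM : 0 < M) (hint : CircleIntegrable (fun z => Real.log (ξ z)) 0 r)
    (hpos : ∀ᶠ z in codiscreteWithin (Metric.sphere (0 : ℂ) |r|), 0 < ξ z)
    (hle : langInt (fun z => ENNReal.ofReal (ξ z)) r ≤ ENNReal.ofReal M) :
    Real.circleAverage (fun z => Real.log (ξ z)) 0 r ≤ Real.log (M / (2 * Real.pi)) := by
  have hpi := Real.pi_pos
  have hmeas : Measurable fun θ : ℝ => ξ (r * dir θ) := hξm.comp (Continuous.measurable (by fun_prop))
  have hle' : -Real.pi ≤ Real.pi := by linarith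
  have hi : IntegrableOn (fun θ : ℝ => ξ (r * dir θ)) (Ioc (-Real.pi) Real.pi) := by
    refine ⟨hmeas.aestronglyMeasurable, ?_⟩
    rw [hasFiniteIntegral_iff_ofReal (Eventually.of_forall fun θ => hξ0 _)]
    exact hle.trans_lt ENNReal.ofReal_lt_top
  have hper : Function.Periodic (fun θ : ℝ => ξ (r * dir θ)) (2 * Real.pi) := by
    intro θ
    have : dir (θ + 2 * Real.pi) = dir θ := by
      simp only [dir]
      push_cast
      rw [add_mul, Complex.exp_add, Complex.exp_two_pi_mul_I, mul_one]
    simp only [this]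
  have hii : IntervalIntegrable (fun θ : ℝ => ξ (r * dir θ)) volume (-Real.pi) (-Real.pi + 2 * Real.pi) := by
    have : -Real.pi + 2 * Real.pi = Real.pi := by ring
    rw [this, intervalIntegrable_iff_integrableOn_Ioc_of_le hle']
    exact hi
  have hci : CircleIntegrable ξ 0 r := by
    have := hper.intervalIntegrable (by positivity) hii 0 (2 * Real.pi)
    simpa only [CircleIntegrable, circleMap_eq_dir] using this
  have havg : Real.circleAverage ξ 0 r ≤ M / (2 * Real.pi) := by
    have h1 := hper.intervalIntegral_add_eq 0 (-Real.pi)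
    have h2 : -Real.pi + 2 * Real.pi = Real.pi := by ring
    rw [zero_add, h2, intervalIntegral.integral_of_le hle'] at h1
    simp only [Real.circleAverage_def, circleMap_eq_dir, smul_eq_mul]
    rw [h1, inv_mul_eq_div]
    gcongr
    rw [← ENNReal.ofReal_le_ofReal_iff hM.le, ofReal_integral_eq_lintegral_ofReal hi
      (Eventually.of_forall fun θ => hξ0 _)]
    exact hle
  set m := M / (2 * Real.pi) with hm
  have hm0 : 0 < m := by positivity
  -- Where `ξ = 0` the value `log 0 = 0` may lie above the tangent line of the logarithm at `m`.
  -- This happens only on a set that circle averages ignore, and there the logarithm is replaced by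
  -- the value of the tangent line at 0.
  let X : ℂ → ℝ := fun z => open Classical in if 0 < ξ z then Real.log (ξ z) else Real.log m - 1
  have hX : (fun z => Real.log (ξ z)) =ᶠ[codiscreteWithin (Metric.sphere (0 : ℂ) |r|)] X := by
    filter_upwards [hpos] with z hz
    simp [X, hz]
  rw [Real.circleAverage_congr_codiscreteWithin hX hr.ne']
  have hXi : CircleIntegrable X 0 r := hint.congr_codiscreteWithin hX
  have hY : CircleIntegrable (fun z => m⁻¹ • ξ z + (Real.log m - 1)) 0 r :=
    (hci.const_fun_smul (a := m⁻¹)).add (circleIntegrable_const _ _ _)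
  have h1 : Real.circleAverage X 0 r ≤
      Real.circleAverage (fun z => m⁻¹ • ξ z + (Real.log m - 1)) 0 r := by
    refine Real.circleAverage_mono hXi hY fun z _ => ?_
    simp only [X, smul_eq_mul]
    split_ifs with hz
    · have := Real.log_le_sub_one_of_pos (div_pos hz hm0)
      rw [Real.log_div hz.ne' hm0.ne'] at this
      rw [inv_mul_eq_div]
      linarith
    · have : 0 ≤ m⁻¹ * ξ z := mul_nonneg (by positivity) (hξ0 z)
      linarith
  have h2 : Real.circleAverage (fun z => m⁻¹ • ξ z + (Real.log m - 1)) 0 r =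
      m⁻¹ * Real.circleAverage ξ 0 r + (Real.log m - 1) := by
    rw [Real.circleAverage_fun_add (hci.const_fun_smul (a := m⁻¹)) (circleIntegrable_const _ _ _),
      Real.circleAverage_fun_smul, Real.circleAverage_const, smul_eq_mul]
  have h3 : m⁻¹ * Real.circleAverage ξ 0 r ≤ 1 := by
    rw [inv_mul_le_iff₀ hm0, mul_one]
    exact havg
  linarith

/-! ### Maps from a disc of finite or infinite radius. -/

/-- The disc of radius `R ≤ ∞` in the plane. -/
def eball (R : EReal) : Set ℂ := {z | ((‖z‖ : ℝ) : EReal) < R}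

lemma isOpen_eball (R : EReal) : IsOpen (eball R) :=
  isOpen_lt (continuous_coe_real_ereal.comp continuous_norm) continuous_const

lemma convex_eball (R : EReal) : Convex ℝ (eball R) := by
  induction R with
  | bot => simp [eball, convex_empty]
  | top => simp [eball, convex_univ]
  | coe R =>
    have : eball R = Metric.ball (0 : ℂ) R := by ext z; simp [eball]
    rw [this]
    exact convex_ball _ _

lemma closedBall_subset_eball {R : EReal} {r : ℝ} (hr : (r : EReal) < R) :
    Metric.closedBall (0 : ℂ) r ⊆ eball R := by
  intro z hz
  have : ‖z‖ ≤ r := by simpa using hz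
  exact lt_of_le_of_lt (EReal.coe_le_coe_iff.2 this) hr

/-- A nonconstant holomorphic map from a disc to the sphere. -/
structure IsHoloDisc (F : ℂ → OnePoint ℂ) (R : EReal) : Prop where
  holo : ∀ z ∈ eball R, HoloAt F z
  not_const : ∀ z ∈ eball R, ∀ c, ¬ ∀ᶠ w in 𝓝 z, F w = c

namespace IsHoloDisc

variable {F : ℂ → OnePoint ℂ} {R : EReal} {q : ℕ} {a : Fin q → OnePoint ℂ} {s r ε : ℝ}

/-- Every estimate at radius `r` needs a pair `g, h` only on a slightly larger disc, so no global
factorization is required. -/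
lemma exists_rep (H : IsHoloDisc F R) (hrR : (r : EReal) < R) :
    ∃ ρ : ℝ, r < ρ ∧ Metric.ball (0 : ℂ) ρ ⊆ eball R ∧ ∃ g h, IsRep F g h (Metric.ball 0 ρ) := by
  obtain ⟨ρ, hρ, hρR⟩ := EReal.lt_iff_exists_real_btwn.1 hrR
  have hsub := closedBall_subset_eball hρR
  exact ⟨ρ, EReal.coe_lt_coe_iff.1 hρ, Metric.ball_subset_closedBall.trans hsub,
    exists_isRep (fun z hz => H.holo z (hsub hz)) fun z hz => H.not_const z (hsub hz)⟩

lemma continuousOn_of_rep (H : IsHoloDisc F R) {f : ℂ → ℝ}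
    (hf : ∀ ρ g h, IsRep F g h (Metric.ball 0 ρ) → ContinuousOn f (Metric.ball 0 ρ)) :
    ContinuousOn f (eball R) := by
  intro z hz
  obtain ⟨ρ, hρ, -, g, h, hrep⟩ := H.exists_rep hz
  have hz' : z ∈ Metric.ball (0 : ℂ) ρ := by simpa using hρ
  exact ((hf ρ g h hrep).continuousAt (Metric.isOpen_ball.mem_nhds hz')).continuousWithinAt

lemma continuousOn_sphDensity (H : IsHoloDisc F R) : ContinuousOn (sphDensity F) (eball R) :=
  H.continuousOn_of_rep fun _ _ _ h => h.continuousOn_sphDensity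

lemma continuousOn_chordSq (H : IsHoloDisc F R) (a : OnePoint ℂ) :
    ContinuousOn (fun z => chordSq (F z) a) (eball R) :=
  H.continuousOn_of_rep fun _ _ _ h => h.continuousOn_chordSq a

lemma measurable_sing (H : IsHoloDisc F R) (a : OnePoint ℂ) (e : ℝ) :
    Measurable ((eball R).indicator fun z => sphDensity F z * chordSq (F z) a ^ e) := by
  have h1 := measurable_indicator_of_continuousOn (isOpen_eball R) H.continuousOn_sphDensity
  have h2 := (measurable_indicator_of_continuousOn (isOpen_eball R)
    (H.continuousOn_chordSq a)).pow_const e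
  convert h1.mul h2 using 1
  ext z
  by_cases hz : z ∈ eball R <;> simp [hz]

lemma measurable_singDensity (H : IsHoloDisc F R) (a : Fin q → OnePoint ℂ) (ε : ℝ) :
    Measurable ((eball R).indicator (singDensity F a ε)) := by
  have h1 := measurable_indicator_of_continuousOn (isOpen_eball R) H.continuousOn_sphDensity
  have h2 := Finset.measurable_fun_prod (Finset.univ : Finset (Fin q)) fun j _ =>
    (measurable_indicator_of_continuousOn (isOpen_eball R)
    (H.continuousOn_chordSq (a j))).pow_const (ε - 1)
  convert h1.mul h2 using 1
  ext z
  by_cases hz : z ∈ eball R <;> simp [hz, singDensity]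

lemma modelT_nonneg (F : ℂ → OnePoint ℂ) (hs : 0 < s) (hsr : s ≤ r) : 0 ≤ modelT F s r := by
  rw [modelT, logInt]
  refine intervalIntegral.integral_nonneg hsr fun t ht => ?_
  refine div_nonneg ?_ (hs.le.trans ht.1)
  exact radInt_nonneg (R := t + 1)
    (fun z _ => mul_nonneg (by have := Real.pi_pos; positivity) (sphDensity_nonneg F z))
    (hs.le.trans ht.1) (by linarith)

/-- The product of the singular factors is bounded by a multiple of their sum, and each summand is
covered by the estimate for a single point. The constant depends on the points and on `ε`, but not
on `r`. -/
lemma exists_llogInt_le (H : IsHoloDisc F R) (hq : 0 < q) (ha : Function.Injective a) (hε : 0 < ε)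
    (hε1 : ε < 1) (hs : 0 < s) : ∃ K > 0, ∀ r : ℝ, s ≤ r → (r : EReal) < R →
      llogInt (fun z => ENNReal.ofReal ((eball R).indicator (singDensity F a ε) z)) s r ≤
        ENNReal.ofReal (K * (1 + modelT F s r)) := by
  obtain ⟨M, hM, hprod⟩ := exists_prod_rpow_le_sum hq ha (e := ε - 1) (by linarith) (by linarith)
  have hpi := Real.pi_pos
  refine ⟨M * (q * (4 * Real.pi / ε ^ 2)), by positivity, fun r hsr hrR => ?_⟩
  obtain ⟨ρ, hrρ, hsub, g, h, hrep⟩ := H.exists_rep hrR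
  let κ : Fin q → ℂ → ℝ≥0∞ := fun j z =>
    ENNReal.ofReal ((eball R).indicator (fun z => sphDensity F z * chordSq (F z) (a j) ^ (ε - 1)) z)
  have hκ : ∀ j, Measurable (κ j) := fun j => (H.measurable_sing (a j) (ε - 1)).ennreal_ofReal
  have hball : ∀ z : ℂ, ‖z‖ ≤ r → z ∈ eball R := fun z hz => hsub (by simpa using hz.trans_lt hrρ)
  have h1 : llogInt (fun z => ENNReal.ofReal ((eball R).indicator (singDensity F a ε) z)) s r ≤
      llogInt (fun z => ENNReal.ofReal M * ∑ j, κ j z) s r := by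
    refine llogInt_mono_on fun z hz => ?_
    simp only [κ, indicator_of_mem (hball z hz)]
    rw [← ENNReal.ofReal_sum_of_nonneg, ← ENNReal.ofReal_mul hM.le]
    · refine ENNReal.ofReal_le_ofReal ?_
      rw [← Finset.mul_sum, mul_left_comm]
      refine mul_le_mul_of_nonneg_left ?_ (sphDensity_nonneg F z)
      -- Over one of the points the product has a factor `0 ^ (ε - 1) = 0`.
      by_cases hz : ∀ j, F z ≠ a j
      · exact hprod (F z) hz
      · push Not at hz
        obtain ⟨j, hj⟩ := hz
        rw [Finset.prod_eq_zero (Finset.mem_univ j)]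
        · exact mul_nonneg hM.le (Finset.sum_nonneg fun j _ => Real.rpow_nonneg (chordSq_nonneg _ _) _)
        · rw [chordSq_eq_zero_iff.2 hj, Real.zero_rpow (by linarith)]
    · exact fun j _ => mul_nonneg (sphDensity_nonneg F z) (Real.rpow_nonneg (chordSq_nonneg _ _) _)
  refine h1.trans ?_
  rw [llogInt_const_mul_sum hκ, mul_assoc, ENNReal.ofReal_mul hM.le]
  gcongr
  have h2 : ∀ j, llogInt (κ j) s r ≤ ENNReal.ofReal (4 * Real.pi / ε ^ 2 * (1 + modelT F s r)) := by
    intro j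
    refine (llogInt_mono_on fun z hz => ?_).trans (hrep.llogInt_singular_le hs hsr hrρ (a j) hε hε1)
    simp only [κ, indicator_of_mem (hball z hz), le_refl]
  refine (Finset.sum_le_sum fun j _ => h2 j).trans (le_of_eq ?_)
  rw [Finset.sum_const, Finset.card_univ, Fintype.card_fin, nsmul_eq_mul, mul_assoc (q : ℝ),
    ENNReal.ofReal_mul (p := (q : ℝ)) (Nat.cast_nonneg q), ENNReal.ofReal_natCast]

/-- The inner integral increases with the radius; if infinite at `r`, it would be infinite on all of
`(r, r']` and so would the outer integral. -/
lemma lradInt_ne_top {κ : ℂ → ℝ≥0∞} {r' : ℝ} (hs : 0 < s) (hsr : s ≤ r) (hrr' : r < r')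
    (h : llogInt κ s r' ≠ ⊤) : lradInt κ r ≠ ⊤ := by
  intro htop
  apply h
  rw [eq_top_iff]
  calc (⊤ : ℝ≥0∞) = ∫⁻ _ in Ioc r r', (⊤ : ℝ≥0∞) := by
        rw [setLIntegral_const, Real.volume_Ioc, ENNReal.top_mul]
        simpa using hrr'
    _ ≤ ∫⁻ t in Ioc r r', ENNReal.ofReal t⁻¹ * lradInt κ t := by
        refine setLIntegral_mono' measurableSet_Ioc fun t ht => ?_
        have h1 : lradInt κ t = ⊤ := top_le_iff.1 (htop ▸ lradInt_mono ht.1.le)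
        have ht0 : 0 < t := (hs.trans_le hsr).trans ht.1
        rw [h1, ENNReal.mul_top]
        simpa using ht0
    _ ≤ llogInt κ s r' := lintegral_mono_set (Ioc_subset_Ioc_left hsr)

/-- The second main theorem at the radii given by Borel's lemma. -/
theorem exists_good_radius (H : IsHoloDisc F R) (hq : 0 < q) (ha : Function.Injective a) (hε : 0 < ε)
    (hε1 : ε < 1) (hs : 0 < s) {γ : ℝ → ℝ}
    (hγpos : ∀ r : ℝ, s < r → (r : EReal) < R → 0 < γ r)
    (hγ : ∀ r₁ : ℝ, s ≤ r₁ → (r₁ : EReal) < R →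
      ∫⁻ r in {r : ℝ | r₁ < r ∧ (r : EReal) < R}, ENNReal.ofReal (γ r) = ⊤) :
    ∃ K > 0, ∃ C : ℝ, ∀ r₁ : ℝ, s ≤ r₁ → (r₁ : EReal) < R → ∃ r : ℝ, r₁ < r ∧ (r : EReal) < R ∧
      ∀ Z : Fin q → Finset ℂ, (∀ j u, u ∈ Z j ↔ u ∈ Metric.closedBall (0 : ℂ) r ∧ F u = a j) →
      2 * ((q * (1 - ε) - 2) * modelT F s r - (1 - ε) * ∑ j, ∑ u ∈ Z j, jensenWeight s r u) ≤
        Real.log (r⁻¹ * (γ r * (1 + r * (γ r * (1 + K * (1 + modelT F s r)) ^ (1 + ε))) ^ (1 + ε))) + C := by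
  obtain ⟨K, hK, hbound⟩ := H.exists_llogInt_le hq ha hε hε1 hs
  refine ⟨K, hK, -Real.log (2 * Real.pi) -
    Real.circleAverage (fun z => Real.log (singDensity F a ε z)) 0 s, fun r₁ hr₁ hr₁R => ?_⟩
  set ξ := (eball R).indicator (singDensity F a ε) with hξ
  have hξm : Measurable ξ := H.measurable_singDensity a ε
  have hξ0 : ∀ z, 0 ≤ ξ z := fun z => indicator_nonneg (fun z _ => singDensity_nonneg F a ε z) z
  set κ : ℂ → ℝ≥0∞ := fun z => ENNReal.ofReal (ξ z) with hκ
  have hκm : Measurable κ := hξm.ennreal_ofReal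
  set J : Set ℝ := {r : ℝ | r₁ < r ∧ (r : EReal) < R} with hJ
  have hJm : MeasurableSet J := by
    have : IsOpen J := isOpen_Ioi.inter (isOpen_lt continuous_coe_real_ereal continuous_const)
    exact this.measurableSet
  have hJs : J ⊆ Ioi s := fun r hr => hr₁.trans_lt hr.1
  have hlog : ∀ r ∈ J, llogInt κ s r ≤ ENNReal.ofReal (K * (1 + modelT F s r)) := fun r hr =>
    hbound r (hJs hr).le hr.2
  have hrad : ∀ r ∈ J, lradInt κ r ≠ ⊤ := by
    intro r hr
    obtain ⟨r', hrr', hr'R⟩ := EReal.lt_iff_exists_real_btwn.1 hr.2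
    have hrr'' := EReal.coe_lt_coe_iff.1 hrr'
    exact lradInt_ne_top hs (hJs hr).le hrr'' (ne_top_of_le_ne_top ENNReal.ofReal_ne_top
      (hlog r' ⟨hr.1.trans hrr'', hr'R⟩))
  have hφle : ∀ r, ∫⁻ x in Ioc s r, ENNReal.ofReal x * langInt κ x ≤ lradInt κ r := fun r =>
    lintegral_mono_set (Ioc_subset_Ioc_left hs.le)
  -- The primitive of `ψ` is `llogInt κ s`, bounded by the characteristic function, and that of `φ`
  -- is at most `lradInt κ`. Both inequalities hold at the same `r`, so `h2` bounds `lradInt` by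
  -- `llogInt`, and `h1` then bounds `langInt` by `lradInt`.
  obtain ⟨r, hr, h1, h2⟩ := exists_le_mul_rpow (φ := fun x => ENNReal.ofReal x * langInt κ x)
    (ψ := fun t => ENNReal.ofReal t⁻¹ * lradInt κ t)
    (ENNReal.measurable_ofReal.mul (measurable_langInt hκm))
    ((ENNReal.measurable_ofReal.comp measurable_inv).mul (measurable_lradInt κ)) hJs hJm hε
    (fun r hr => ne_top_of_le_ne_top (hrad r hr) (hφle r))
    (fun r hr => ne_top_of_le_ne_top ENNReal.ofReal_ne_top (hlog r hr))
    (hγ r₁ hr₁ hr₁R)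
  refine ⟨r, hr.1, hr.2, fun Z hZ => ?_⟩
  have hsr : s < r := hJs hr
  have hr0 : 0 < r := hs.trans hsr
  have hγr : 0 < γ r := hγpos r hsr hr.2
  have hT := modelT_nonneg F hs hsr.le
  set T := modelT F s r with hTdef
  have hp : 0 ≤ 1 + ε := by linarith
  set Y := (1 + K * (1 + T)) ^ (1 + ε) with hY
  have hY0 : 0 ≤ Y := Real.rpow_nonneg (by positivity) _
  have hA : lradInt κ r ≤ ENNReal.ofReal (r * (γ r * Y)) := by
    have h3 : (1 + ∫⁻ x in Ioc s r, ENNReal.ofReal x⁻¹ * lradInt κ x) ^ (1 + ε) ≤ ENNReal.ofReal Y := by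
      rw [hY, ← ENNReal.ofReal_rpow_of_nonneg (by positivity) hp, ENNReal.ofReal_add zero_le_one
        (by positivity), ENNReal.ofReal_one]
      gcongr
      exact hlog r hr
    have h4 : ENNReal.ofReal r⁻¹ * lradInt κ r ≤ ENNReal.ofReal (γ r * Y) := by
      rw [ENNReal.ofReal_mul hγr.le]
      exact h2.trans (by gcongr)
    have h5 : lradInt κ r = ENNReal.ofReal r * (ENNReal.ofReal r⁻¹ * lradInt κ r) := by
      rw [← mul_assoc, ← ENNReal.ofReal_mul hr0.le, mul_inv_cancel₀ hr0.ne', ENNReal.ofReal_one, one_mul]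
    rw [h5, ENNReal.ofReal_mul hr0.le]
    gcongr
  set M := r⁻¹ * (γ r * (1 + r * (γ r * Y)) ^ (1 + ε)) with hM
  have hM0 : 0 < M := by positivity
  have hlang : langInt κ r ≤ ENNReal.ofReal M := by
    have h3 : (1 + ∫⁻ x in Ioc s r, ENNReal.ofReal x * langInt κ x) ^ (1 + ε) ≤
        ENNReal.ofReal ((1 + r * (γ r * Y)) ^ (1 + ε)) := by
      rw [← ENNReal.ofReal_rpow_of_nonneg (by positivity) hp, ENNReal.ofReal_add zero_le_one
        (by positivity), ENNReal.ofReal_one]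
      gcongr
      exact (hφle r).trans hA
    have h4 : ENNReal.ofReal r * langInt κ r ≤ ENNReal.ofReal (γ r * (1 + r * (γ r * Y)) ^ (1 + ε)) := by
      rw [ENNReal.ofReal_mul hγr.le]
      exact h1.trans (by gcongr)
    have h5 : langInt κ r = ENNReal.ofReal r⁻¹ * (ENNReal.ofReal r * langInt κ r) := by
      rw [← mul_assoc, ← ENNReal.ofReal_mul (by positivity), inv_mul_cancel₀ hr0.ne', ENNReal.ofReal_one,
        one_mul]
    rw [h5, hM, ENNReal.ofReal_mul (by positivity)]
    gcongr
  obtain ⟨ρ, hrρ, hsub, g, h, hrep⟩ := H.exists_rep hr.2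
  have hholo : ∀ z ∈ Metric.ball (0 : ℂ) ρ, HoloAt F z := fun z hz => H.holo z (hsub hz)
  have hnc : ∀ z ∈ Metric.ball (0 : ℂ) ρ, ∀ c, ¬ ∀ᶠ w in 𝓝 z, F w = c := fun z hz => H.not_const z (hsub hz)
  have hsph : ∀ z ∈ Metric.sphere (0 : ℂ) |r|, z ∈ Metric.ball (0 : ℂ) ρ := by
    intro z hz
    rw [abs_of_pos hr0] at hz
    simpa using (by simpa using hz : ‖z‖ = r).trans_lt hrρ
  have hξeq : ∀ z ∈ Metric.sphere (0 : ℂ) |r|, ξ z = singDensity F a ε z := fun z hz =>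
    indicator_of_mem (hsub (hsph z hz)) _
  have hcongr : EqOn (fun z => Real.log (ξ z)) (fun z => Real.log (singDensity F a ε z))
      (Metric.sphere 0 |r|) := fun z hz => by simp only [hξeq z hz]
  have hint : CircleIntegrable (fun z => Real.log (ξ z)) 0 r := by
    refine (hrep.circleIntegrable_log_singDensity (a := a) (ε := ε) hr0 hrρ hholo hnc).congr_codiscreteWithin ?_
    filter_upwards [self_mem_codiscreteWithin _] with z hz using (hcongr hz).symm
  have hpos : ∀ᶠ z in codiscreteWithin (Metric.sphere (0 : ℂ) |r|), 0 < ξ z := by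
    have hfin := hrep.finite_bad (a := a) hrρ hholo hnc
    filter_upwards [compl_finite_mem_codiscreteWithin hfin, self_mem_codiscreteWithin _] with z hz hzs
    have hzb := hsph z hzs
    rw [hξeq z hzs]
    have hzc : z ∈ Metric.closedBall (0 : ℂ) r := by
      rw [abs_of_pos hr0] at hzs
      exact Metric.sphere_subset_closedBall hzs
    have hzn : ¬ (wronskian g h z = 0 ∨ ∃ j, comb (sphereVec (a j)) g h z = 0) :=
      fun hh => hz ⟨hzc, hh⟩
    push Not at hzn
    refine mul_pos ?_ (Finset.prod_pos fun j _ => Real.rpow_pos_of_pos ?_ _)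
    · rw [hrep.sphDensity_eq hzb]
      have := wnorm_pos (hrep.ne z hzb)
      have := norm_pos_iff.2 hzn.1
      positivity
    · rw [hrep.chordSq_eq hzb]
      have := wnorm_pos (hrep.ne z hzb)
      have := norm_pos_iff.2 (hzn.2 j)
      positivity
  have hmean := circleAverage_log_le hξm hξ0 hr0 hM0 hint hpos hlang
  rw [Real.circleAverage_congr_sphere hcongr, Real.log_div hM0.ne' (by positivity)] at hmean
  have hcore := hrep.smt_core hs hsr.le hrρ hholo hnc ha hε.le hε1.le Z hZ
  linarith

end IsHoloDisc

/-! ### Counting functions and the growth of the characteristic function. -/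

/-- The counting function of the `a`-points of a map from the disc, without multiplicities. -/
def modelN (F : ℂ → OnePoint ℂ) (a : OnePoint ℂ) (s r : ℝ) : ℝ :=
  ∫ t in s..r, ({z : ℂ | ‖z‖ < t ∧ F z = a}.ncard : ℝ) / t

lemma integral_indicator_inv {s r m : ℝ} (hs : 0 < s) (hsr : s ≤ r) (hmr : m ≤ r) :
    IntervalIntegrable ((Ioi m).indicator fun t : ℝ => t⁻¹) volume s r ∧
      ∫ t in s..r, (Ioi m).indicator (fun t : ℝ => t⁻¹) t = Real.log (r / max s m) := by
  have hmax : 0 < max s m := lt_max_of_lt_left hs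
  have hmaxr : max s m ≤ r := max_le hsr hmr
  have hi : IntervalIntegrable (fun t : ℝ => t⁻¹) volume s r :=
    intervalIntegral.intervalIntegrable_inv (fun t ht => by
      rw [uIcc_of_le hsr] at ht; exact (hs.trans_le ht.1).ne') continuousOn_id
  rw [intervalIntegrable_iff_integrableOn_Ioc_of_le hsr] at hi ⊢
  refine ⟨hi.indicator measurableSet_Ioi, ?_⟩
  rw [intervalIntegral.integral_of_le hsr, setIntegral_indicator measurableSet_Ioi, Ioc_inter_Ioi,
    ← intervalIntegral.integral_of_le hmaxr, integral_inv_of_pos hmax (hmax.trans_le hmaxr)]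

namespace IsHoloDisc

variable {F : ℂ → OnePoint ℂ} {R : EReal} {q : ℕ} {s r : ℝ}

lemma exists_finset (H : IsHoloDisc F R) (hrR : (r : EReal) < R) (a : OnePoint ℂ) :
    ∃ Z : Finset ℂ, ∀ u, u ∈ Z ↔ u ∈ Metric.closedBall (0 : ℂ) r ∧ F u = a := by
  obtain ⟨ρ, hrρ, hsub, g, h, hrep⟩ := H.exists_rep hrR
  have hsub' : Metric.closedBall (0 : ℂ) r ⊆ Metric.ball 0 ρ := Metric.closedBall_subset_ball hrρ
  have hfin : {u ∈ Metric.closedBall (0 : ℂ) r | comb (sphereVec a) g h u = 0}.Finite :=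
    finite_zeros (fun z hz => analyticAt_comb (hrep.left z (hsub' hz)) (hrep.right z (hsub' hz)))
      fun z hz => hrep.not_eventually_comb (hsub' hz) a (H.not_const z (hsub (hsub' hz)))
  refine ⟨hfin.toFinset, fun u => ?_⟩
  rw [Finite.mem_toFinset, mem_ofPred_eq]
  exact and_congr_right fun hu => hrep.comb_eq_zero_iff (hsub' hu) a

/-- A point `u` contributes the integral of `dt / t` over the `t` in `(s, r]` exceeding `‖u‖`, which
is its Jensen weight; points on the outer circle have weight 0. -/
lemma modelN_eq_sum {a : OnePoint ℂ} {Z : Finset ℂ} (hs : 0 < s) (hsr : s ≤ r)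
    (hZ : ∀ u, u ∈ Z ↔ u ∈ Metric.closedBall (0 : ℂ) r ∧ F u = a) :
    modelN F a s r = ∑ u ∈ Z, jensenWeight s r u := by
  have hZr : ∀ u ∈ Z, ‖u‖ ≤ r := fun u hu => by simpa using ((hZ u).1 hu).1
  have h1 : ∀ t ∈ uIcc s r, ({z : ℂ | ‖z‖ < t ∧ F z = a}.ncard : ℝ) / t =
      ∑ u ∈ Z, (Ioi ‖u‖).indicator (fun t : ℝ => t⁻¹) t := by
    intro t ht
    rw [uIcc_of_le hsr] at ht
    have : {z : ℂ | ‖z‖ < t ∧ F z = a} = (Z.filter fun u => ‖u‖ < t : Finset ℂ) := by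
      ext u
      simp only [mem_ofPred_eq, Finset.coe_filter, hZ]
      constructor
      · exact fun hu => ⟨⟨by simpa using hu.1.le.trans ht.2, hu.2⟩, hu.1⟩
      · exact fun hu => ⟨hu.2, hu.1.2⟩
    rw [this, ncard_coe_finset, Finset.card_filter, Nat.cast_sum, Finset.sum_div]
    refine Finset.sum_congr rfl fun u _ => ?_
    by_cases hu : ‖u‖ < t <;> simp [hu]
  rw [modelN, intervalIntegral.integral_congr h1, intervalIntegral.integral_finsetSum
    fun u hu => (integral_indicator_inv hs hsr (hZr u hu)).1]
  exact Finset.sum_congr rfl fun u hu => (integral_indicator_inv hs hsr (hZr u hu)).2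

lemma fs_nonneg (F : ℂ → OnePoint ℂ) (z : ℂ) : 0 ≤ 1 / Real.pi * sphDensity F z :=
  mul_nonneg (by have := Real.pi_pos; positivity) (sphDensity_nonneg F z)

lemma continuousOn_fs (H : IsHoloDisc F R) :
    ContinuousOn (fun z => 1 / Real.pi * sphDensity F z) (eball R) :=
  continuousOn_const.mul H.continuousOn_sphDensity

lemma setLIntegral_fs (H : IsHoloDisc F R) (hr : 0 ≤ r) (hrR : (r : EReal) < R) :
    ∫⁻ z in Metric.ball (0 : ℂ) r, ENNReal.ofReal (1 / Real.pi * sphDensity F z) =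
      ENNReal.ofReal (radInt (fun z => 1 / Real.pi * sphDensity F z) r) := by
  obtain ⟨ρ, hrρ, hsub, -⟩ := H.exists_rep hrR
  rw [← lradInt_ofReal (R := ρ) (fun z _ => fs_nonneg F z) (H.continuousOn_fs.mono hsub) hr hrρ]
  have hm := measurable_indicator_of_continuousOn (isOpen_eball R) H.continuousOn_fs
  have hmem : ∀ z : ℂ, ‖z‖ ≤ r → z ∈ eball R := fun z hz =>
    closedBall_subset_eball hrR (by simpa using hz)
  have h1 : lradInt (fun z => ENNReal.ofReal (1 / Real.pi * sphDensity F z)) r =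
      lradInt (fun z => ENNReal.ofReal ((eball R).indicator
        (fun z => 1 / Real.pi * sphDensity F z) z)) r :=
    le_antisymm (lradInt_mono_on fun z hz => by rw [indicator_of_mem (hmem z hz)])
      (lradInt_mono_on fun z hz => by rw [indicator_of_mem (hmem z hz)])
  rw [h1, ← setLIntegral_ball_eq hm.ennreal_ofReal]
  refine setLIntegral_congr_fun measurableSet_ball fun z hz => ?_
  rw [indicator_of_mem (hmem z (by simpa using (Metric.mem_ball.1 hz).le))]

/-- The Wronskian does not vanish identically near 0, so the continuous density is positive on some
open subset of the disc. -/
lemma radInt_pos (H : IsHoloDisc F R) (hr : 0 < r) (hrR : (r : EReal) < R) :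
    0 < radInt (fun z => 1 / Real.pi * sphDensity F z) r := by
  rw [← ENNReal.ofReal_pos, ← H.setLIntegral_fs hr.le hrR]
  obtain ⟨ρ, hrρ, hsub, g, h, hrep⟩ := H.exists_rep hrR
  have h0 : (0 : ℂ) ∈ Metric.ball (0 : ℂ) ρ := by simpa using hr.trans hrρ
  have hW := hrep.not_eventually_wronskian h0 (H.holo 0 (hsub h0)) (H.not_const 0 (hsub h0))
  obtain ⟨z, hz, hzr⟩ := ((not_eventually.1 hW).and_eventually (Metric.ball_mem_nhds 0 hr)).exists
  have hzρ : z ∈ Metric.ball (0 : ℂ) ρ := Metric.ball_subset_ball hrρ.le hzr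
  have hpos : 0 < 1 / Real.pi * sphDensity F z := by
    have := Real.pi_pos
    rw [hrep.sphDensity_eq hzρ]
    have := wnorm_pos (hrep.ne z hzρ)
    have := norm_pos_iff.2 hz
    positivity
  have hcont := H.continuousOn_fs.mono
    (Metric.ball_subset_closedBall.trans (closedBall_subset_eball hrR))
  have hm := measurable_indicator_of_continuousOn (Metric.isOpen_ball) hcont
  rw [← lintegral_indicator measurableSet_ball]
  have e : (Metric.ball (0 : ℂ) r).indicator (fun z => ENNReal.ofReal (1 / Real.pi * sphDensity F z)) =
      fun z => ENNReal.ofReal ((Metric.ball (0 : ℂ) r).indicator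
        (fun z => 1 / Real.pi * sphDensity F z) z) := by
    ext w
    by_cases hw : w ∈ Metric.ball (0 : ℂ) r <;> simp [hw]
  rw [e, lintegral_pos_iff_support hm.ennreal_ofReal]
  have hev : ∀ᶠ w in 𝓝 z, 0 < (Metric.ball (0 : ℂ) r).indicator
      (fun z => 1 / Real.pi * sphDensity F z) w := by
    filter_upwards [Metric.isOpen_ball.mem_nhds hzr, (hcont.continuousAt
      (Metric.isOpen_ball.mem_nhds hzr)).eventually (lt_mem_nhds hpos)] with w hw hw'
    rwa [indicator_of_mem hw]
  refine Measure.measure_pos_of_mem_nhds volume (x := z) ?_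
  filter_upwards [hev] with w hw
  exact (ENNReal.ofReal_pos.2 hw).ne'

lemma radInt_mono_radius (H : IsHoloDisc F R) (hs : 0 ≤ s) (hsr : s ≤ r) (hrR : (r : EReal) < R) :
    radInt (fun z => 1 / Real.pi * sphDensity F z) s ≤ radInt (fun z => 1 / Real.pi * sphDensity F z) r := by
  have hr0 : 0 ≤ radInt (fun z => 1 / Real.pi * sphDensity F z) r :=
    radInt_nonneg (R := r + 1) (fun z _ => fs_nonneg F z) (hs.trans hsr) (by linarith)
  rw [← ENNReal.ofReal_le_ofReal_iff hr0, ← H.setLIntegral_fs (hs.trans hsr) hrR,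
    ← H.setLIntegral_fs hs (lt_of_le_of_lt (EReal.coe_le_coe_iff.2 hsr) hrR)]
  exact lintegral_mono_set (Metric.ball_subset_ball hsr)

lemma intervalIntegrable_modelT (H : IsHoloDisc F R) (hs : 0 < s) (hsr : s ≤ r) (hrR : (r : EReal) < R) :
    IntervalIntegrable (fun t => radInt (fun z => 1 / Real.pi * sphDensity F z) t / t) volume s r := by
  obtain ⟨ρ, hrρ, hsub, -⟩ := H.exists_rep hrR
  exact intervalIntegrable_log (H.continuousOn_fs.mono hsub) hs hsr hrρ

lemma modelT_mono (H : IsHoloDisc F R) {r' : ℝ} (hs : 0 < s) (hsr : s ≤ r) (hrr' : r ≤ r')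
    (hrR : (r' : EReal) < R) : modelT F s r ≤ modelT F s r' := by
  have h1 := H.intervalIntegrable_modelT hs (hsr.trans hrr') hrR
  have h2 := H.intervalIntegrable_modelT hs hsr (lt_of_le_of_lt (EReal.coe_le_coe_iff.2 hrr') hrR)
  have h3 := H.intervalIntegrable_modelT (hs.trans_le hsr) hrr' hrR
  have h4 : modelT F s r' = modelT F s r + modelT F r r' :=
    (intervalIntegral.integral_add_adjacent_intervals h2 h3).symm
  have := modelT_nonneg F (hs.trans_le hsr) hrr'
  linarith

/-- The area of the image increases with the radius, so its value at `s` is a lower bound in the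
integrand. Thus `log r` is at most a multiple of `T` plus a constant. -/
lemma mul_log_le_modelT (H : IsHoloDisc F R) (hs : 0 < s) (hsr : s ≤ r) (hrR : (r : EReal) < R) :
    radInt (fun z => 1 / Real.pi * sphDensity F z) s * Real.log (r / s) ≤ modelT F s r := by
  rw [← integral_inv_of_pos hs (hs.trans_le hsr), ← intervalIntegral.integral_const_mul]
  refine intervalIntegral.integral_mono_on hsr ?_ (H.intervalIntegrable_modelT hs hsr hrR) fun t ht => ?_
  · exact (intervalIntegral.intervalIntegrable_inv (fun t ht => by
      rw [uIcc_of_le hsr] at ht; exact (hs.trans_le ht.1).ne') continuousOn_id).const_mul _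
  · have ht0 : 0 < t := hs.trans_le ht.1
    rw [div_eq_mul_inv]
    exact mul_le_mul_of_nonneg_right (H.radInt_mono_radius hs.le ht.1
      (lt_of_le_of_lt (EReal.coe_le_coe_iff.2 ht.2) hrR)) (by positivity)

lemma modelT_pos (H : IsHoloDisc F R) (hs : 0 < s) (hsr : s < r) (hrR : (r : EReal) < R) :
    0 < modelT F s r := by
  refine lt_of_lt_of_le ?_ (H.mul_log_le_modelT hs hsr.le hrR)
  refine mul_pos (H.radInt_pos hs (lt_trans (EReal.coe_lt_coe_iff.2 hsr) hrR)) (Real.log_pos ?_)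
  rwa [one_lt_div hs]

end IsHoloDisc

/-! ### The second main theorem with the error absorbed. -/

/-- A weight whose integral diverges at `R`, and whose logarithm is small against `T`. -/
structure IsGrowthWeight (γ : ℝ → ℝ) (T : ℝ → ℝ) (s : ℝ) (R : EReal) : Prop where
  pos : ∀ r : ℝ, s < r → (r : EReal) < R → 0 < γ r
  diverges : ∀ r₁ : ℝ, s ≤ r₁ → (r₁ : EReal) < R →
    ∫⁻ r in {r : ℝ | r₁ < r ∧ (r : EReal) < R}, ENNReal.ofReal (γ r) = ⊤
  log_le : ∃ c : ℝ, ∀ η > 0, ∃ r₁ : ℝ, s ≤ r₁ ∧ (r₁ : EReal) < R ∧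
    ∀ r : ℝ, r₁ < r → (r : EReal) < R → Real.log (γ r) ≤ η * T r + c

namespace IsHoloDisc

variable {F : ℂ → OnePoint ℂ} {R : EReal} {q : ℕ} {s r : ℝ} {γ : ℝ → ℝ}

/-- For `R = ∞`, `T` grows at least like a multiple of `log r`. For finite `R`, a bounded `T` would
bound `log γ` near `R`, and `γ` would have finite integral over a bounded interval. -/
lemma exists_le_modelT (H : IsHoloDisc F R) (hs : 0 < s) (hsR : (s : EReal) < R)
    (hγ : IsGrowthWeight γ (modelT F s) s R) (B : ℝ) :
    ∃ r : ℝ, s ≤ r ∧ (r : EReal) < R ∧ B ≤ modelT F s r := by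
  induction R with
  | bot => simp at hsR
  | top =>
    have hA := H.radInt_pos hs hsR
    set A := radInt (fun z => 1 / Real.pi * sphDensity F z) s
    refine ⟨s * Real.exp (max B 0 / A), le_mul_of_one_le_right hs.le (Real.one_le_exp (by positivity)),
      EReal.coe_lt_top _, ?_⟩
    refine le_trans ?_ (H.mul_log_le_modelT hs
      (le_mul_of_one_le_right hs.le (Real.one_le_exp (by positivity))) (EReal.coe_lt_top _))
    rw [mul_div_cancel_left₀ _ hs.ne', Real.log_exp, mul_div_cancel₀ _ hA.ne']
    exact le_max_left _ _
  | coe ρ =>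
    by_contra! hcon
    obtain ⟨c, hc⟩ := hγ.log_le
    obtain ⟨r₁, hsr₁, hr₁R, hr₁⟩ := hc 1 one_pos
    have hdiv := hγ.diverges r₁ hsr₁ hr₁R
    have hle : ∫⁻ r in {r : ℝ | r₁ < r ∧ (r : EReal) < (ρ : EReal)}, ENNReal.ofReal (γ r) ≤
        ∫⁻ r in Ioo r₁ ρ, ENNReal.ofReal (Real.exp (B + c)) := by
      have e : {r : ℝ | r₁ < r ∧ (r : EReal) < (ρ : EReal)} = Ioo r₁ ρ := by
        ext r; simp [EReal.coe_lt_coe_iff]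
      rw [e]
      refine setLIntegral_mono' measurableSet_Ioo fun r hr => ENNReal.ofReal_le_ofReal ?_
      have hrR : (r : EReal) < ρ := EReal.coe_lt_coe_iff.2 hr.2
      rw [← Real.log_le_iff_le_exp (hγ.pos r (hsr₁.trans_lt hr.1) hrR)]
      have := hr₁ r hr.1 hrR
      have := hcon r (hsr₁.trans hr.1.le) hrR
      linarith
    rw [hdiv, setLIntegral_const, top_le_iff] at hle
    exact ENNReal.mul_ne_top ENNReal.ofReal_ne_top (by simp) hle

/-- A bound for the error term of the second main theorem. -/
lemma log_error_le {γr r T K c ε A s p : ℝ} (hs : 0 < s) (hsr : s < r) (hγr : 0 < γr) (hT : 0 ≤ T)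
    (hK : 0 < K) (hA : 0 < A) (hε : 0 < ε) (hp : p = 1 + ε) (hε1 : ε < 1)
    (hγ : Real.log γr ≤ ε * T + c) (hAT : A * Real.log (r / s) ≤ T) :
    Real.log (r⁻¹ * (γr * (1 + r * (γr * (1 + K * (1 + T)) ^ p)) ^ p)) ≤ ε * (1 / A + 7) * T +
      (|c| + |Real.log s| + 2 * (Real.log (1 + 1 / s) + |c| + 2 * (ε / K + ε + |Real.log (ε / K)|))) := by
  have hr : 0 < r := hs.trans hsr
  set Y := 1 + K * (1 + T) with hY
  have hY1 : 1 ≤ Y := by have : 0 < K * (1 + T) := by positivity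
                         linarith
  have hY0 : 0 < Y := by linarith
  have hp1 : 1 ≤ p := by linarith
  have hlogY : Real.log Y ≤ ε * T + (ε / K + ε + |Real.log (ε / K)|) := by
    -- Applying `log x ≤ x - 1` at `x = ε Y / K` makes the slope in `T` equal to `ε`.
    have h1 := Real.log_le_sub_one_of_pos (mul_pos (div_pos hε hK) hY0)
    rw [Real.log_mul (div_pos hε hK).ne' hY0.ne'] at h1
    have h2 : ε / K * Y = ε / K + ε * (1 + T) := by rw [hY]; field_simp
    have h3 := neg_abs_le (Real.log (ε / K))
    rw [h2] at h1
    linarith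
  have hlogY0 : 0 ≤ Real.log Y := Real.log_nonneg hY1
  have hYp : 1 ≤ Y ^ p := Real.one_le_rpow hY1 (by linarith)
  have hlogr : ε * Real.log r ≤ ε * (1 / A) * T + |Real.log s| := by
    rw [Real.log_div hr.ne' hs.ne'] at hAT
    have h1 : Real.log r ≤ 1 / A * T + Real.log s := by
      have : Real.log r - Real.log s ≤ T / A := by rwa [le_div_iff₀ hA, mul_comm]
      have e : T / A = 1 / A * T := by ring
      linarith
    have h2 : ε * Real.log s ≤ |Real.log s| := by
      calc ε * Real.log s ≤ ε * |Real.log s| := by gcongr; exact le_abs_self _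
        _ ≤ 1 * |Real.log s| := by gcongr
        _ = _ := one_mul _
    nlinarith [mul_le_mul_of_nonneg_left h1 hε.le]
  have hE : γr ≤ Real.exp (ε * T + |c|) := by
    rw [← Real.log_le_iff_le_exp hγr]
    linarith [le_abs_self c]
  have hE1 : 1 ≤ Real.exp (ε * T + |c|) := Real.one_le_exp (by positivity)
  -- The summand 1 is absorbed by `r / s` times factors that are at least 1, turning the sum into a
  -- product.
  have hX : 1 + r * (γr * Y ^ p) ≤ r * (1 + 1 / s) * (Real.exp (ε * T + |c|) * Y ^ p) := by
    have h1 : 1 ≤ r / s := by rw [one_le_div hs]; exact hsr.le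
    have h2 : r * (1 + 1 / s) = r + r / s := by ring
    rw [h2, add_mul, add_comm (1 : ℝ)]
    refine add_le_add (by gcongr) ?_
    calc (1 : ℝ) = 1 * (1 * 1) := by norm_num
      _ ≤ _ := by gcongr
  have hX0 : 0 < 1 + r * (γr * Y ^ p) := by positivity
  have hlogX : Real.log (1 + r * (γr * Y ^ p)) ≤
      Real.log r + Real.log (1 + 1 / s) + (ε * T + |c| + p * Real.log Y) := by
    refine (Real.log_le_log hX0 hX).trans (le_of_eq ?_)
    rw [Real.log_mul (by positivity) (by positivity), Real.log_mul hr.ne' (by positivity),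
      Real.log_mul (Real.exp_pos _).ne' (by positivity), Real.log_exp, Real.log_rpow hY0]
  have hl1 : 0 ≤ Real.log (1 + 1 / s) := Real.log_nonneg (by have : 0 < 1 / s := by positivity
                                                             linarith)
  rw [Real.log_mul (by positivity) (by positivity), Real.log_inv,
    Real.log_mul hγr.ne' (by positivity), Real.log_rpow hX0]
  have hc := le_abs_self c
  have hpY : p * Real.log Y ≤ 2 * (ε * T + (ε / K + ε + |Real.log (ε / K)|)) :=
    (mul_le_mul_of_nonneg_right (by linarith : p ≤ 2) hlogY0).trans (by linarith)
  set B := Real.log (1 + 1 / s) + (ε * T + |c| + p * Real.log Y) with hB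
  have hB0 : 0 ≤ B := by positivity
  -- The coefficient of `log r` is `p = 1 + ε`. The part 1 cancels against the factor `r⁻¹`, and
  -- `hlogr` controls `ε log r`.
  have hpX : p * Real.log (1 + r * (γr * Y ^ p)) ≤ Real.log r + ε * Real.log r + 2 * B := by
    calc p * Real.log (1 + r * (γr * Y ^ p)) ≤ p * (Real.log r + B) := by
          refine mul_le_mul_of_nonneg_left ?_ (by linarith)
          rw [hB]; linarith
      _ = Real.log r + ε * Real.log r + p * B := by rw [hp]; ring
      _ ≤ _ := by
          have := mul_le_mul_of_nonneg_right (by linarith : p ≤ 2) hB0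
          linarith
  -- The 7 counts one `ε T` from `log γ` and twice the `ε T + 2 ε T` contained in `B`.
  have e : ε * (1 / A + 7) * T = ε * (1 / A) * T + 7 * (ε * T) := by ring
  rw [e]
  linarith

/-- The **second main theorem** for maps from a disc, at a sequence of radii. -/
theorem exists_counting_ge (H : IsHoloDisc F R) {a : Fin q → OnePoint ℂ} (hq : 0 < q)
    (ha : Function.Injective a) (hs : 0 < s) (hsR : (s : EReal) < R)
    (hγ : IsGrowthWeight γ (modelT F s) s R) {η : ℝ} (hη : 0 < η) {r₁ : ℝ} (hr₁ : s ≤ r₁)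
    (hr₁R : (r₁ : EReal) < R) :
    ∃ r : ℝ, r₁ < r ∧ (r : EReal) < R ∧
      (q - 2 - η) * modelT F s r ≤ ∑ j, modelN F (a j) s r := by
  have hA := H.radInt_pos hs hsR
  set A := radInt (fun z => 1 / Real.pi * sphDensity F z) s with hAdef
  -- The `q` pays for the loss `q ε T` from the exponents `1 - ε`, and `1 / A + 7` for
  -- `log_error_le`. With `ε L ≤ η / 2` these cost at most `η T / 2`; the constants, at most `η T`
  -- before halving, cost the other half.
  set L : ℝ := q + 1 / A + 7 with hL
  have hL0 : 0 < L := by positivity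
  set ε := min (1 / 2) (η / 2 / L) with hεdef
  have hε : 0 < ε := by positivity
  have hε1 : ε < 1 := (min_le_left _ _).trans_lt (by norm_num)
  have hεη : ε * L ≤ η / 2 := by
    rw [← le_div_iff₀ hL0]
    exact min_le_right _ _
  obtain ⟨K, hK, C, hgood⟩ := H.exists_good_radius hq ha hε hε1 hs hγ.pos hγ.diverges
  obtain ⟨c, hc⟩ := hγ.log_le
  obtain ⟨r₂, hsr₂, hr₂R, hr₂⟩ := hc ε hε
  set c' := |c| + |Real.log s| + 2 * (Real.log (1 + 1 / s) + |c| + 2 * (ε / K + ε + |Real.log (ε / K)|))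
    with hc'
  obtain ⟨r₃, hsr₃, hr₃R, hr₃⟩ := H.exists_le_modelT hs hsR hγ ((c' + C) / η)
  obtain ⟨r, hr, hrR, hmain⟩ := hgood (max r₁ (max r₂ r₃)) (hr₁.trans (le_max_left _ _)) (by
    rw [EReal.coe_strictMono.monotone.map_max, EReal.coe_strictMono.monotone.map_max]
    exact max_lt hr₁R (max_lt hr₂R hr₃R))
  have hrr₁ : r₁ < r := (le_max_left _ _).trans_lt hr
  have hrr₂ : r₂ < r := ((le_max_left _ _).trans (le_max_right _ _)).trans_lt hr
  have hrr₃ : r₃ < r := ((le_max_right _ _).trans (le_max_right _ _)).trans_lt hr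
  have hsr : s < r := hr₁.trans_lt hrr₁
  choose Z hZ using fun j => H.exists_finset hrR (a j)
  refine ⟨r, hrr₁, hrR, ?_⟩
  have hN : ∑ j, modelN F (a j) s r = ∑ j, ∑ u ∈ Z j, jensenWeight s r u :=
    Finset.sum_congr rfl fun j _ => modelN_eq_sum hs hsr.le (hZ j)
  have hN0 : 0 ≤ ∑ j, ∑ u ∈ Z j, jensenWeight s r u :=
    Finset.sum_nonneg fun j _ => Finset.sum_nonneg fun u hu =>
      jensenWeight_nonneg hs hsr.le (by simpa using ((hZ j u).1 hu).1)
  have h1 := hmain Z hZ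
  have hT := modelT_nonneg F hs hsr.le
  have h2 := log_error_le hs hsr (hγ.pos r hsr hrR) hT hK hA hε rfl hε1 (hr₂ r hrr₂ hrR)
    (H.mul_log_le_modelT hs hsr.le hrR)
  have h3 : c' + C ≤ η * modelT F s r := by
    rw [mul_comm, ← div_le_iff₀ hη]
    exact hr₃.trans (H.modelT_mono hs hsr₃ hrr₃.le hrR)
  rw [hN]
  set N := ∑ j, ∑ u ∈ Z j, jensenWeight s r u
  set T := modelT F s r
  have h4 := mul_le_mul_of_nonneg_right hεη hT
  have h5 : 0 ≤ ε * N := by positivity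
  have h6 : 0 ≤ ε * (1 / A + 7) * T := by positivity
  rw [hL] at h4
  nlinarith

end IsHoloDisc

/-! ### Integration along piecewise smooth curves. -/

section curves

variable {S : Type*} [TopologicalSpace S] [ChartedSpace ℂ S]

lemma contDiffOn_transition [IsManifold 𝓘(ℂ) ω S] {e e' : OpenPartialHomeomorph S ℂ}
    (he : e ∈ atlas ℂ S) (he' : e' ∈ atlas ℂ S) :
    ContDiffOn ℂ ω (e' ∘ e.symm) (e.symm.trans e').source := by
  have := (contDiffGroupoid ω 𝓘(ℂ)).compatible he he'
  rw [contDiffGroupoid, mem_groupoid_of_pregroupoid] at this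
  simpa [contDiffPregroupoid] using this.1

omit [ChartedSpace ℂ S] in
lemma mem_transition_source {e e' : OpenPartialHomeomorph S ℂ} {x : S} (h : x ∈ e.source)
    (h' : x ∈ e'.source) : e x ∈ (e.symm.trans e').source := by
  rw [OpenPartialHomeomorph.trans_source]
  exact ⟨e.map_source h, by simpa [h] using h'⟩

lemma hasDerivAt_transition [IsManifold 𝓘(ℂ) ω S] {e e' : OpenPartialHomeomorph S ℂ}
    (he : e ∈ atlas ℂ S) (he' : e' ∈ atlas ℂ S) {x : S} (h : x ∈ e.source) (h' : x ∈ e'.source) :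
    HasDerivAt (e' ∘ e.symm) (deriv (e' ∘ e.symm) (e x)) (e x) :=
  (((contDiffOn_transition he he').contDiffAt ((e.symm.trans e').open_source.mem_nhds
    (mem_transition_source h h'))).differentiableAt (by simp)).hasDerivAt

/-- The integrand of `curveIntegral`. -/
def curveIntegrand (η : HolomorphicForm S) (c : ℝ → S) (t : ℝ) : ℂ :=
  η.coeff (chartAt ℂ (c t)) (chartAt ℂ (c t) (c t)) * deriv (fun s => chartAt ℂ (c t) (c s)) t

lemma curveIntegral_eq (η : HolomorphicForm S) (c : ℝ → S) :
    curveIntegral η c = ∫ t in (0 : ℝ)..1, curveIntegrand η c t := rfl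

/-- The transformation rule of the coefficients and the chain rule cancel, so one fixed chart may be
used along a whole arc instead of a chart that changes with `t`. -/
lemma curveIntegrand_eq [IsManifold 𝓘(ℂ) ω S] (η : HolomorphicForm S) {c : ℝ → S} {t : ℝ}
    {e : OpenPartialHomeomorph S ℂ} (he : e ∈ atlas ℂ S) (hc : c t ∈ e.source)
    (hcont : ContinuousAt c t) (hd : DifferentiableAt ℝ (e ∘ c) t) :
    curveIntegrand η c t = η.coeff e (e (c t)) * deriv (e ∘ c) t := by
  have he' := chart_mem_atlas ℂ (c t)
  have hx := mem_chart_source ℂ (c t)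
  set e' := chartAt ℂ (c t) with he'def
  have h1 : HasDerivAt ((e' ∘ e.symm) ∘ (e ∘ c)) (deriv (e' ∘ e.symm) (e (c t)) * deriv (e ∘ c) t) t :=
    HasDerivAt.comp t (hasDerivAt_transition he he' hc hx) hd.hasDerivAt
  have h2 : (fun s => e' (c s)) =ᶠ[𝓝 t] (e' ∘ e.symm) ∘ (e ∘ c) := by
    filter_upwards [hcont (e.open_source.mem_nhds hc)] with s hs
    simp [e.left_inv hs]
  rw [curveIntegrand, ← he'def, (h1.congr_of_eventuallyEq h2).deriv,
    η.compatible e he e' he' (c t) ⟨hc, hx⟩, mul_assoc]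

lemma curveIntegrand_congr (η : HolomorphicForm S) {c d : ℝ → S} {t : ℝ} (h : c =ᶠ[𝓝 t] d) :
    curveIntegrand η c t = curveIntegrand η d t := by
  have h0 := h.self_of_nhds
  rw [curveIntegrand, curveIntegrand, h0]
  congr 1
  refine Filter.EventuallyEq.deriv_eq ?_
  filter_upwards [h] with s hs
  rw [hs]

lemma curveIntegrand_comp_mul_sub (η : HolomorphicForm S) (c : ℝ → S) (a b t : ℝ) :
    curveIntegrand η (fun s => c (a * s - b)) t = a • curveIntegrand η c (a * t - b) := by
  rw [curveIntegrand, curveIntegrand, ← mul_smul_comm]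
  congr 1
  set e := chartAt ℂ (c (a * t - b))
  rw [deriv_comp_mul_left a (fun s => e (c (s - b))) t, deriv_comp_sub_const (fun s => e (c s)) b (a * t)]

omit [ChartedSpace ℂ S] in
lemma contDiffOn_comp_curve {e : OpenPartialHomeomorph S ℂ} {c d : ℝ → S} {a b a' b' : ℝ} {φ : ℝ → ℝ}
    (h : ContDiffOn ℝ 1 (e ∘ c) (Icc a b ∩ c ⁻¹' e.source)) (hφ : ContDiff ℝ 1 φ)
    (hmaps : MapsTo φ (Icc a' b') (Icc a b)) (heq : EqOn d (c ∘ φ) (Icc a' b')) :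
    ContDiffOn ℝ 1 (e ∘ d) (Icc a' b' ∩ d ⁻¹' e.source) := by
  have h1 : ContDiffOn ℝ 1 ((e ∘ c) ∘ φ) (Icc a' b' ∩ d ⁻¹' e.source) :=
    h.comp hφ.contDiffOn fun t ht => ⟨hmaps ht.1, by
      have : d t ∈ e.source := ht.2
      rwa [heq ht.1] at this⟩
  exact h1.congr fun t ht => by simp [heq ht.1]

/-- The derivative within the closed interval is continuous up to the ends and agrees with the
derivative inside; the endpoints are negligible. -/
lemma integrableOn_curveIntegrand_Icc [IsManifold 𝓘(ℂ) ω S] (η : HolomorphicForm S) {c : ℝ → S}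
    {a b : ℝ} {e : OpenPartialHomeomorph S ℂ} (he : e ∈ atlas ℂ S) (hab : a < b)
    (hc : ContinuousOn c (Icc a b)) (hsub : ∀ t ∈ Icc a b, c t ∈ e.source)
    (hd : ContDiffOn ℝ 1 (e ∘ c) (Icc a b)) : IntegrableOn (curveIntegrand η c) (Icc a b) := by
  have h1 : ContinuousOn (fun t => η.coeff e (e (c t)) * derivWithin (e ∘ c) (Icc a b) t) (Icc a b) := by
    refine ContinuousOn.mul ?_ (hd.continuousOn_derivWithin (uniqueDiffOn_Icc hab) le_rfl)
    exact (η.holomorphic e he).continuousOn.comp hd.continuousOn fun t ht => e.map_source (hsub t ht)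
  rw [integrableOn_Icc_iff_integrableOn_Ioo]
  refine (h1.integrableOn_Icc.mono_set Ioo_subset_Icc_self).congr_fun (fun t ht => ?_) measurableSet_Ioo
  have hn : Icc a b ∈ 𝓝 t := Icc_mem_nhds ht.1 ht.2
  rw [curveIntegrand_eq η he (hsub t (Ioo_subset_Icc_self ht)) (hc.continuousAt hn)
    ((hd.contDiffAt hn).differentiableAt (by simp))]
  simp only [derivWithin_of_mem_nhds hn]

/-- Local integrability suffices on a compact interval, and near each parameter the curve stays in
one chart. -/
lemma integrableOn_curveIntegrand [IsManifold 𝓘(ℂ) ω S] (η : HolomorphicForm S) {c : ℝ → S}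
    {a b : ℝ} (hab : a < b) (hc : ContinuousOn c (Icc a b))
    (hd : ∀ e ∈ atlas ℂ S, ContDiffOn ℝ 1 (e ∘ c) (Icc a b ∩ c ⁻¹' e.source)) :
    IntegrableOn (curveIntegrand η c) (Icc a b) := by
  refine LocallyIntegrableOn.integrableOn_isCompact (fun τ hτ => ?_) isCompact_Icc
  have he := chart_mem_atlas ℂ (c τ)
  have hx := mem_chart_source ℂ (c τ)
  set e := chartAt ℂ (c τ)
  have h1 : c ⁻¹' e.source ∈ 𝓝[Icc a b] τ := hc τ hτ (e.open_source.mem_nhds hx)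
  obtain ⟨δ, hδ, hδs⟩ := Metric.mem_nhdsWithin_iff.1 h1
  set a' := max a (τ - δ / 2)
  set b' := min b (τ + δ / 2)
  have hab' : a' < b' := by
    refine max_lt (lt_min hab ?_) (lt_min ?_ ?_) <;> linarith [hτ.1, hτ.2]
  have hsub : Icc a' b' ⊆ Icc a b := Icc_subset_Icc (le_max_left _ _) (min_le_left _ _)
  have hsrc : ∀ t ∈ Icc a' b', c t ∈ e.source := fun t ht => hδs ⟨by
    rw [Metric.mem_ball, Real.dist_eq, abs_lt]
    have h3 := (le_max_right _ _).trans ht.1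
    have h4 := ht.2.trans (min_le_right _ _)
    constructor <;> linarith, hsub ht⟩
  refine ⟨Icc a' b', ?_, integrableOn_curveIntegrand_Icc η he hab' (hc.mono hsub) hsrc
    ((hd e he).mono fun t ht => ⟨hsub ht, hsrc t ht⟩)⟩
  rw [mem_nhdsWithin]
  refine ⟨Ioo (τ - δ / 2) (τ + δ / 2), isOpen_Ioo, ⟨by linarith, by linarith⟩, fun t ht => ?_⟩
  exact ⟨max_le ht.2.1 ht.1.1.le, le_min ht.2.2 ht.1.2.le⟩

namespace IsPiecewiseC1

variable {c d : ℝ → S}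

lemma intervalIntegrable [IsManifold 𝓘(ℂ) ω S] (η : HolomorphicForm S) (hc : IsPiecewiseC1 c) :
    IntervalIntegrable (curveIntegrand η c) volume 0 1 := by
  obtain ⟨hcont, n, t, h0, h1, hlt, hd⟩ := hc
  have hmem : ∀ i ≤ n, t i ∈ Icc (0 : ℝ) 1 := by
    have hmono : ∀ i j, i ≤ j → j ≤ n → t i ≤ t j := fun i j hij => by
      induction j, hij using Nat.le_induction with
      | base => exact fun _ => le_rfl
      | succ j _ ih => exact fun hj => (ih (by omega)).trans (hlt j (by omega)).le
    exact fun i hi => ⟨h0 ▸ hmono 0 i (Nat.zero_le i) hi, h1 ▸ hmono i n hi le_rfl⟩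
  have key : ∀ i ≤ n, IntervalIntegrable (curveIntegrand η c) volume (t 0) (t i) := by
    intro i
    induction i with
    | zero => exact fun _ => IntervalIntegrable.refl
    | succ i ih =>
      intro hi
      refine (ih (by omega)).trans ?_
      have hlt' := hlt i (by omega)
      rw [intervalIntegrable_iff_integrableOn_Icc_of_le hlt'.le]
      exact integrableOn_curveIntegrand η hlt'
        (hcont.mono (Icc_subset_Icc (hmem i (by omega)).1 (hmem _ hi).2)) (hd i (by omega))
  simpa [h0, h1] using key n le_rfl

lemma reverse (hc : IsPiecewiseC1 c) : IsPiecewiseC1 fun t => c (1 - t) := by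
  obtain ⟨hcont, n, t, h0, h1, hlt, hd⟩ := hc
  refine ⟨hcont.comp (by fun_prop) fun t ht => ⟨by linarith [ht.2], by linarith [ht.1]⟩,
    n, fun i => 1 - t (n - i), by simp [h1], by simp [h0], fun i hi => ?_, fun i hi e he => ?_⟩
  · have := hlt (n - (i + 1)) (by omega)
    rw [show n - (i + 1) + 1 = n - i by omega] at this
    linarith
  · have := hd (n - (i + 1)) (by omega) e he
    rw [show n - (i + 1) + 1 = n - i by omega] at this
    exact contDiffOn_comp_curve this (φ := fun s => 1 - s) (by fun_prop)
      (fun s hs => ⟨by linarith [hs.2], by linarith [hs.1]⟩) fun s _ => rfl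

end IsPiecewiseC1

lemma curveIntegral_reverse (η : HolomorphicForm S) (c : ℝ → S) :
    curveIntegral η (fun t => c (1 - t)) = -curveIntegral η c := by
  have h : ∀ t, curveIntegrand η (fun t => c (1 - t)) t = -curveIntegrand η c (1 - t) := fun t => by
    have := curveIntegrand_comp_mul_sub η c (-1) (-1) t
    have e : ∀ s : ℝ, -1 * s - -1 = 1 - s := fun s => by ring
    simpa only [e, neg_smul, one_smul] using this
  simp only [curveIntegral_eq, h]
  rw [intervalIntegral.integral_neg, intervalIntegral.integral_comp_sub_left (curveIntegrand η c) 1]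
  simp

/-- The concatenation of two curves. -/
def curveTrans (c d : ℝ → S) (t : ℝ) : S := if t ≤ 1 / 2 then c (2 * t) else d (2 * t - 1)

omit [TopologicalSpace S] [ChartedSpace ℂ S] in
lemma curveTrans_left {c d : ℝ → S} {t : ℝ} (ht : t ≤ 1 / 2) : curveTrans c d t = c (2 * t) := if_pos ht

omit [TopologicalSpace S] [ChartedSpace ℂ S] in
lemma curveTrans_right {c d : ℝ → S} (h : c 1 = d 0) {t : ℝ} (ht : 1 / 2 ≤ t) :
    curveTrans c d t = d (2 * t - 1) := by
  rcases ht.eq_or_lt with rfl | ht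
  · rw [curveTrans_left le_rfl]
    norm_num [h]
  · exact if_neg (not_le.2 ht)

lemma IsPiecewiseC1.trans {c d : ℝ → S} (hc : IsPiecewiseC1 c) (hd : IsPiecewiseC1 d) (h : c 1 = d 0) :
    IsPiecewiseC1 (curveTrans c d) := by
  obtain ⟨hccont, n, t, h0, h1, hlt, hdc⟩ := hc
  obtain ⟨hdcont, m, s, k0, k1, hls, hdd⟩ := hd
  have htle : ∀ i < n, t (i + 1) ≤ 1 := fun i hi => by
    have : ∀ j, i + 1 ≤ j → j ≤ n → t (i + 1) ≤ t j := fun j hij => by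
      induction j, hij using Nat.le_induction with
      | base => exact fun _ => le_rfl
      | succ j _ ih => exact fun hj => (ih (by omega)).trans (hlt j (by omega)).le
    exact h1 ▸ this n hi le_rfl
  have hsle : ∀ i ≤ m, 0 ≤ s i := fun i => by
    induction i with
    | zero => exact fun _ => k0.ge
    | succ i ih => exact fun hi => (ih (by omega)).trans (hls i (by omega)).le
  -- Break points of the concatenation. Both formulas give `1 / 2` at `i = n`, so either may be used
  -- there.
  let τ : ℕ → ℝ := fun i => if i ≤ n then t i / 2 else (1 + s (i - n)) / 2
  have hτl : ∀ i ≤ n, τ i = t i / 2 := fun i hi => if_pos hi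
  have hτr : ∀ i, n ≤ i → τ i = (1 + s (i - n)) / 2 := fun i hi => by
    rcases hi.eq_or_lt with rfl | hi
    · simp [τ, h1, k0]
    · exact if_neg (not_le.2 hi)
  refine ⟨?_, n + m, τ, by rw [hτl 0 (Nat.zero_le n), h0, zero_div], by rw [hτr _ (by omega)]; simp [k1],
    fun i hi => ?_, fun i hi e he => ?_⟩
  · have e : Icc (0 : ℝ) 1 = Icc 0 (1 / 2) ∪ Icc (1 / 2) 1 :=
      (Icc_union_Icc_eq_Icc (by norm_num) (by norm_num)).symm
    rw [e]
    refine ContinuousOn.union_of_isClosed ?_ ?_ isClosed_Icc isClosed_Icc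
    · refine ContinuousOn.congr (f := fun t => c (2 * t)) (hccont.comp (by fun_prop) fun t ht => ?_)
        fun t ht => curveTrans_left ht.2
      exact ⟨by linarith [ht.1], by linarith [ht.2]⟩
    · refine ContinuousOn.congr (f := fun t => d (2 * t - 1)) (hdcont.comp (by fun_prop) fun t ht => ?_)
        fun t ht => curveTrans_right h ht.1
      exact ⟨by linarith [ht.1], by linarith [ht.2]⟩
  · rcases lt_or_ge i n with hin | hin
    · rw [hτl i hin.le, hτl (i + 1) hin]
      linarith [hlt i hin]
    · rw [hτr i hin, hτr (i + 1) (by omega), show i + 1 - n = i - n + 1 by omega]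
      linarith [hls (i - n) (by omega)]
  · rcases lt_or_ge i n with hin | hin
    · rw [hτl i hin.le, hτl (i + 1) hin]
      refine contDiffOn_comp_curve (hdc i hin e he) (φ := fun s => 2 * s) (by fun_prop)
        (fun s hs => ⟨by linarith [hs.1], by linarith [hs.2]⟩) fun s hs => curveTrans_left ?_
      linarith [hs.2, htle i hin]
    · rw [hτr i hin, hτr (i + 1) (by omega), show i + 1 - n = i - n + 1 by omega]
      refine contDiffOn_comp_curve (hdd (i - n) (by omega) e he) (φ := fun s => 2 * s - 1) (by fun_prop)
        (fun s hs => ⟨by linarith [hs.1], by linarith [hs.2]⟩) fun s hs => curveTrans_right h ?_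
      linarith [hs.1, hsle (i - n) (by omega)]

lemma curveIntegral_trans [IsManifold 𝓘(ℂ) ω S] (η : HolomorphicForm S) {c d : ℝ → S}
    (hc : IsPiecewiseC1 c) (hd : IsPiecewiseC1 d) (h : c 1 = d 0) :
    curveIntegral η (curveTrans c d) = curveIntegral η c + curveIntegral η d := by
  have hi := (hc.trans hd h).intervalIntegrable η
  have h1 : IntervalIntegrable (curveIntegrand η (curveTrans c d)) volume 0 (1 / 2) :=
    hi.mono_set (by rw [uIcc_of_le, uIcc_of_le] <;> first | exact Icc_subset_Icc (by norm_num) (by norm_num) | norm_num)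
  have h2 : IntervalIntegrable (curveIntegrand η (curveTrans c d)) volume (1 / 2) 1 :=
    hi.mono_set (by rw [uIcc_of_le, uIcc_of_le] <;> first | exact Icc_subset_Icc (by norm_num) (by norm_num) | norm_num)
  rw [curveIntegral_eq, ← intervalIntegral.integral_add_adjacent_intervals h1 h2]
  congr 1
  · have e : ∀ᵐ t : ℝ, t ∈ uIoc (0 : ℝ) (1 / 2) → curveIntegrand η (curveTrans c d) t =
        (2 : ℝ) • curveIntegrand η c (2 * t) := by
      -- At the junction the curve does not agree with the first piece on a neighbourhood, so this
      -- single parameter is discarded.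
      have : ∀ᵐ t : ℝ, t ≠ 1 / 2 := by simp [ae_iff]
      filter_upwards [this] with t ht1 ht
      rw [uIoc_of_le (by norm_num)] at ht
      have ht2 : t < 1 / 2 := lt_of_le_of_ne ht.2 ht1
      have := curveIntegrand_comp_mul_sub η c 2 0 t
      simp only [sub_zero] at this
      rw [← this]
      refine curveIntegrand_congr η ?_
      filter_upwards [Iio_mem_nhds ht2] with s hs using curveTrans_left (le_of_lt hs)
    rw [intervalIntegral.integral_congr_ae e, intervalIntegral.integral_smul,
      intervalIntegral.integral_comp_mul_left (curveIntegrand η c) two_ne_zero, smul_smul]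
    norm_num [curveIntegral_eq]
  · have e : ∀ᵐ t : ℝ, t ∈ uIoc (1 / 2 : ℝ) 1 → curveIntegrand η (curveTrans c d) t =
        (2 : ℝ) • curveIntegrand η d (2 * t - 1) := by
      refine Eventually.of_forall fun t ht => ?_
      rw [uIoc_of_le (by norm_num)] at ht
      rw [← curveIntegrand_comp_mul_sub η d 2 1 t]
      refine curveIntegrand_congr η ?_
      filter_upwards [Ioi_mem_nhds ht.1] with s hs using curveTrans_right h (le_of_lt hs)
    rw [intervalIntegral.integral_congr_ae e, intervalIntegral.integral_smul,
      intervalIntegral.integral_comp_mul_sub (curveIntegrand η d) two_ne_zero, smul_smul]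
    norm_num [curveIntegral_eq]

/-- The curve which is a segment in the coordinate of a chart. -/
def chartSegment (e : OpenPartialHomeomorph S ℂ) (z w : ℂ) (t : ℝ) : S := e.symm (z + t * (w - z))

section segment

variable {e : OpenPartialHomeomorph S ℂ} {z w : ℂ}

omit [ChartedSpace ℂ S] in
lemma chartSegment_zero : chartSegment e z w 0 = e.symm z := by simp [chartSegment]

omit [ChartedSpace ℂ S] in
lemma chartSegment_one : chartSegment e z w 1 = e.symm w := by simp [chartSegment]

omit [ChartedSpace ℂ S] in
lemma continuousAt_chartSegment {t : ℝ} (ht : z + t * (w - z) ∈ e.target) :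
    ContinuousAt (chartSegment e z w) t :=
  ContinuousAt.comp (f := fun t : ℝ => z + t * (w - z)) (e.continuousAt_symm ht) (by fun_prop)

lemma isPiecewiseC1_chartSegment [IsManifold 𝓘(ℂ) ω S] (he : e ∈ atlas ℂ S)
    (hsub : ∀ t ∈ Icc (0 : ℝ) 1, z + t * (w - z) ∈ e.target) : IsPiecewiseC1 (chartSegment e z w) := by
  refine ⟨fun t ht => (continuousAt_chartSegment (hsub t ht)).continuousWithinAt,
    1, fun i => i, by simp, by simp, fun i _ => by simp, fun i hi e' he' => ?_⟩
  obtain rfl : i = 0 := by omega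
  have h1 : ContDiffOn ℝ 1 (e' ∘ e.symm) (e.symm.trans e').source :=
    ((contDiffOn_transition he he').restrict_scalars ℝ).of_le (by simp)
  have hφ : ContDiff ℝ 1 fun t : ℝ => z + t * (w - z) :=
    contDiff_const.add (Complex.ofRealCLM.contDiff.mul contDiff_const)
  refine h1.comp hφ.contDiffOn fun t ht => ?_
  rw [OpenPartialHomeomorph.trans_source]
  exact ⟨hsub t (by simpa using ht.1), ht.2⟩

lemma curveIntegral_chartSegment [IsManifold 𝓘(ℂ) ω S] (η : HolomorphicForm S) (he : e ∈ atlas ℂ S)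
    (hsub : ∀ t ∈ Icc (0 : ℝ) 1, z + t * (w - z) ∈ e.target) {G : ℂ → ℂ}
    (hG : ∀ t ∈ Icc (0 : ℝ) 1, HasDerivAt G (η.coeff e (z + t * (w - z))) (z + t * (w - z))) :
    curveIntegral η (chartSegment e z w) = G w - G z := by
  have hφ : ∀ t : ℝ, HasDerivAt (fun t : ℝ => z + t * (w - z)) (w - z) t := fun t => by
    simpa using (((hasDerivAt_id t).ofReal_comp).mul_const (w - z)).const_add z
  have h1 : ∀ t ∈ uIcc (0 : ℝ) 1, curveIntegrand η (chartSegment e z w) t =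
      η.coeff e (z + t * (w - z)) * (w - z) := by
    intro t ht
    rw [uIcc_of_le zero_le_one] at ht
    have hev : e ∘ chartSegment e z w =ᶠ[𝓝 t] fun t : ℝ => z + t * (w - z) := by
      filter_upwards [(hφ t).continuousAt (e.open_target.mem_nhds (hsub t ht))] with s hs
      exact e.right_inv hs
    have hd := (hφ t).congr_of_eventuallyEq hev
    rw [curveIntegrand_eq η he (e.map_target (hsub t ht)) (continuousAt_chartSegment (hsub t ht))
      hd.differentiableAt, hd.deriv, chartSegment, e.right_inv (hsub t ht)]
  rw [curveIntegral_eq, intervalIntegral.integral_congr h1,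
    intervalIntegral.integral_eq_sub_of_hasDerivAt (f := fun t : ℝ => G (z + t * (w - z)))]
  · simp
  · intro t ht
    rw [uIcc_of_le zero_le_one] at ht
    exact HasDerivAt.comp t (hG t ht) (hφ t)
  · refine ContinuousOn.intervalIntegrable ?_
    rw [uIcc_of_le zero_le_one]
    refine ContinuousOn.mul ?_ continuousOn_const
    exact (η.holomorphic e he).continuousOn.comp (Continuous.continuousOn (by fun_prop)) fun t ht => hsub t ht

end segment

end curves

/-! ### The integral of the form as a local coordinate. -/

section uniformization

variable {S : Type*} [TopologicalSpace S] [ChartedSpace ℂ S] [IsManifold 𝓘(ℂ) ω S]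
  {η : HolomorphicForm S} {o : S}

lemma add_mul_sub_mem_ball {z w c : ℂ} {ρ : ℝ} (hz : z ∈ Metric.ball c ρ) (hw : w ∈ Metric.ball c ρ)
    {t : ℝ} (ht : t ∈ Icc (0 : ℝ) 1) : z + t * (w - z) ∈ Metric.ball c ρ := by
  have := (convex_ball c ρ).add_smul_sub_mem hz hw ht
  simpa using this

lemma exists_curve_of_ball {e : OpenPartialHomeomorph S ℂ} (he : e ∈ atlas ℂ S) {c : ℂ} {ρ : ℝ}
    (hρ : Metric.ball c ρ ⊆ e.target) {z w : ℂ} (hz : z ∈ Metric.ball c ρ) (hw : w ∈ Metric.ball c ρ)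
    (h : ∃ γ : ℝ → S, IsPiecewiseC1 γ ∧ γ 0 = o ∧ γ 1 = e.symm z) :
    ∃ γ : ℝ → S, IsPiecewiseC1 γ ∧ γ 0 = o ∧ γ 1 = e.symm w := by
  obtain ⟨γ, hγ, h0, h1⟩ := h
  have hσ := isPiecewiseC1_chartSegment he (z := z) (w := w) fun t ht => hρ (add_mul_sub_mem_ball hz hw ht)
  refine ⟨curveTrans γ (chartSegment e z w), hγ.trans hσ (h1.trans chartSegment_zero.symm), ?_, ?_⟩
  · rw [curveTrans_left (by norm_num), mul_zero, h0]
  · rw [curveTrans_right (h1.trans chartSegment_zero.symm) (by norm_num)]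
    norm_num [chartSegment_one]

/-- Any point of a connected surface is the end of a piecewise `C¹` curve. -/
theorem exists_curve [ConnectedSpace S] (o x : S) :
    ∃ γ : ℝ → S, IsPiecewiseC1 γ ∧ γ 0 = o ∧ γ 1 = x := by
  set A : Set S := {x | ∃ γ : ℝ → S, IsPiecewiseC1 γ ∧ γ 0 = o ∧ γ 1 = x} with hA
  -- Membership in `A` is locally constant, because inside a coordinate disc a curve can be
  -- prolonged by a segment in either direction.
  have key : ∀ x : S, ∃ U ∈ 𝓝 x, ∀ y ∈ U, x ∈ A ↔ y ∈ A := by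
    intro x
    have he := chart_mem_atlas ℂ x
    have hx := mem_chart_source ℂ x
    set e := chartAt ℂ x
    obtain ⟨ρ, hρ, hsub⟩ := Metric.isOpen_iff.1 e.open_target (e x) (e.map_source hx)
    refine ⟨e.source ∩ e ⁻¹' Metric.ball (e x) ρ, ?_, fun y hy => ?_⟩
    · exact inter_mem (e.open_source.mem_nhds hx) ((e.continuousAt hx) (Metric.ball_mem_nhds _ hρ))
    · have h1 := exists_curve_of_ball (o := o) he hsub (Metric.mem_ball_self hρ) hy.2
      have h2 := exists_curve_of_ball (o := o) he hsub hy.2 (Metric.mem_ball_self hρ)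
      rw [e.left_inv hx, e.left_inv hy.1] at h1 h2
      exact ⟨h1, h2⟩
  have hcl : IsClopen A := by
    refine ⟨⟨isOpen_iff_mem_nhds.2 fun x hx => ?_⟩, isOpen_iff_mem_nhds.2 fun x hx => ?_⟩
    · obtain ⟨U, hU, h⟩ := key x
      exact mem_of_superset hU fun y hy hyA => hx ((h y hy).2 hyA)
    · obtain ⟨U, hU, h⟩ := key x
      exact mem_of_superset hU fun y hy => (h y hy).1 hx
  have ho : o ∈ A := by
    have he := chart_mem_atlas ℂ o
    have hx := mem_chart_source ℂ o
    refine ⟨chartSegment (chartAt ℂ o) (chartAt ℂ o o) (chartAt ℂ o o),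
      isPiecewiseC1_chartSegment he fun t _ => ?_, ?_, ?_⟩
    · simp
    · rw [chartSegment_zero, (chartAt ℂ o).left_inv hx]
    · rw [chartSegment_one, (chartAt ℂ o).left_inv hx]
  have hx : x ∈ A := hcl.eq_univ ⟨o, ho⟩ ▸ mem_univ x
  exact hx

namespace IsSRiemannSurface

/-- Following `c` and then `d` backwards gives a closed curve, whose period is 0. -/
lemma curveIntegral_eq_of_endpoints (hS : IsSRiemannSurface η o) {c d : ℝ → S} (hc : IsPiecewiseC1 c)
    (hd : IsPiecewiseC1 d) (h0 : c 0 = d 0) (h1 : c 1 = d 1) : curveIntegral η c = curveIntegral η d := by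
  have hr : c 1 = (fun t => d (1 - t)) 0 := by simp [h1]
  have h := hS.period_eq_zero _ (hc.trans hd.reverse hr) (by
    rw [curveTrans_left (by norm_num), curveTrans_right hr (by norm_num)]
    norm_num [h0])
  rw [curveIntegral_trans η hc hd.reverse hr, curveIntegral_reverse, add_neg_eq_zero] at h
  exact h

lemma hat_eq (hS : IsSRiemannSurface η o) {c : ℝ → S} (hc : IsPiecewiseC1 c) (h0 : c 0 = o) :
    hat η o (c 1) = curveIntegral η c := by
  have H : ∃ d : ℝ → S, IsPiecewiseC1 d ∧ d 0 = o ∧ d 1 = c 1 := ⟨c, hc, h0, rfl⟩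
  rw [hat, dif_pos H]
  exact hS.curveIntegral_eq_of_endpoints H.choose_spec.1 hc (H.choose_spec.2.1.trans h0.symm)
    H.choose_spec.2.2

variable [ConnectedSpace S]

/-- On a coordinate disc the coefficient has a primitive `G`. Prolonging a curve by a segment
changes the integral by a difference of values of `G`, so `hat` differs from `G` by a constant. -/
lemma hasDerivAt_hat (hS : IsSRiemannSurface η o) {e : OpenPartialHomeomorph S ℂ} (he : e ∈ atlas ℂ S)
    {z : ℂ} (hz : z ∈ e.target) : HasDerivAt (fun w => hat η o (e.symm w)) (η.coeff e z) z := by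
  obtain ⟨ρ, hρ, hsub⟩ := Metric.isOpen_iff.1 e.open_target z hz
  obtain ⟨G, hG⟩ := ((η.holomorphic e he).mono hsub).isExactOn_ball
  have hzb := Metric.mem_ball_self (x := z) hρ
  obtain ⟨γ, hγ, h0, h1⟩ := exists_curve o (e.symm z)
  have key : ∀ w ∈ Metric.ball z ρ, hat η o (e.symm w) = curveIntegral η γ + (G w - G z) := by
    intro w hw
    have hin : ∀ t ∈ Icc (0 : ℝ) 1, z + t * (w - z) ∈ Metric.ball z ρ := fun t ht =>
      add_mul_sub_mem_ball hzb hw ht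
    have hσ := isPiecewiseC1_chartSegment he fun t ht => hsub (hin t ht)
    have hj : γ 1 = chartSegment e z w 0 := h1.trans chartSegment_zero.symm
    have h := hS.hat_eq (hγ.trans hσ hj) (by rw [curveTrans_left (by norm_num), mul_zero, h0])
    rw [curveIntegral_trans η hγ hσ hj, curveIntegral_chartSegment η he (fun t ht => hsub (hin t ht))
      fun t ht => hG _ (hin t ht)] at h
    rw [← h, curveTrans_right hj (by norm_num)]
    norm_num [chartSegment_one]
  refine (((hG z hzb).sub_const (G z)).const_add (curveIntegral η γ)).congr_of_eventuallyEq ?_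
  filter_upwards [Metric.ball_mem_nhds z hρ] with w hw using key w hw

omit [IsManifold 𝓘(ℂ) ω S] [ConnectedSpace S] in
lemma hat_chart_ne_zero (hS : IsSRiemannSurface η o) (x : S) :
    η.coeff (chartAt ℂ x) (chartAt ℂ x x) ≠ 0 :=
  hS.ne_zero _ (chart_mem_atlas ℂ x) _ (mem_chart_target ℂ x)

lemma hasStrictDerivAt_hat (hS : IsSRiemannSurface η o) {e : OpenPartialHomeomorph S ℂ}
    (he : e ∈ atlas ℂ S) {z : ℂ} (hz : z ∈ e.target) :
    HasStrictDerivAt (fun w => hat η o (e.symm w)) (η.coeff e z) z := by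
  have h : DifferentiableOn ℂ (fun w => hat η o (e.symm w)) e.target := fun w hw =>
    (hS.hasDerivAt_hat he hw).differentiableAt.differentiableWithinAt
  have := (h.analyticAt (e.open_target.mem_nhds hz)).hasStrictDerivAt
  rwa [(hS.hasDerivAt_hat he hz).deriv] at this

lemma isLocalHomeomorph_hat (hS : IsSRiemannSurface η o) : IsLocalHomeomorph (hat η o) := by
  refine IsLocalHomeomorph.mk _ fun x => ?_
  have he := chart_mem_atlas ℂ x
  have hx := mem_chart_source ℂ x
  have h := (hS.hasStrictDerivAt_hat he (mem_chart_target ℂ x)).hasStrictFDerivAt_equiv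
    (hS.hat_chart_ne_zero x)
  refine ⟨(chartAt ℂ x).trans (h.toOpenPartialHomeomorph _), ?_, fun y hy => ?_⟩
  · rw [OpenPartialHomeomorph.trans_source]
    exact ⟨hx, h.mem_toOpenPartialHomeomorph_source⟩
  · rw [OpenPartialHomeomorph.trans_source] at hy
    simp [(chartAt ℂ x).left_inv hy.1]

end IsSRiemannSurface

end uniformization

/-! ### From local to global coordinate. -/

/-- A local homeomorphism to the plane is injective over a disc if it is so over the centre and if the
preimage of the disc is relatively compact. -/
theorem injOn_preimage_ball_of_isLocalHomeomorph {S : Type*} [TopologicalSpace S] [T2Space S] {p : S → ℂ}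
    (hp : IsLocalHomeomorph p) {r : ℝ} (hr : 0 < r) {K : Set S} (hK : IsCompact K)
    (hsub : p ⁻¹' Metric.ball 0 r ⊆ K) (h0 : ∀ x y, p x = 0 → p y = 0 → x = y) :
    InjOn p (p ⁻¹' Metric.ball 0 r) := by
  have hpc := hp.continuous
  -- `V` is a neighbourhood of the diagonal on which equal images force equal points. Removing it
  -- from the closed relation `p x = p y` on `K` leaves exactly the pairs of distinct points, and
  -- this set `A` is compact.
  set V : Set (S × S) := ⋃ U ∈ {U : Set S | IsOpen U ∧ InjOn p U}, U ×ˢ U with hV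
  have hVo : IsOpen V := isOpen_biUnion fun U hU => hU.1.prod hU.1
  set A : Set (S × S) := (K ×ˢ K ∩ {q | p q.1 = p q.2}) \ V with hA
  have hAc : IsCompact A :=
    ((hK.prod hK).inter_right (isClosed_eq (by fun_prop) (by fun_prop))).diff hVo
  have hdiag : ∀ x y, p x = p y → ((x, y) ∈ V ↔ x = y) := by
    intro x y hxy
    constructor
    · intro h
      obtain ⟨U, hU, hUx⟩ := mem_iUnion₂.1 h
      exact hU.2 hUx.1 hUx.2 hxy
    · rintro rfl
      obtain ⟨e, hx, rfl⟩ := hp x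
      exact mem_iUnion₂.2 ⟨e.source, ⟨e.open_source, e.injOn⟩, hx, hx⟩
  set B : Set ℂ := (fun q : S × S => p q.1) '' A with hB
  have hBc : IsClosed B := (hAc.image (by fun_prop)).isClosed
  have hBmem : ∀ w ∈ Metric.ball (0 : ℂ) r, w ∈ B ↔ ∃ x y, x ≠ y ∧ p x = w ∧ p y = w := by
    intro w hw
    constructor
    · rintro ⟨⟨x, y⟩, ⟨⟨-, hxy⟩, hn⟩, rfl⟩
      exact ⟨x, y, fun h => hn ((hdiag x y hxy).2 h), rfl, Eq.symm hxy⟩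
    · rintro ⟨x, y, hne, rfl, hxy⟩
      refine ⟨(x, y), ⟨⟨⟨hsub hw, hsub ?_⟩, hxy.symm⟩, fun h => hne ((hdiag x y hxy.symm).1 h)⟩, rfl⟩
      rwa [mem_preimage, hxy]
  set B' : Set ℂ := {w | ∃ x y, x ≠ y ∧ p x = w ∧ p y = w} with hB'
  have hBo : IsOpen B' := by
    refine isOpen_iff_mem_nhds.2 ?_
    rintro w ⟨x, y, hne, hx, hy⟩
    obtain ⟨U, W, hU, hW, hxU, hyW, hd⟩ := t2_separation hne
    have h1 : p '' U ∈ 𝓝 w := (hp.isOpenMap U hU).mem_nhds ⟨x, hxU, hx⟩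
    have h2 : p '' W ∈ 𝓝 w := (hp.isOpenMap W hW).mem_nhds ⟨y, hyW, hy⟩
    filter_upwards [h1, h2]
    rintro v ⟨x', hx', rfl⟩ ⟨y', hy', h⟩
    exact ⟨x', y', fun hh => disjoint_left.1 hd hx' (hh ▸ hy'), rfl, h⟩
  -- Within the disc, the values taken at least twice form a closed set by compactness (`B`) and an
  -- open set since `p` is open and `S` is Hausdorff (`B'`). As 0 is not such a value, connectedness
  -- leaves none.
  have hpre : IsPreconnected (Metric.ball (0 : ℂ) r) := (convex_ball 0 r).isPreconnected
  have h0r : (0 : ℂ) ∈ Metric.ball (0 : ℂ) r := Metric.mem_ball_self hr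
  have h0B : (0 : ℂ) ∉ B := fun h => by
    obtain ⟨x, y, hne, hx, hy⟩ := (hBmem 0 h0r).1 h
    exact hne (h0 x y hx hy)
  intro x hx y hy hxy
  by_contra hne
  obtain ⟨w, hw, hwB, hwB'⟩ := hpre Bᶜ B' hBc.isOpen_compl hBo
    (fun w hw => by
      by_cases h : w ∈ B
      · exact Or.inr ((hBmem w hw).1 h)
      · exact Or.inl h)
    ⟨0, h0r, h0B⟩ ⟨p x, hx, x, y, hne, rfl, hxy.symm⟩
  exact hwB ((hBmem w hw).2 hwB')

/-- A local homeomorphism to the plane is surjective over a disc if the preimage of the disc is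
relatively compact and contains a point over the centre. -/
theorem ball_subset_range_of_isLocalHomeomorph {S : Type*} [TopologicalSpace S] {p : S → ℂ}
    (hp : IsLocalHomeomorph p) {r : ℝ} (hr : 0 < r) {K : Set S} (hK : IsCompact K)
    (hsub : p ⁻¹' Metric.ball 0 r ⊆ K) (h0 : (0 : ℂ) ∈ range p) : Metric.ball 0 r ⊆ range p := by
  have hpre : IsPreconnected (Metric.ball (0 : ℂ) r) := (convex_ball 0 r).isPreconnected
  have hKc : IsClosed (p '' K) := (hK.image hp.continuous).isClosed
  by_contra hcon
  obtain ⟨w, hw, hwn⟩ := not_subset.1 hcon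
  -- Inside the disc `range p` and `p '' K` coincide, so the range is both open and closed there.
  obtain ⟨v, hv, ⟨x, hx⟩, hvK⟩ := hpre (range p) (p '' K)ᶜ hp.isOpenMap.isOpen_range hKc.isOpen_compl
    (fun v hv => by
      by_cases h : v ∈ p '' K
      · exact Or.inl (image_subset_range _ _ h)
      · exact Or.inr h)
    ⟨0, Metric.mem_ball_self hr, h0⟩ ⟨w, hw, fun h => hwn (image_subset_range _ _ h)⟩
  exact hvK ⟨x, hsub (by rwa [mem_preimage, hx]), hx⟩

section disc

variable {S : Type*} [TopologicalSpace S] [T2Space S] [ConnectedSpace S] [ChartedSpace ℂ S]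
  [IsManifold 𝓘(ℂ) ω S] {η : HolomorphicForm S} {o : S}

-- Apply the exhaustion property to the radii `r + n`. The only case without compactness at `n = 0`
-- is that the disc of radius `r` is everything, but a nonempty circle of larger radius exists.
omit [T2Space S] [ConnectedSpace S] [IsManifold 𝓘(ℂ) ω S] in
lemma isCompact_closure_disc (hexh : IsExhaustionForm η o) {r : ℝ} (hr : 0 < r)
    (hrR : (r : EReal) < radius η o) : IsCompact (closure (disc η o r)) := by
  have hmono : StrictMono fun n : ℕ => r + n := fun m n h => by
    have : (m : ℝ) < n := Nat.cast_lt.2 h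
    show r + m < r + n
    linarith
  obtain ⟨-, h | ⟨k, hk, hk'⟩⟩ := hexh (fun n => r + n) (by simpa using hr) hmono
    (tendsto_atTop_add_const_left _ _ tendsto_natCast_atTop_atTop)
  · simpa using (h 0).1
  · rcases Nat.eq_zero_or_pos k with rfl | hk0
    · have h0 : disc η o r = univ := by simpa using hk' 0 le_rfl
      obtain ⟨_, ⟨s, -, ⟨x, hx⟩, rfl⟩, hs⟩ := lt_sSup_iff.1 hrR
      have h1 : x ∈ disc η o r := h0 ▸ mem_univ x
      have h2 : ‖hat η o x‖ = s := hx
      have h3 : ‖hat η o x‖ < r := h1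
      rw [h2] at h3
      exact absurd (EReal.coe_lt_coe_iff.1 hs) (not_lt.2 h3.le)
    · simpa using (hk 0 hk0).1

namespace IsSRiemannSurface

variable (hS : IsSRiemannSurface η o) (hexh : IsExhaustionForm η o)

include hS

-- The image of `hat` is open, so no point has maximal modulus: some circle beyond `x` is nonempty
-- and the inequality with the radius is strict.
omit [T2Space S] in
lemma hat_mem_eball (x : S) : hat η o x ∈ eball (radius η o) := by
  have hop : IsOpen (range (hat η o)) := hS.isLocalHomeomorph_hat.isOpenMap.isOpen_range
  have : ¬ range (hat η o) ⊆ Metric.closedBall 0 ‖hat η o x‖ := by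
    intro h
    have h1 := interior_maximal h hop (mem_range_self x)
    rw [interior_closedBall'] at h1
    simp at h1
  obtain ⟨_, ⟨y, rfl⟩, hy⟩ := not_subset.1 this
  have hy' : ‖hat η o x‖ < ‖hat η o y‖ := by simpa using hy
  refine lt_of_lt_of_le (EReal.coe_lt_coe_iff.2 hy') (le_sSup ⟨‖hat η o y‖, ?_, ⟨y, rfl⟩, rfl⟩)
  exact (norm_nonneg _).trans_lt hy'

include hexh

omit [T2Space S] [ConnectedSpace S] [IsManifold 𝓘(ℂ) ω S] hS in
lemma exists_radius (z : ℂ) (hz : z ∈ eball (radius η o)) : ∃ r : ℝ, 0 < r ∧ ‖z‖ < r ∧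
    IsCompact (closure (disc η o r)) := by
  obtain ⟨r, hzr, hr⟩ := EReal.lt_iff_exists_real_btwn.1 hz
  have hzr' := EReal.coe_lt_coe_iff.1 hzr
  have hr0 := (norm_nonneg z).trans_lt hzr'
  exact ⟨r, hr0, hzr', isCompact_closure_disc hexh hr0 hr⟩

omit [T2Space S] [ConnectedSpace S] [IsManifold 𝓘(ℂ) ω S] hS hexh in
lemma preimage_ball_subset (r : ℝ) : hat η o ⁻¹' Metric.ball 0 r ⊆ closure (disc η o r) := fun x hx =>
  subset_closure (by simpa [disc] using hx)

/-- Two points with the same image lie over a disc with relatively compact preimage, and the centre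
of that disc has `o` as its only preimage. -/
lemma injective_hat : Function.Injective (hat η o) := by
  intro x y hxy
  obtain ⟨r, hr, hxr, hK⟩ := exists_radius hexh _ (hS.hat_mem_eball x)
  refine injOn_preimage_ball_of_isLocalHomeomorph hS.isLocalHomeomorph_hat hr hK (preimage_ball_subset r)
    (fun x y hx hy => ?_) (by simpa using hxr) (by simpa [← hxy] using hxr) hxy
  rw [(hS.hat_eq_zero_iff x).1 hx, (hS.hat_eq_zero_iff y).1 hy]

omit [T2Space S] in
lemma range_hat : range (hat η o) = eball (radius η o) := by
  refine Subset.antisymm (range_subset_iff.2 hS.hat_mem_eball) fun z hz => ?_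
  obtain ⟨r, hr, hzr, hK⟩ := exists_radius hexh z hz
  exact ball_subset_range_of_isLocalHomeomorph hS.isLocalHomeomorph_hat hr hK (preimage_ball_subset r)
    ⟨o, (hS.hat_eq_zero_iff o).2 rfl⟩ (by simpa using hzr)

end IsSRiemannSurface

end disc

lemma abs_det_smul_one (a : ℂ) : |(a • (1 : ℂ →L[ℝ] ℂ)).det| = ‖a‖ ^ 2 := by
  have h : ((a • (1 : ℂ →L[ℝ] ℂ) : ℂ →L[ℝ] ℂ) : ℂ →ₗ[ℝ] ℂ) = Algebra.lmul ℝ ℂ a := by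
    ext
    simp
  rw [ContinuousLinearMap.det, h, ← Algebra.norm_apply, Algebra.norm_complex_apply,
    Complex.normSq_eq_norm_sq, abs_of_nonneg (by positivity)]

/-! ### Transfer of the characteristic and counting functions to the disc. -/

section transfer

variable {S : Type*} [TopologicalSpace S] [T2Space S] [ConnectedSpace S] [ChartedSpace ℂ S]
  [IsManifold 𝓘(ℂ) ω S] {η : HolomorphicForm S} {o : S}

/-- The inverse of `hat`. -/
def hatInv [Nonempty S] (η : HolomorphicForm S) (o : S) : ℂ → S := Function.invFun (hat η o)

namespace IsSRiemannSurface

variable (hS : IsSRiemannSurface η o) (hexh : IsExhaustionForm η o)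

include hS hexh

lemma hatInv_hat (x : S) : hatInv η o (hat η o x) = x :=
  Function.leftInverse_invFun (hS.injective_hat hexh) x

omit [T2Space S] in
lemma hat_hatInv {z : ℂ} (hz : z ∈ eball (radius η o)) : hat η o (hatInv η o z) = z :=
  Function.invFun_eq (by rw [← hS.range_hat hexh] at hz; exact hz)

lemma continuousAt_hatInv (x : S) : ContinuousAt (hatInv η o) (hat η o x) := by
  intro U hU
  rw [hS.hatInv_hat hexh] at hU
  rw [mem_map]
  refine mem_of_superset (hS.isLocalHomeomorph_hat.isOpenMap.image_mem_nhds hU) ?_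
  rintro _ ⟨y, hy, rfl⟩
  rwa [mem_preimage, hS.hatInv_hat hexh]

lemma eventually_hatInv_mem {e : OpenPartialHomeomorph S ℂ} {x : S} (hx : x ∈ e.source) :
    ∀ᶠ z in 𝓝 (hat η o x), z ∈ eball (radius η o) ∧ hatInv η o z ∈ e.source := by
  have h := hS.continuousAt_hatInv hexh x
  have hx' : hatInv η o (hat η o x) ∈ e.source := by rwa [hS.hatInv_hat hexh]
  filter_upwards [(isOpen_eball _).mem_nhds (hS.hat_mem_eball x), h (e.open_source.mem_nhds hx')]
    with z hz hz' using ⟨hz, hz'⟩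

lemma hasDerivAt_chart_hatInv {e : OpenPartialHomeomorph S ℂ} (he : e ∈ atlas ℂ S) {x : S}
    (hx : x ∈ e.source) : HasDerivAt (e ∘ hatInv η o) (η.coeff e (e x))⁻¹ (hat η o x) := by
  have hinv := hS.hatInv_hat hexh x
  refine HasDerivAt.of_local_left_inverse (f := fun w => hat η o (e.symm w)) ?_ ?_
    (hS.ne_zero e he _ (e.map_source hx)) ?_
  · refine ContinuousAt.comp ?_ (hS.continuousAt_hatInv hexh x)
    rw [hinv]
    exact e.continuousAt hx
  · rw [Function.comp_apply, hinv]
    exact hS.hasDerivAt_hat he (e.map_source hx)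
  · filter_upwards [hS.eventually_hatInv_mem hexh hx] with z hz
    rw [Function.comp_apply, e.left_inv hz.2, hS.hat_hatInv hexh hz.1]

lemma analyticAt_chart_hatInv {e : OpenPartialHomeomorph S ℂ} (he : e ∈ atlas ℂ S) {x : S}
    (hx : x ∈ e.source) : AnalyticAt ℂ (e ∘ hatInv η o) (hat η o x) := by
  rw [Complex.analyticAt_iff_eventually_differentiableAt]
  filter_upwards [hS.eventually_hatInv_mem hexh hx] with z hz
  have := (hS.hasDerivAt_chart_hatInv hexh he hz.2).differentiableAt
  rwa [hS.hat_hatInv hexh hz.1] at this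

variable {f : S → OnePoint ℂ} (hf : IsMeromorphic f)

lemma sphereCoord_hatInv {e : OpenPartialHomeomorph S ℂ} {x : S} (hx : x ∈ e.source) :
    (fun w => sphereCoord (f (hatInv η o (hat η o x))) (f (hatInv η o w))) =ᶠ[𝓝 (hat η o x)]
      (fun v => sphereCoord (f (e.symm (e x))) (f (e.symm v))) ∘ (e ∘ hatInv η o) := by
  filter_upwards [hS.eventually_hatInv_mem hexh hx] with z hz
  simp only [Function.comp_apply, e.left_inv hz.2, e.left_inv hx, hS.hatInv_hat hexh]

include hf

lemma holoAt_comp_hatInv {z : ℂ} (hz : z ∈ eball (radius η o)) : HoloAt (f ∘ hatInv η o) z := by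
  rw [← hS.range_hat hexh] at hz
  obtain ⟨x, rfl⟩ := hz
  refine ⟨ContinuousAt.comp hf.1.continuousAt (hS.continuousAt_hatInv hexh x), ?_⟩
  have hx := mem_chart_source ℂ x
  refine AnalyticAt.congr ?_ (hS.sphereCoord_hatInv hexh hx).symm
  refine AnalyticAt.comp ?_ (hS.analyticAt_chart_hatInv hexh (chart_mem_atlas ℂ x) hx)
  rw [Function.comp_apply, hS.hatInv_hat hexh]
  exact hf.2 _ (chart_mem_atlas ℂ x) _ (mem_chart_target ℂ x)

/-- In the coordinate `hat`, a meromorphic function is a map from a disc to the sphere. -/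
theorem isHoloDisc (hfc : ¬ ∃ c, ∀ x, f x = c) : IsHoloDisc (f ∘ hatInv η o) (radius η o) := by
  refine ⟨fun z hz => hS.holoAt_comp_hatInv hexh hf hz, fun z hz c hc => hfc ⟨c, fun x => ?_⟩⟩
  have := eq_of_eventually_eq (convex_eball (radius η o)).isPreconnected
    (fun z hz => hS.holoAt_comp_hatInv hexh hf hz) hz hc _ (hS.hat_mem_eball x)
  rwa [Function.comp_apply, hS.hatInv_hat hexh] at this

/-- By the chain rule the derivative in the chart carries an additional factor, the coefficient of
the form; its squared modulus is the real Jacobian of `hat` in the chart. -/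
lemma pullbackFS_eq {e : OpenPartialHomeomorph S ℂ} (he : e ∈ atlas ℂ S) {z : ℂ} (hz : z ∈ e.target) :
    pullbackFS f e z = ENNReal.ofReal (‖η.coeff e z‖ ^ 2) *
      ENNReal.ofReal (1 / Real.pi * sphDensity (f ∘ hatInv η o) (hat η o (e.symm z))) := by
  set x := e.symm z with hx
  have hxs : x ∈ e.source := e.map_target hz
  have hex : e x = z := e.right_inv hz
  have hev := hS.sphereCoord_hatInv hexh (f := f) hxs
  have hd : HasDerivAt (fun v => sphereCoord (f (e.symm (e x))) (f (e.symm v)))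
      (deriv (fun v => sphereCoord (f x) (f (e.symm v))) z) ((e ∘ hatInv η o) (hat η o x)) := by
    rw [Function.comp_apply, hS.hatInv_hat hexh, hex]
    exact (hf.2 e he z hz).differentiableAt.hasDerivAt
  have hd' := HasDerivAt.comp _ hd (hS.hasDerivAt_chart_hatInv hexh he hxs)
  have hc := hS.ne_zero e he z hz
  have hcn : ‖η.coeff e z‖ ≠ 0 := norm_ne_zero_iff.2 hc
  rw [← ENNReal.ofReal_mul (by positivity), sphDensity, pullbackFS]
  congr 1
  simp only [Function.comp_apply, hS.hatInv_hat hexh, ← hx] at hev hd' ⊢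
  rw [hev.deriv_eq, hd'.deriv, hex, norm_mul, norm_inv]
  field_simp

/-- Change of variables on every piece; the images of disjoint pieces remain disjoint since `hat` is
injective. -/
lemma sum_setLIntegral_pullbackFS {n : ℕ} {e : Fin n → OpenPartialHomeomorph S ℂ} {W : Fin n → Set ℂ}
    (h : ∀ i, e i ∈ atlas ℂ S ∧ MeasurableSet (W i) ∧ W i ⊆ (e i).target)
    (hd : Pairwise fun i j => Disjoint ((e i).symm '' W i) ((e j).symm '' W j)) :
    ∑ i, ∫⁻ z in W i, pullbackFS f (e i) z =
      ∫⁻ z in ⋃ i, hat η o '' ((e i).symm '' W i),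
        ENNReal.ofReal (1 / Real.pi * sphDensity (f ∘ hatInv η o) z) := by
  have hinj := hS.injective_hat hexh
  have hder : ∀ i, ∀ z ∈ W i, HasFDerivWithinAt (fun w => hat η o ((e i).symm w))
      ((η.coeff (e i) z) • (1 : ℂ →L[ℝ] ℂ)) (W i) z := fun i z hz =>
    (hS.hasDerivAt_hat (h i).1 ((h i).2.2 hz)).complexToReal_fderiv.hasFDerivWithinAt
  have hinjOn : ∀ i, InjOn (fun w => hat η o ((e i).symm w)) (W i) := fun i =>
    hinj.comp_injOn ((e i).symm.injOn.mono (h i).2.2)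
  have himg : ∀ i, hat η o '' ((e i).symm '' W i) = (fun w => hat η o ((e i).symm w)) '' W i := fun i =>
    image_image _ _ _
  rw [lintegral_iUnion, tsum_fintype]
  · refine Finset.sum_congr rfl fun i _ => ?_
    rw [himg, lintegral_image_eq_lintegral_abs_det_fderiv_mul volume (h i).2.1 (hder i) (hinjOn i)]
    refine setLIntegral_congr_fun (h i).2.1 fun z hz => ?_
    rw [abs_det_smul_one, hS.pullbackFS_eq hexh hf (h i).1 ((h i).2.2 hz)]
  · intro i
    rw [himg]
    exact measurable_image_of_fderivWithin (h i).2.1 (hder i) (hinjOn i)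
  · intro i j hij
    exact (disjoint_image_iff hinj).2 (hd hij)

omit [T2Space S] hf in
lemma image_disc {t : ℝ} (ht : (t : EReal) < radius η o) : hat η o '' disc η o t = Metric.ball 0 t := by
  refine Subset.antisymm ?_ fun z hz => ?_
  · rintro _ ⟨x, hx, rfl⟩
    simpa [disc] using hx
  · have hz' : ‖z‖ < t := by simpa using hz
    have h := hS.hat_hatInv hexh (closedBall_subset_eball ht (Metric.ball_subset_closedBall hz))
    exact ⟨hatInv η o z, by rw [disc, mem_ofPred_eq, h]; exact hz', h⟩

/-- The integral of the pull-back of the Fubini-Study form over a disc, in the coordinate `hat`. -/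
theorem integralForm_pullbackFS {t : ℝ} (ht0 : 0 < t) (ht : (t : EReal) < radius η o) :
    integralForm (pullbackFS f) (disc η o t) =
      ∫⁻ z in Metric.ball (0 : ℂ) t, ENNReal.ofReal (1 / Real.pi * sphDensity (f ∘ hatInv η o) z) := by
  rw [← hS.image_disc hexh ht]
  refine le_antisymm ?_ ?_
  · refine iSup_le fun n => iSup_le fun e => iSup_le fun W => iSup_le fun h => iSup_le fun hd => ?_
    rw [hS.sum_setLIntegral_pullbackFS hexh hf (fun i => ⟨(h i).1, (h i).2.1, (h i).2.2.1⟩) hd]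
    exact lintegral_mono_set (iUnion_subset fun i => image_mono (h i).2.2.2)
  · obtain ⟨F, -, hF⟩ := (isCompact_closure_disc hexh ht0 ht).elim_nhds_subcover
      (fun x => (chartAt ℂ x).source) fun x _ => (chartAt ℂ x).open_source.mem_nhds (mem_chart_source ℂ x)
    let e : Fin F.card → OpenPartialHomeomorph S ℂ := fun i => chartAt ℂ (F.equivFin.symm i : S)
    have he : ∀ i, e i ∈ atlas ℂ S := fun i => chart_mem_atlas ℂ _
    have hcov : ∀ y ∈ disc η o t, ∃ i, y ∈ (e i).source := fun y hy => by
      obtain ⟨x, hx, hy⟩ := mem_iUnion₂.1 (hF (subset_closure hy))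
      exact ⟨F.equivFin ⟨x, hx⟩, by simpa [e] using hy⟩
    have hopen : IsOpen (disc η o t) :=
      isOpen_lt hS.isLocalHomeomorph_hat.continuous.norm continuous_const
    -- To attain the supremum, cut the disc into disjoint measurable pieces: from each chart of a
    -- finite cover remove the domains of smaller index. A point then lies in the piece of its first
    -- chart.
    let W : Fin F.card → Set ℂ := fun i => ((e i).target ∩ (e i).symm ⁻¹' disc η o t) \
      ⋃ j < i, (e i).target ∩ (e i).symm ⁻¹' (e j).source
    have hWsub : ∀ i, W i ⊆ (e i).target := fun i z hz => hz.1.1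
    have hWm : ∀ i, MeasurableSet (W i) := fun i =>
      ((e i).isOpen_inter_preimage_symm hopen).measurableSet.diff
        (isOpen_biUnion fun j _ => (e i).isOpen_inter_preimage_symm (e j).open_source).measurableSet
    have hWdisc : ∀ i, (e i).symm '' W i ⊆ disc η o t := by
      rintro i _ ⟨z, hz, rfl⟩
      exact hz.1.2
    have hlt : ∀ i j, i < j → Disjoint ((e i).symm '' W i) ((e j).symm '' W j) := by
      intro i j hij
      rw [disjoint_left]
      rintro _ ⟨z, hz, rfl⟩ ⟨w, hw, hwz⟩
      refine hw.2 (mem_iUnion₂.2 ⟨i, hij, hw.1.1, ?_⟩)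
      rw [mem_preimage, hwz]
      exact (e i).map_target hz.1.1
    have hdisj : Pairwise fun i j => Disjoint ((e i).symm '' W i) ((e j).symm '' W j) := by
      intro i j hij
      rcases lt_or_gt_of_ne hij with h | h
      · exact hlt i j h
      · exact (hlt j i h).symm
    have hunion : disc η o t ⊆ ⋃ i, (e i).symm '' W i := by
      intro y hy
      obtain ⟨i, hi, hmin⟩ := wellFounded_lt.has_min {i | y ∈ (e i).source} (hcov y hy)
      refine mem_iUnion.2 ⟨i, e i y, ⟨⟨(e i).map_source hi, ?_⟩, fun hcon => ?_⟩, (e i).left_inv hi⟩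
      · rwa [mem_preimage, (e i).left_inv hi]
      · obtain ⟨j, hj, -, hjy⟩ := mem_iUnion₂.1 hcon
        rw [mem_preimage, (e i).left_inv hi] at hjy
        exact hmin j hjy hj
    calc _ ≤ ∫⁻ z in ⋃ i, hat η o '' ((e i).symm '' W i),
          ENNReal.ofReal (1 / Real.pi * sphDensity (f ∘ hatInv η o) z) := by
          rw [← image_iUnion]
          exact lintegral_mono_set (image_mono hunion)
      _ = ∑ i, ∫⁻ z in W i, pullbackFS f (e i) z :=
          (hS.sum_setLIntegral_pullbackFS hexh hf (fun i => ⟨he i, hWm i, hWsub i⟩) hdisj).symm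
      _ ≤ integralForm (pullbackFS f) (disc η o t) := by
          refine le_iSup_of_le F.card (le_iSup_of_le e (le_iSup_of_le W ?_))
          exact le_iSup₂_of_le (fun i => ⟨he i, hWm i, hWsub i, hWdisc i⟩) hdisj le_rfl

theorem charT_eq (hfc : ¬ ∃ c, ∀ x, f x = c) {s r : ℝ} (hs : 0 < s) (hsr : s ≤ r)
    (hr : (r : EReal) < radius η o) : charT η o s f r = modelT (f ∘ hatInv η o) s r := by
  refine intervalIntegral.integral_congr fun t ht => ?_
  rw [uIcc_of_le hsr] at ht
  have ht0 : 0 < t := hs.trans_le ht.1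
  have htR : (t : EReal) < radius η o := lt_of_le_of_lt (EReal.coe_le_coe_iff.2 ht.2) hr
  have H := hS.isHoloDisc hexh hf hfc
  rw [hS.integralForm_pullbackFS hexh hf ht0 htR, H.setLIntegral_fs ht0.le htR,
    ENNReal.toReal_ofReal (H.radInt_pos ht0 htR).le]

omit hf in
theorem simpleN_eq (a : OnePoint ℂ) {s r : ℝ} (hsr : s ≤ r)
    (hr : (r : EReal) < radius η o) : simpleN η o s f a r = modelN (f ∘ hatInv η o) a s r := by
  refine intervalIntegral.integral_congr fun t ht => ?_
  rw [uIcc_of_le hsr] at ht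
  have htR : (t : EReal) < radius η o := lt_of_le_of_lt (EReal.coe_le_coe_iff.2 ht.2) hr
  have himg : {z : ℂ | ‖z‖ < t ∧ (f ∘ hatInv η o) z = a} = hat η o '' {x | x ∈ disc η o t ∧ f x = a} := by
    ext z
    constructor
    · rintro ⟨hz, hfz⟩
      have hz' : z ∈ hat η o '' disc η o t := by rw [hS.image_disc hexh htR]; simpa using hz
      obtain ⟨x, hx, rfl⟩ := hz'
      rw [Function.comp_apply, hS.hatInv_hat hexh] at hfz
      exact ⟨x, ⟨hx, hfz⟩, rfl⟩
    · rintro ⟨x, ⟨hx, hfx⟩, rfl⟩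
      exact ⟨hx, by rw [Function.comp_apply, hS.hatInv_hat hexh, hfx]⟩
  simp only [simpleCount, himg]
  rw [ncard_image_of_injective _ (hS.injective_hat hexh)]

end IsSRiemannSurface

end transfer

/-! ### The metric and the growth condition. -/

section metric

variable {S : Type*} [TopologicalSpace S] [ChartedSpace ℂ S]
  {η : HolomorphicForm S} {o : S} (h : HermitianMetric S)

lemma formNorm_eq {e : OpenPartialHomeomorph S ℂ} (he : e ∈ atlas ℂ S) {x : S} (hx : x ∈ e.source) :
    formNorm h η x = ‖η.coeff e (e x)‖ / √(h.coeff e (e x)) := by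
  have he' := chart_mem_atlas ℂ x
  have hx' := mem_chart_source ℂ x
  rw [formNorm]
  set e' := chartAt ℂ x
  have h1 := η.compatible e he e' he' x ⟨hx, hx'⟩
  have h2 := h.compatible e he e' he' x ⟨hx, hx'⟩
  have hp := h.pos e he _ (e.map_source hx)
  have hp' := h.pos e' he' _ (e'.map_source hx')
  have hd : ‖deriv (e' ∘ e.symm) (e x)‖ ≠ 0 := by
    intro h0
    rw [h0] at h2
    simp [h2] at hp
  rw [h1, h2, norm_mul, Real.sqrt_mul hp'.le, Real.sqrt_sq (norm_nonneg _), mul_div_mul_right _ _ hd]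

lemma continuous_formNorm : Continuous (formNorm h η) := by
  rw [continuous_iff_continuousAt]
  intro x
  have he := chart_mem_atlas ℂ x
  have hx := mem_chart_source ℂ x
  set e := chartAt ℂ x
  have hev : formNorm h η =ᶠ[𝓝 x] fun y => ‖η.coeff e (e y)‖ / √(h.coeff e (e y)) := by
    filter_upwards [e.open_source.mem_nhds hx] with y hy using formNorm_eq h he hy
  refine ContinuousAt.congr ?_ hev.symm
  have hex := e.open_target.mem_nhds (e.map_source hx)
  have h1 : ContinuousAt (fun y => η.coeff e (e y)) x :=
    ContinuousAt.comp ((η.holomorphic e he).continuousOn.continuousAt hex) (e.continuousAt hx)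
  have h2 : ContinuousAt (fun y => h.coeff e (e y)) x :=
    ContinuousAt.comp ((h.smooth e he).continuousOn.continuousAt hex) (e.continuousAt hx)
  exact h1.norm.div h2.sqrt (Real.sqrt_pos.2 (h.pos e he _ (e.map_source hx))).ne'

lemma IsSRiemannSurface.formNorm_pos (hS : IsSRiemannSurface η o) (x : S) : 0 < formNorm h η x :=
  div_pos (norm_pos_iff.2 (hS.hat_chart_ne_zero x))
    (Real.sqrt_pos.2 (h.pos _ (chart_mem_atlas ℂ x) _ (mem_chart_target ℂ x)))

/-- Relative compactness of the disc makes the norms bounded above, so the real supremum is a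
genuine one. -/
lemma IsSRiemannSurface.formNorm_le_supNorm (hS : IsSRiemannSurface η o) (hexh : IsExhaustionForm η o)
    {r : ℝ} (hr : 0 < r) (hrR : (r : EReal) < radius η o) : formNorm h η o ≤ supNorm h η o r := by
  refine le_csSup ?_ ⟨o, ?_, rfl⟩
  · exact ((isCompact_closure_disc hexh hr hrR).bddAbove_image
      (continuous_formNorm h).continuousOn).mono (image_mono subset_closure)
  · rw [disc, mem_ofPred_eq, (hS.hat_eq_zero_iff o).2 rfl, norm_zero]
    exact hr

lemma infNorm_nonneg (r : ℝ) : 0 ≤ infNorm h η o r := by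
  refine Real.sInf_nonneg ?_
  rintro _ ⟨x, -, rfl⟩
  exact div_nonneg (norm_nonneg _) (Real.sqrt_nonneg _)

lemma eventually_toRadius {s : ℝ} (hs : (s : EReal) < radius η o) {P : ℝ → Prop} :
    (∀ᶠ r in toRadius η o, P r) ↔ ∃ r₁ : ℝ, s ≤ r₁ ∧ (r₁ : EReal) < radius η o ∧
      ∀ r : ℝ, r₁ < r → (r : EReal) < radius η o → P r := by
  constructor
  · intro hP
    obtain ⟨U, hU, hUP⟩ := mem_comap.1 hP
    obtain ⟨l, hl, hlU⟩ := (mem_nhdsLT_iff_exists_Ioo_subset' hs).1 hU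
    obtain ⟨r, hlr, hr⟩ := EReal.lt_iff_exists_real_btwn.1 (mem_Iio.1 hl)
    refine ⟨max s r, le_max_left _ _, ?_, fun t ht htR => hUP (hlU ⟨?_, htR⟩)⟩
    · rw [EReal.coe_strictMono.monotone.map_max]
      exact max_lt hs hr
    · exact hlr.trans (EReal.coe_lt_coe_iff.2 ((le_max_right _ _).trans_lt ht))
  · rintro ⟨r₁, -, hr₁, hP⟩
    refine mem_comap.2 ⟨Ioo (r₁ : EReal) (radius η o), Ioo_mem_nhdsLT hr₁, fun r hr => ?_⟩
    exact hP r (EReal.coe_lt_coe_iff.1 hr.1) hr.2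

lemma neBot_toRadius {s : ℝ} (hs : (s : EReal) < radius η o) : (toRadius η o).NeBot := by
  rw [neBot_iff]
  intro hbot
  have : ∀ᶠ r in toRadius η o, False := by rw [hbot]; exact eventually_bot
  obtain ⟨r₁, -, hr₁, hP⟩ := (eventually_toRadius hs).1 this
  obtain ⟨r, hr, hrR⟩ := EReal.lt_iff_exists_real_btwn.1 hr₁
  exact hP r (EReal.coe_lt_coe_iff.1 hr) hrR

/-- Integrability of `γ` on `(0, r₁]` pushes the divergence to the end near `R`. In the growth
condition the term with `C` is nonnegative and the supremum norm is at least the norm at `o`; this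
leaves `log γ ≤ η T + c` with `c` independent of `η`. -/
theorem IsSRiemannSurface.isGrowthWeight (hS : IsSRiemannSurface η o) (hexh : IsExhaustionForm η o)
    {r₀ : ℝ} (hr₀ : 0 < r₀) (hr₀R : (r₀ : EReal) < radius η o)
    {γ : ℝ → ℝ} (hγpos : ∀ r : ℝ, 0 < r → (r : EReal) < radius η o → 0 < γ r)
    (hγint : ∀ r : ℝ, 0 < r → (r : EReal) < radius η o → IntegrableOn γ (Ioc 0 r))
    (hγdiv : ∫⁻ r in {r : ℝ | 0 < r ∧ (r : EReal) < radius η o}, ENNReal.ofReal (γ r) = ⊤)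
    {T : ℝ → ℝ} (hT : ∀ r : ℝ, r₀ < r → (r : EReal) < radius η o → 0 < T r) {C : ℝ} (hC : 0 ≤ C)
    (hgrowth : limsup (fun r : ℝ => (((C * r ^ 2 * (infNorm h η o r)⁻¹ +
      Real.log (γ r * supNorm h η o r)) / T r : ℝ) : EReal)) (toRadius η o) = 0) :
    IsGrowthWeight γ T r₀ (radius η o) := by
  refine ⟨fun r hr hrR => hγpos r (hr₀.trans hr) hrR, fun r₁ hr₁ hr₁R => ?_,
    -Real.log (formNorm h η o), fun ε hε => ?_⟩
  · have hr₁0 : 0 < r₁ := hr₀.trans_le hr₁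
    have hfin : ∫⁻ r in Ioc 0 r₁, ENNReal.ofReal (γ r) ≠ ⊤ := (hγint r₁ hr₁0 hr₁R).lintegral_lt_top.ne
    have hsub : {r : ℝ | 0 < r ∧ (r : EReal) < radius η o} ⊆
        Ioc 0 r₁ ∪ {r : ℝ | r₁ < r ∧ (r : EReal) < radius η o} := fun r hr => by
      rcases le_or_gt r r₁ with h | h
      · exact Or.inl ⟨hr.1, h⟩
      · exact Or.inr ⟨h, hr.2⟩
    have := (lintegral_mono_set (μ := volume) hsub).trans
      (lintegral_union_le (μ := volume) (fun r => ENNReal.ofReal (γ r)) _ _)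
    rw [hγdiv, top_le_iff, ENNReal.add_eq_top] at this
    exact this.resolve_left hfin
  · have hlt := eventually_lt_of_limsup_lt (hgrowth.trans_lt (EReal.coe_pos.2 hε))
    obtain ⟨r₁, hr₁, hr₁R, hP⟩ := (eventually_toRadius hr₀R).1 hlt
    refine ⟨r₁, hr₁, hr₁R, fun r hr hrR => ?_⟩
    have hr' : r₀ < r := hr₁.trans_lt hr
    have h1 := EReal.coe_lt_coe_iff.1 (hP r hr hrR)
    rw [div_lt_iff₀ (hT r hr' hrR)] at h1
    have hpos := hS.formNorm_pos h o
    have hsup := hS.formNorm_le_supNorm h hexh (hr₀.trans hr') hrR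
    have h2 : 0 ≤ C * r ^ 2 * (infNorm h η o r)⁻¹ :=
      mul_nonneg (by positivity) (inv_nonneg.2 (infNorm_nonneg h r))
    rw [Real.log_mul (hγpos r (hr₀.trans hr') hrR).ne' (hpos.trans_le hsup).ne'] at h1
    have := Real.log_le_log hpos hsup
    linarith

end metric

/-! ### The defect relation. -/

/-- A sum of numbers `1 - limsup u j` is at most `2` if `∑ j, u j` is frequently almost `q - 2`. -/
lemma sum_one_sub_limsup_le {q : ℕ} {l : Filter ℝ} [l.NeBot] {u : Fin q → ℝ → ℝ}
    (h0 : ∀ j, ∀ᶠ r in l, 0 ≤ u j r) (h : ∀ ε > 0, ∃ᶠ r in l, (q : ℝ) - 2 - ε ≤ ∑ j, u j r) :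
    ∑ j, (1 - limsup (fun r => (u j r : EReal)) l) ≤ 2 := by
  set L : Fin q → EReal := fun j => limsup (fun r => (u j r : EReal)) l with hL
  have hL0 : ∀ j, 0 ≤ L j := fun j =>
    le_limsup_of_frequently_le ((h0 j).mono fun r hr => EReal.coe_nonneg.2 hr).frequently
  -- An infinite upper limit makes its term `-∞`, which absorbs the whole sum in `EReal`.
  by_cases htop : ∃ j, L j = ⊤
  · obtain ⟨j, hj⟩ := htop
    have hj' : limsup (fun r => (u j r : EReal)) l = ⊤ := hj
    rw [← Finset.add_sum_erase _ _ (Finset.mem_univ j), hj']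
    simp
  · push Not at htop
    have hreal : ∀ j, L j = ((L j).toReal : EReal) := fun j =>
      (EReal.coe_toReal (htop j) (fun hb => by simpa [hb] using hL0 j)).symm
    set m : Fin q → ℝ := fun j => (L j).toReal
    have hsum : ∑ j, (1 - L j) = ((∑ j, (1 - m j) : ℝ) : EReal) := by
      let φ : ℝ →+ EReal := ⟨⟨Real.toEReal, EReal.coe_zero⟩, EReal.coe_add⟩
      refine Eq.trans ?_ (map_sum φ (fun j => 1 - m j) Finset.univ).symm
      refine Finset.sum_congr rfl fun j _ => ?_
      rw [hreal j]
      rfl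
    rw [hsum]
    have key : (q : ℝ) - 2 ≤ ∑ j, m j := by
      refine le_of_forall_pos_le_add fun ε hε => ?_
      have hq : (0 : ℝ) < q + 1 := by positivity
      -- There are `q` errors from the upper limits and one from the frequent lower bound.
      set δ := ε / (q + 1) with hδ
      have hδ0 : 0 < δ := by positivity
      have hev : ∀ᶠ r in l, ∀ j, u j r < m j + δ := by
        rw [eventually_all]
        intro j
        have : L j < ((m j + δ : ℝ) : EReal) := by
          rw [hreal j]
          exact EReal.coe_lt_coe_iff.2 (by linarith)
        exact (eventually_lt_of_limsup_lt this).mono fun r hr => EReal.coe_lt_coe_iff.1 hr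
      obtain ⟨r, hr, hr'⟩ := ((h δ hδ0).and_eventually hev).exists
      have h1 : ∑ j, u j r ≤ ∑ j, (m j + δ) := Finset.sum_le_sum fun j _ => (hr' j).le
      rw [Finset.sum_add_distrib, Finset.sum_const, Finset.card_univ, Fintype.card_fin,
        nsmul_eq_mul] at h1
      have h2 : (q + 1) * δ = ε := by rw [hδ]; field_simp
      linarith
    have : ∑ j, (1 - m j) ≤ 2 := by
      rw [Finset.sum_sub_distrib]
      simp
      linarith
    exact EReal.coe_le_coe_iff.2 this

end SNevanlinna

end

theorem mainTheorem9 {S : Type*} [TopologicalSpace S] [T2Space S] [ConnectedSpace S]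
    [NoncompactSpace S] [ChartedSpace ℂ S] [IsManifold 𝓘(ℂ) ω S]
    (h : SNevanlinna.HermitianMetric S) (𝒮 : SNevanlinna.HolomorphicForm S) (o : S)
    (hS : SNevanlinna.IsSRiemannSurface 𝒮 o) (hexh : SNevanlinna.IsExhaustionForm 𝒮 o)
    (r₀ : ℝ) (hr₀ : 0 < r₀) (hr₀R : (r₀ : EReal) < SNevanlinna.radius 𝒮 o)
    (γ : ℝ → ℝ) (hγpos : ∀ r : ℝ, 0 < r → (r : EReal) < SNevanlinna.radius 𝒮 o → 0 < γ r)
    (hγint : ∀ r : ℝ, 0 < r → (r : EReal) < SNevanlinna.radius 𝒮 o →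
      IntegrableOn γ (Ioc 0 r))
    (hγdiv : ∫⁻ r in {r : ℝ | 0 < r ∧ (r : EReal) < SNevanlinna.radius 𝒮 o},
      ENNReal.ofReal (γ r) = ⊤)
    (f : S → OnePoint ℂ) (hf : SNevanlinna.IsMeromorphic f) (hfc : ¬ ∃ c, ∀ x, f x = c)
    (q : ℕ) (a : Fin q → OnePoint ℂ) (ha : Function.Injective a)
    (C : ℝ) (hC : 0 ≤ C)
    (hK : ∀ x, -C ≤ SNevanlinna.gaussCurvature h x ∧ SNevanlinna.gaussCurvature h x ≤ 0)
    (hgrowth : limsup (fun r : ℝ =>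
        (((C * r ^ 2 * (SNevanlinna.infNorm h 𝒮 o r)⁻¹ +
            Real.log (γ r * SNevanlinna.supNorm h 𝒮 o r)) /
          SNevanlinna.charT 𝒮 o r₀ f r : ℝ) : EReal)) (SNevanlinna.toRadius 𝒮 o) = 0) :
    ∑ j, SNevanlinna.simpleDefect 𝒮 o r₀ f (a j) ≤ 2 := by
  have H := hS.isHoloDisc hexh hf hfc
  set F := f ∘ SNevanlinna.hatInv 𝒮 o
  have hT : ∀ r : ℝ, r₀ < r → (r : EReal) < SNevanlinna.radius 𝒮 o →
      SNevanlinna.charT 𝒮 o r₀ f r = SNevanlinna.modelT F r₀ r := fun r hr hrR =>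
    hS.charT_eq hexh hf hfc hr₀ hr.le hrR
  have hTpos : ∀ r : ℝ, r₀ < r → (r : EReal) < SNevanlinna.radius 𝒮 o →
      0 < SNevanlinna.charT 𝒮 o r₀ f r := fun r hr hrR => by
    rw [hT r hr hrR]
    exact H.modelT_pos hr₀ hr hrR
  have hweight := hS.isGrowthWeight h hexh hr₀ hr₀R hγpos hγint hγdiv hTpos hC hgrowth
  have hweight' : SNevanlinna.IsGrowthWeight γ (SNevanlinna.modelT F r₀) r₀
      (SNevanlinna.radius 𝒮 o) := by
    refine ⟨hweight.pos, hweight.diverges, ?_⟩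
    obtain ⟨c, hc⟩ := hweight.log_le
    refine ⟨c, fun ε hε => ?_⟩
    obtain ⟨r₁, hr₁, hr₁R, hr⟩ := hc ε hε
    exact ⟨r₁, hr₁, hr₁R, fun r hr' hrR => hT r (hr₁.trans_lt hr') hrR ▸ hr r hr' hrR⟩
  have hne := SNevanlinna.neBot_toRadius hr₀R
  -- The case `q = 0` is separate: an empty product 1 is not controlled by an empty sum 0, as the
  -- singular metric would require.
  rcases Nat.eq_zero_or_pos q with rfl | hq
  · simp
  refine SNevanlinna.sum_one_sub_limsup_le (fun j => ?_) fun ε hε => ?_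
  · refine (SNevanlinna.eventually_toRadius hr₀R).2 ⟨r₀, le_rfl, hr₀R, fun r hr hrR => ?_⟩
    refine div_nonneg ?_ (hTpos r hr hrR).le
    exact intervalIntegral.integral_nonneg hr.le fun t ht =>
      div_nonneg (Nat.cast_nonneg _) (hr₀.le.trans ht.1)
  -- If the bound failed at all radii near `R`, it would fail at one supplied by the second main
  -- theorem.
  · intro hcon
    obtain ⟨r₁, hr₁, hr₁R, hr⟩ := (SNevanlinna.eventually_toRadius hr₀R).1 hcon
    obtain ⟨r, hrr₁, hrR, hmain⟩ := H.exists_counting_ge hq ha hr₀ hr₀R hweight' hε hr₁ hr₁R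
    have hr₀r : r₀ < r := hr₁.trans_lt hrr₁
    refine hr r hrr₁ hrR ?_
    simp only
    rw [← Finset.sum_div, le_div_iff₀ (hTpos r hr₀r hrR), hT r hr₀r hrR]
    refine hmain.trans (le_of_eq (Finset.sum_congr rfl fun j _ => ?_))
    exact (hS.simpleN_eq hexh (a j) hr₀r.le hrR).symm
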